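/- Theorem 10 (Pitt's inequality). Let $n\ge 1$, $0<\beta<1$, $1<p\le 2$ and $\frac1p+\frac1{p'}=1$, with $p'\beta<n$. Let $\eta\in S^{n-1}$ be any unit vector of $\mathbb R^n$, put $\lambda=(n-p'\beta)/p'$, and write $\widehat f(\xi)=\int_{\mathbb R^n}e^{-2\pi i x\cdot\xi}f(x)\,dx$. Then for every (complex-valued) Schwartz function $f\in\mathcal S(\mathbb R^n)$ $$\left[\int_{\mathbb R^n}\Big|\,|x|^{-\beta}\,\widehat f(x)\Big|^{p'}dx\right]^{1/p'}\le A\left[\int_{\mathbb R^n}\Big|\,|x|^{\beta}f(x)\Big|^{p}dx\right]^{1/p},$$ $$A=\left[\frac{p^{1/p}}{p'^{\,1/p'}}\right]^{n/2}\;\frac{\left[\int_{\mathbb R^n}|e^{2\pi i w\cdot\eta}-1|^{p'}\,\frac{1}{|w|^{n+p'\beta}}\,dw\right]^{1/p'}}{\left[\int_{\mathbb R^n}\big|1-|x|^{-\lambda}\big|^{p'}\,|x-\eta|^{-n-p'\beta}\,dx\right]^{1/p'}}.$$ All four integrals are finite, and the integral in the denominator of $A$ is positive. -/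

import Mathlib

open MeasureTheory
open scoped FourierTransform SchwartzMap

noncomputable section

/-- The integrand `w ↦ |e^{2πi w·η} - 1|^q / |w|^{n+qβ}` on `ℝⁿ`. -/
def diffKernel (n : ℕ) (β q : ℝ) (η w : EuclideanSpace ℝ (Fin n)) : ℝ :=
  ‖Complex.exp (2 * (Real.pi : ℂ) * Complex.I * ((inner ℝ w η : ℝ) : ℂ)) - 1‖ ^ q
    * (1 / ‖w‖ ^ ((n : ℝ) + q * β))

/-- The integrand `x ↦ |1 - |x|^{-λ}|^q |x - η|^{-n-qβ}` on `ℝⁿ`, with `λ = (n - qβ)/q`. -/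
def steinWeissKernel (n : ℕ) (β q : ℝ) (η x : EuclideanSpace ℝ (Fin n)) : ℝ :=
  |1 - ‖x‖ ^ (-(((n : ℝ) - q * β) / q))| ^ q * ‖x - η‖ ^ (-(n : ℝ) - q * β)

/-- The constant `A` in Pitt's inequality, for the dual exponents `p` and `q`:
`A = [p^{1/p} / q^{1/q}]^{n/2} [∫ |e^{2πi w·η} - 1|^q |w|^{-n-qβ} dw]^{1/q}
  / [∫ |1 - |x|^{-λ}|^q |x - η|^{-n-qβ} dx]^{1/q}`. -/
def pittConstant (n : ℕ) (β p q : ℝ) (η : EuclideanSpace ℝ (Fin n)) : ℝ :=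
  (p ^ (1 / p) / q ^ (1 / q)) ^ ((n : ℝ) / 2)
    * ((∫ w, diffKernel n β q η w) ^ (1 / q) / (∫ x, steinWeissKernel n β q η x) ^ (1 / q))

end

namespace Pitt

/-! Write F = 𝓕 f, q for the exponent dual to p, κ = n + qβ, and let D and E be the numerator and
denominator integrals of the constant. Both sides of the inequality are compared with the double
integral I = ∬ |F(x) − F(y)|^q |x − y|^{−κ} dx dy.

Lower bound (`lintegral_steinWeissKernel_mul_le`): E ∫ |x|^{−qβ} |F|^q ≤ I, a sharp fractional Hardy
inequality. At each pair (x, y), convexity of t^q compares F with the ground state |x|^{−λ}; after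
integration the unwanted coefficients cancel, by inversion of a homogeneous kernel.

Upper bound (`lintegral_lintegral_fourier_sub_le`): with y = x − w, F(x − w) − F(x) is the Fourier
transform of (e^{2πi w·v} − 1) f(v). The sharp Hausdorff–Young inequality is applied for each w, and
Minkowski's inequality with exponent q/p ≥ 1 exchanges the integrals in w and v. By scaling, ∫
|e^{2πi w·v} − 1|^q |w|^{−κ} dw = D |v|^{qβ}, which produces the weight |v|^β.

The sharp Hausdorff–Young inequality is itself proved here. For a trigonometric polynomial φ times a
Gaussian it amounts to hypercontractivity on Gauss space at the imaginary parameter i√(p−1)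
(`integral_exp_sum_rpow_le`). Put s = √(p−1) and let K_θ(x, y) be the average of φ(cos θ y + sin θ
(i s x + √p y')) over an independent standard Gaussian y'. Then K_0 depends on y only, K_{π/2} on x
only, and ∫ (∫ |K_θ|^p dγ(y))^{q/p} dγ(x) is nonincreasing on [0, π/2]. Gaussian integration by
parts in x and y, with Cauchy–Schwarz in y, reduces this to a pointwise inequality; |K|² is replaced
by |K|² + ε to keep all powers smooth. Dominated limits then reach the functions (e^{2πi w·v} − 1)
f. -/

/-- Euclidean space of dimension `n`. -/
abbrev Eu (n : ℕ) := EuclideanSpace ℝ (Fin n)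

/-! ### Functions of exponential growth -/

section ExpBdd

/-- `u` grows at most exponentially with respect to the weight `w`. -/
def ExpBdd {α F : Type*} [Norm F] (w : α → ℝ) (u : α → F) : Prop :=
  ∃ C B : ℝ, 0 ≤ C ∧ 0 ≤ B ∧ ∀ a, ‖u a‖ ≤ C * Real.exp (B * w a)

variable {α : Type*} {w : α → ℝ}

theorem ExpBdd.add {F : Type*} [SeminormedAddCommGroup F] (hw : ∀ a, 0 ≤ w a) {u v : α → F}
    (hu : ExpBdd w u) (hv : ExpBdd w v) : ExpBdd w (fun a => u a + v a) := by
  obtain ⟨C, B, hC, hB, h⟩ := hu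
  obtain ⟨C', B', hC', hB', h'⟩ := hv
  refine ⟨C + C', B + B', by positivity, by positivity, fun a => ?_⟩
  have h1 : Real.exp (B * w a) ≤ Real.exp ((B + B') * w a) := by
    apply Real.exp_le_exp.2; nlinarith [hw a, mul_nonneg hB' (hw a)]
  have h2 : Real.exp (B' * w a) ≤ Real.exp ((B + B') * w a) := by
    apply Real.exp_le_exp.2; nlinarith [hw a, mul_nonneg hB (hw a)]
  calc ‖u a + v a‖ ≤ ‖u a‖ + ‖v a‖ := norm_add_le _ _
    _ ≤ C * Real.exp (B * w a) + C' * Real.exp (B' * w a) := add_le_add (h a) (h' a)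
    _ ≤ _ := by rw [add_mul]; gcongr

theorem ExpBdd.mul {F : Type*} [SeminormedRing F] {u v : α → F}
    (hu : ExpBdd w u) (hv : ExpBdd w v) : ExpBdd w (fun a => u a * v a) := by
  obtain ⟨C, B, hC, hB, h⟩ := hu
  obtain ⟨C', B', hC', hB', h'⟩ := hv
  refine ⟨C * C', B + B', by positivity, by positivity, fun a => ?_⟩
  calc ‖u a * v a‖ ≤ ‖u a‖ * ‖v a‖ := norm_mul_le _ _
    _ ≤ (C * Real.exp (B * w a)) * (C' * Real.exp (B' * w a)) :=
        mul_le_mul (h a) (h' a) (norm_nonneg _) ((norm_nonneg _).trans (h a))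
    _ = _ := by rw [add_mul, Real.exp_add]; ring

theorem ExpBdd.of_le {F G : Type*} [Norm F] [Norm G] {u : α → F} {v : α → G} (hu : ExpBdd w u)
    (h : ∀ a, ‖v a‖ ≤ ‖u a‖) : ExpBdd w v := by
  obtain ⟨C, B, hC, hB, h'⟩ := hu
  exact ⟨C, B, hC, hB, fun a => (h a).trans (h' a)⟩

theorem ExpBdd.comp {β F : Type*} [Norm F] {w' : β → ℝ} {u : α → F} (hu : ExpBdd w u) (g : β → α)
    (h : ∀ b, w (g b) ≤ w' b) : ExpBdd w' (fun b => u (g b)) := by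
  obtain ⟨C, B, hC, hB, h'⟩ := hu
  refine ⟨C, B, hC, hB, fun b => (h' _).trans ?_⟩
  gcongr
  exact h b

theorem ExpBdd.of_bound {F : Type*} [Norm F] {u : α → F} (C : ℝ)
    (h : ∀ a, ‖u a‖ ≤ C) : ExpBdd w u :=
  ⟨max C 0, 0, le_max_right _ _, le_rfl, fun a => by simpa using Or.inl (h a)⟩

theorem ExpBdd.const {F : Type*} [Norm F] (c : F) :
    ExpBdd w (fun _ => c) := .of_bound ‖c‖ fun _ => le_rfl

theorem ExpBdd.sum {F κ : Type*} [SeminormedAddCommGroup F] (hw : ∀ a, 0 ≤ w a) (s : Finset κ)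
    {u : κ → α → F} (hu : ∀ k ∈ s, ExpBdd w (u k)) : ExpBdd w (fun a => ∑ k ∈ s, u k a) := by
  classical
  induction s using Finset.induction_on with
  | empty => simpa using ExpBdd.const (0 : F)
  | insert k s hk ih =>
    simp only [Finset.sum_insert hk]
    exact (hu k (by simp)).add hw (ih fun j hj => hu j (by simp [hj]))

theorem ExpBdd.rpow {u : α → ℝ} (hu : ExpBdd w u) (h0 : ∀ a, 0 ≤ u a) {a : ℝ} (ha : 0 ≤ a) :
    ExpBdd w (fun x => u x ^ a) := by
  obtain ⟨C, B, hC, hB, h⟩ := hu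
  refine ⟨C ^ a, B * a, by positivity, by positivity, fun x => ?_⟩
  rw [Real.norm_of_nonneg (Real.rpow_nonneg (h0 x) _)]
  calc u x ^ a ≤ (C * Real.exp (B * w x)) ^ a :=
        Real.rpow_le_rpow (h0 x) ((Real.le_norm_self _).trans (h x)) ha
    _ = _ := by
      rw [Real.mul_rpow hC (Real.exp_pos _).le, ← Real.exp_mul]; ring_nf

theorem ExpBdd.weight (hw : ∀ a, 0 ≤ w a) : ExpBdd w w :=
  ⟨1, 1, zero_le_one, zero_le_one, fun a => by
    rw [Real.norm_of_nonneg (hw a)]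
    rw [one_mul, one_mul]; linarith [Real.add_one_le_exp (w a)]⟩

end ExpBdd

/-! ### Gaussian measure: integrability, integration by parts, differentiation under the integral -/

section Gauss

variable {n : ℕ}

/-- The density of the standard Gaussian measure on `ℝⁿ`. -/
noncomputable def gaussDensity (x : Eu n) : ℝ :=
  (2 * Real.pi) ^ (-(n : ℝ) / 2) * Real.exp (-(1 / 2) * ‖x‖ ^ 2)

/-- The standard Gaussian measure on `ℝⁿ`. -/
noncomputable def gaussMeasure (n : ℕ) : Measure (Eu n) :=
  volume.withDensity fun x => ENNReal.ofReal (gaussDensity x)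

theorem gaussDensity_nonneg (x : Eu n) : 0 ≤ gaussDensity x := by
  unfold gaussDensity; positivity

theorem continuous_gaussDensity : Continuous (gaussDensity : Eu n → ℝ) := by
  unfold gaussDensity; fun_prop

theorem integral_gaussMeasure {F : Type*} [NormedAddCommGroup F] [NormedSpace ℝ F] (f : Eu n → F) :
    ∫ x, f x ∂(gaussMeasure n) = ∫ x, gaussDensity x • f x := by
  unfold gaussMeasure
  rw [integral_withDensity_eq_integral_toReal_smul
    (by exact continuous_gaussDensity.measurable.ennreal_ofReal) (by simp)]
  simp [ENNReal.toReal_ofReal, gaussDensity_nonneg]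

theorem integrable_gaussMeasure_iff {F : Type*} [NormedAddCommGroup F] [NormedSpace ℝ F]
    (f : Eu n → F) :
    Integrable f (gaussMeasure n) ↔ Integrable (fun x => gaussDensity x • f x) := by
  unfold gaussMeasure
  rw [integrable_withDensity_iff_integrable_smul'
    (by exact continuous_gaussDensity.measurable.ennreal_ofReal) (by simp)]
  simp [ENNReal.toReal_ofReal, gaussDensity_nonneg]

theorem integral_gaussDensity : ∫ x : Eu n, gaussDensity x = 1 := by
  unfold gaussDensity
  rw [integral_const_mul, GaussianFourier.integral_rexp_neg_mul_sq_norm (by norm_num)]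
  rw [show Real.pi / (1 / 2) = 2 * Real.pi by ring, ← Real.rpow_add (by positivity)]
  simp; ring_nf; simp

theorem integrable_exp_neg_mul_sq_norm {b : ℝ} (hb : 0 < b) :
    Integrable (fun x : Eu n => Real.exp (-b * ‖x‖ ^ 2)) := by
  have := (GaussianFourier.integrable_cexp_neg_mul_sq_norm_add (V := (Eu n)) (b := b) (by simpa) 0 0).norm
  simpa [Complex.norm_exp, ← Complex.ofReal_pow] using this

instance : IsProbabilityMeasure (gaussMeasure n) := by
  refine ⟨?_⟩
  have hi : Integrable (gaussDensity : Eu n → ℝ) :=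
    (integrable_exp_neg_mul_sq_norm (by norm_num)).const_mul _
  rw [gaussMeasure, withDensity_apply _ MeasurableSet.univ, Measure.restrict_univ,
    ← ofReal_integral_eq_lintegral_ofReal hi (.of_forall gaussDensity_nonneg),
    integral_gaussDensity]
  simp

theorem integrable_exp_gaussMeasure (B : ℝ) :
    Integrable (fun x : Eu n => Real.exp (B * ‖x‖)) (gaussMeasure n) := by
  rw [integrable_gaussMeasure_iff]
  -- Completing the square, B t ≤ t²/4 + B², spends half of the Gaussian decay; hence the rate 1/4
  -- and the factor exp(B²).
  refine (((integrable_exp_neg_mul_sq_norm (n := n) (b := 1 / 4) (by norm_num)).const_mul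
    ((2 * Real.pi) ^ (-(n : ℝ) / 2) * Real.exp (B ^ 2)))).mono'
    (by exact (continuous_gaussDensity.smul (by fun_prop)).aestronglyMeasurable)
    (.of_forall fun x => ?_)
  rw [smul_eq_mul, Real.norm_of_nonneg (mul_nonneg (gaussDensity_nonneg _) (Real.exp_pos _).le)]
  unfold gaussDensity
  rw [mul_assoc, mul_assoc, ← Real.exp_add, ← Real.exp_add]
  refine mul_le_mul_of_nonneg_left (Real.exp_le_exp.2 ?_) (by positivity)
  nlinarith [sq_nonneg (‖x‖ / 2 - B)]

theorem ExpBdd.integrable {F : Type*} [NormedAddCommGroup F] {u : Eu n → F}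
    (hu : ExpBdd (fun x : Eu n => ‖x‖) u) (hc : AEStronglyMeasurable u (gaussMeasure n)) :
    Integrable u (gaussMeasure n) := by
  obtain ⟨C, B, hC, hB, h⟩ := hu
  exact ((integrable_exp_gaussMeasure B).const_mul C).mono' hc (.of_forall h)

/-- Gaussian integration by parts. -/
theorem integral_inner_mul_gaussMeasure {f f' : Eu n → ℝ} (v : Eu n) (hf : Continuous f)
    (hf' : Continuous f') (hbf : ExpBdd (fun x : Eu n => ‖x‖) f) (hbf' : ExpBdd (fun x : Eu n => ‖x‖) f')
    (hd : ∀ x, HasLineDerivAt ℝ f (f' x) x v) :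
    ∫ x, inner ℝ v x * f x ∂(gaussMeasure n) = ∫ x, f' x ∂(gaussMeasure n) := by
  have hdg : ∀ x : Eu n, HasLineDerivAt ℝ gaussDensity (-(inner ℝ v x) * gaussDensity x) x v := by
    intro x
    have h1 : HasFDerivAt (fun x : Eu n => ‖x‖ ^ 2) (2 • (innerSL ℝ x)) x :=
      (hasStrictFDerivAt_norm_sq x).hasFDerivAt
    have h2 := ((h1.const_mul (-(1 / 2) : ℝ)).exp.const_mul
      ((2 * Real.pi) ^ (-(n : ℝ) / 2))).hasLineDerivAt v
    convert! h2 using 1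
    simp [gaussDensity, real_inner_comm]
    ring
  have hw : ∀ x : Eu n, 0 ≤ ‖x‖ := fun x => norm_nonneg x
  have hxf : ExpBdd (fun x : Eu n => ‖x‖) (fun x => inner ℝ v x * f x) := by
    refine ExpBdd.mul ?_ hbf
    refine ((ExpBdd.const ‖v‖).mul (ExpBdd.weight hw)).of_le fun x => ?_
    simpa using abs_real_inner_le_norm v x
  have i1 := (integrable_gaussMeasure_iff _).1 (hbf.integrable hf.aestronglyMeasurable)
  have i2 := (integrable_gaussMeasure_iff _).1 (hbf'.integrable hf'.aestronglyMeasurable)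
  have i3 := (integrable_gaussMeasure_iff _).1
    (hxf.integrable (by exact Continuous.aestronglyMeasurable (by fun_prop)))
  have key := integral_bilinear_hasLineDerivAt_right_eq_neg_left_of_integrable
    (μ := (volume : Measure (Eu n))) (f := gaussDensity) (g := f)
    (f' := fun x => -(inner ℝ v x) * gaussDensity x) (g' := f') (v := v)
    (B := ContinuousLinearMap.mul ℝ ℝ) ?_ ?_ ?_ (fun x _ => hdg x) (fun x _ => hd x)
  · rw [integral_gaussMeasure, integral_gaussMeasure]
    simp only [ContinuousLinearMap.mul_apply'] at key
    simp only [smul_eq_mul]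
    rw [key, ← integral_neg]
    congr 1; ext x; ring
  · refine i3.neg.congr (.of_forall fun x => ?_)
    simp; ring
  · simpa using i2
  · simpa using i1

theorem hasDerivAt_integral_gaussMeasure {F F' : ℝ → Eu n → ℝ} {t₀ : ℝ}
    (hF : ∀ t, Continuous (F t)) (hF' : Continuous (F' t₀))
    (hb : ExpBdd (fun x : Eu n => ‖x‖) (F t₀))
    (hb' : ∃ C B : ℝ, ∀ t ∈ Metric.ball t₀ 1, ∀ x, |F' t x| ≤ C * Real.exp (B * ‖x‖))
    (hd : ∀ t x, HasDerivAt (fun t => F t x) (F' t x) t) :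
    HasDerivAt (fun t => ∫ x, F t x ∂(gaussMeasure n)) (∫ x, F' t₀ x ∂(gaussMeasure n)) t₀ := by
  obtain ⟨C, B, h⟩ := hb'
  exact (hasDerivAt_integral_of_dominated_loc_of_deriv_le (Metric.ball_mem_nhds t₀ one_pos)
    (.of_forall fun t => (hF t).aestronglyMeasurable) (hb.integrable (hF t₀).aestronglyMeasurable)
    hF'.aestronglyMeasurable (.of_forall fun x t ht => h t ht x)
    ((integrable_exp_gaussMeasure B).const_mul C) (.of_forall fun x t _ => hd t x)).2

end Gauss

end Pitt

namespace Pitt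

theorem hasDerivAt_comp_line {V : Type*} [AddCommGroup V] [Module ℝ V] {f : V → ℝ} {f' : V → ℝ}
    {v : V} (h : ∀ x, HasLineDerivAt ℝ f (f' x) x v) (x : V) (t : ℝ) :
    HasDerivAt (fun t : ℝ => f (x + t • v)) (f' (x + t • v)) t := by
  have h0 : HasDerivAt (fun s : ℝ => f (x + t • v + s • v)) (f' (x + t • v)) (t - t) := by
    rw [sub_self]; exact h (x + t • v)
  have h1 := h0.comp_sub_const t t
  refine h1.congr_of_eventuallyEq (.of_forall fun s => ?_)
  simp only [add_assoc, ← add_smul, add_sub_cancel]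

/-! ### Admissible integrands for the flow, and Cauchy–Schwarz -/

section Flow

variable {n : ℕ}

/-- Jointly continuous functions of `(θ, x, y)`, of exponential growth in `x` and `y`. -/
structure Adm (u : ℝ → Eu n → Eu n → ℝ) : Prop where
  cont : Continuous fun z : ℝ × Eu n × Eu n => u z.1 z.2.1 z.2.2
  bdd : ExpBdd (fun z : ℝ × Eu n × Eu n => ‖z.2.1‖ + ‖z.2.2‖) fun z => u z.1 z.2.1 z.2.2

/-- Jointly continuous functions of `(θ, x)`, of exponential growth in `x`. -/
structure AdmFst (u : ℝ → Eu n → ℝ) : Prop where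
  cont : Continuous fun z : ℝ × Eu n => u z.1 z.2
  bdd : ExpBdd (fun z : ℝ × Eu n => ‖z.2‖) fun z => u z.1 z.2

theorem weight_nonneg (z : ℝ × Eu n × Eu n) : 0 ≤ ‖z.2.1‖ + ‖z.2.2‖ := by positivity

theorem weight_nonneg' (z : ℝ × Eu n) : 0 ≤ ‖z.2‖ := norm_nonneg _

namespace Adm

variable {u v : ℝ → Eu n → Eu n → ℝ}

theorem add (hu : Adm u) (hv : Adm v) : Adm fun t x y => u t x y + v t x y :=
  ⟨hu.cont.add hv.cont, hu.bdd.add weight_nonneg hv.bdd⟩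

theorem mul (hu : Adm u) (hv : Adm v) : Adm fun t x y => u t x y * v t x y :=
  ⟨hu.cont.mul hv.cont, hu.bdd.mul hv.bdd⟩

theorem of_bound {u : ℝ → Eu n → Eu n → ℝ} (hc : Continuous fun z : ℝ × Eu n × Eu n => u z.1 z.2.1 z.2.2)
    (C : ℝ) (h : ∀ t x y, |u t x y| ≤ C) : Adm u := ⟨hc, .of_bound C fun _ => h _ _ _⟩

theorem const (c : ℝ) : Adm fun (_ : ℝ) (_ _ : Eu n) => c := of_bound continuous_const |c| (by simp)

theorem sum {κ : Type*} (s : Finset κ) {u : κ → ℝ → Eu n → Eu n → ℝ} (hu : ∀ k ∈ s, Adm (u k)) :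
    Adm fun t x y => ∑ k ∈ s, u k t x y :=
  ⟨continuous_finsetSum _ fun k hk => (hu k hk).cont,
    ExpBdd.sum weight_nonneg s fun k hk => (hu k hk).bdd⟩

theorem neg (hu : Adm u) : Adm fun t x y => -u t x y := by
  simpa using (const (-1)).mul hu

theorem sub (hu : Adm u) (hv : Adm v) : Adm fun t x y => u t x y - v t x y := by
  simpa [sub_eq_add_neg] using hu.add hv.neg

theorem fst_apply (j : Fin n) : Adm fun (_ : ℝ) (x _ : Eu n) => x j :=
  ⟨by fun_prop, (ExpBdd.weight weight_nonneg).of_le fun z => by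
    rw [Real.norm_of_nonneg (weight_nonneg z)]
    exact (PiLp.norm_apply_le z.2.1 j).trans (by simp)⟩

theorem snd_apply (j : Fin n) : Adm fun (_ : ℝ) (_ y : Eu n) => y j :=
  ⟨by fun_prop, (ExpBdd.weight weight_nonneg).of_le fun z => by
    rw [Real.norm_of_nonneg (weight_nonneg z)]
    exact (PiLp.norm_apply_le z.2.2 j).trans (by simp)⟩

theorem sin : Adm fun (t : ℝ) (_ _ : Eu n) => Real.sin t :=
  of_bound (by fun_prop) 1 fun t _ _ => Real.abs_sin_le_one t

theorem cos : Adm fun (t : ℝ) (_ _ : Eu n) => Real.cos t :=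
  of_bound (by fun_prop) 1 fun t _ _ => Real.abs_cos_le_one t

theorem continuous_snd (hu : Adm u) (t : ℝ) (x : Eu n) : Continuous (u t x) :=
  hu.cont.comp (by fun_prop : Continuous fun y : Eu n => (t, x, y))

theorem expBdd_snd (hu : Adm u) (t : ℝ) (x : Eu n) : ExpBdd (fun y : Eu n => ‖y‖) (u t x) := by
  obtain ⟨C, B, hC, hB, h⟩ := hu.bdd
  refine ⟨C * Real.exp (B * ‖x‖), B, by positivity, hB, fun y => (h (t, x, y)).trans_eq ?_⟩
  rw [mul_assoc, ← Real.exp_add, mul_add]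

theorem integrable (hu : Adm u) (t : ℝ) (x : Eu n) : Integrable (u t x) (gaussMeasure n) :=
  (hu.expBdd_snd t x).integrable (hu.continuous_snd t x).aestronglyMeasurable

/-- The weight is additive in x and y, so the exponential bound factorises and the y-factor
integrates to a constant; locally in x this also provides the dominating function for continuity. -/
theorem integral (hu : Adm u) : AdmFst fun t x => ∫ y, u t x y ∂(gaussMeasure n) := by
  obtain ⟨C, B, hC, hB, h⟩ := hu.bdd
  constructor
  · rw [continuous_iff_continuousAt]
    rintro ⟨t₀, x₀⟩
    refine continuousAt_of_dominated (bound := fun y => C * Real.exp (B * (‖x₀‖ + 1)) *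
      Real.exp (B * ‖y‖)) (.of_forall fun z => (hu.continuous_snd _ _).aestronglyMeasurable) ?_
      ((integrable_exp_gaussMeasure B).const_mul _)
      (.of_forall fun y => (hu.cont.comp
        (by fun_prop : Continuous fun z : ℝ × Eu n => (z.1, z.2, y))).continuousAt)
    have hlim : ∀ᶠ z : ℝ × Eu n in nhds (t₀, x₀), ‖z.2‖ < ‖x₀‖ + 1 :=
      (_root_.continuous_snd.norm.tendsto (t₀, x₀)).eventually (gt_mem_nhds (by simp))
    filter_upwards [hlim] with z hz
    refine .of_forall fun y => (h (z.1, z.2, y)).trans ?_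
    rw [mul_assoc, ← Real.exp_add, ← mul_add]
    have hz' : ‖z.2‖ + ‖y‖ ≤ ‖x₀‖ + 1 + ‖y‖ := by linarith
    gcongr
  · refine ⟨C * ∫ y : Eu n, Real.exp (B * ‖y‖) ∂(gaussMeasure n), B, ?_, hB, fun z => ?_⟩
    · exact mul_nonneg hC (integral_nonneg fun _ => (Real.exp_pos _).le)
    · calc ‖∫ y, u z.1 z.2 y ∂(gaussMeasure n)‖
          ≤ ∫ y, C * Real.exp (B * ‖z.2‖) * Real.exp (B * ‖y‖) ∂(gaussMeasure n) := by
            refine norm_integral_le_of_norm_le ((integrable_exp_gaussMeasure B).const_mul _)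
              (.of_forall fun y => (h (z.1, z.2, y)).trans_eq ?_)
            rw [mul_assoc, ← Real.exp_add, ← mul_add]
        _ = _ := by rw [integral_const_mul]; ring

end Adm

namespace AdmFst

variable {u v : ℝ → Eu n → ℝ}

theorem add (hu : AdmFst u) (hv : AdmFst v) : AdmFst fun t x => u t x + v t x :=
  ⟨hu.cont.add hv.cont, hu.bdd.add weight_nonneg' hv.bdd⟩

theorem mul (hu : AdmFst u) (hv : AdmFst v) : AdmFst fun t x => u t x * v t x :=
  ⟨hu.cont.mul hv.cont, hu.bdd.mul hv.bdd⟩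

theorem of_bound {u : ℝ → Eu n → ℝ} (hc : Continuous fun z : ℝ × Eu n => u z.1 z.2)
    (C : ℝ) (h : ∀ t x, |u t x| ≤ C) : AdmFst u := ⟨hc, .of_bound C fun _ => h _ _⟩

theorem const (c : ℝ) : AdmFst fun (_ : ℝ) (_ : Eu n) => c := of_bound continuous_const |c| (by simp)

theorem sum {κ : Type*} (s : Finset κ) {u : κ → ℝ → Eu n → ℝ} (hu : ∀ k ∈ s, AdmFst (u k)) :
    AdmFst fun t x => ∑ k ∈ s, u k t x :=
  ⟨continuous_finsetSum _ fun k hk => (hu k hk).cont,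
    ExpBdd.sum weight_nonneg' s fun k hk => (hu k hk).bdd⟩

theorem neg (hu : AdmFst u) : AdmFst fun t x => -u t x := by
  simpa using (const (-1)).mul hu

theorem sub (hu : AdmFst u) (hv : AdmFst v) : AdmFst fun t x => u t x - v t x := by
  simpa [sub_eq_add_neg] using hu.add hv.neg

theorem apply (j : Fin n) : AdmFst fun (_ : ℝ) (x : Eu n) => x j :=
  ⟨by fun_prop, (ExpBdd.weight weight_nonneg').of_le fun z => by
    rw [Real.norm_of_nonneg (weight_nonneg' z)]
    exact PiLp.norm_apply_le z.2 j⟩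

theorem sin : AdmFst fun (t : ℝ) (_ : Eu n) => Real.sin t :=
  of_bound (by fun_prop) 1 fun t _ => Real.abs_sin_le_one t

theorem cos : AdmFst fun (t : ℝ) (_ : Eu n) => Real.cos t :=
  of_bound (by fun_prop) 1 fun t _ => Real.abs_cos_le_one t

theorem continuous (hu : AdmFst u) (t : ℝ) : Continuous (u t) :=
  hu.cont.comp (by fun_prop : Continuous fun x : Eu n => (t, x))

theorem expBdd (hu : AdmFst u) (t : ℝ) : ExpBdd (fun x : Eu n => ‖x‖) (u t) :=
  hu.bdd.comp (fun x => (t, x)) fun _ => le_rfl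

theorem integrable (hu : AdmFst u) (t : ℝ) : Integrable (u t) (gaussMeasure n) :=
  (hu.expBdd t).integrable (hu.continuous t).aestronglyMeasurable

/-- Negative exponents are admissible only because of the lower bound δ. This is what the
regularisation by ε secures along the flow. -/
theorem rpow (hu : AdmFst u) {δ : ℝ} (hδ : 0 < δ) (h : ∀ t x, δ ≤ u t x) (a : ℝ) :
    AdmFst fun t x => u t x ^ a := by
  have hc : Continuous fun z : ℝ × Eu n => u z.1 z.2 ^ a :=
    hu.cont.rpow_const fun z => Or.inl (hδ.trans_le (h _ _)).ne'
  rcases le_total 0 a with ha | ha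
  · exact ⟨hc, hu.bdd.rpow (fun z => hδ.le.trans (h _ _)) ha⟩
  · refine of_bound hc (δ ^ a) fun t x => ?_
    rw [abs_of_nonneg (Real.rpow_nonneg (hδ.le.trans (h _ _)) _)]
    exact Real.rpow_le_rpow_of_nonpos hδ (h t x) ha

end AdmFst

/-- Cauchy–Schwarz by the discriminant: the quadratic with coefficients ∫ g, 2 ∫ f, ∫ h is the
integral of a pointwise nonnegative quadratic. The hypothesis f² ≤ g h avoids square roots and
square integrability in the applications. -/
theorem sq_integral_le {α : Type*} [MeasurableSpace α] {μ : Measure α} {f g h : α → ℝ}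
    (hf : Integrable f μ) (hg : Integrable g μ) (hh : Integrable h μ) (hg0 : ∀ x, 0 ≤ g x)
    (hh0 : ∀ x, 0 ≤ h x) (hfgh : ∀ x, f x ^ 2 ≤ g x * h x) :
    (∫ x, f x ∂μ) ^ 2 ≤ (∫ x, g x ∂μ) * ∫ x, h x ∂μ := by
  have key : ∀ t : ℝ, 0 ≤ (∫ x, g x ∂μ) * (t * t) + (2 * ∫ x, f x ∂μ) * t + ∫ x, h x ∂μ := by
    intro t
    have : (∫ x, g x ∂μ) * (t * t) + (2 * ∫ x, f x ∂μ) * t + ∫ x, h x ∂μ =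
        ∫ x, (g x * (t * t) + 2 * f x * t + h x) ∂μ := by
      rw [integral_add (f := fun x => g x * (t * t) + 2 * f x * t)
        ((hg.mul_const _).add ((hf.const_mul 2).mul_const _)) hh,
        integral_add (hg.mul_const _) ((hf.const_mul 2).mul_const _), integral_mul_const,
        integral_mul_const, integral_const_mul]
    rw [this]
    refine integral_nonneg fun x => ?_
    have h1 := hfgh x
    have h2 : |f x| ≤ Real.sqrt (g x) * Real.sqrt (h x) := by
      rw [← Real.sqrt_mul (hg0 x), ← Real.sqrt_sq_eq_abs]; exact Real.sqrt_le_sqrt h1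
    have h3 := Real.sq_sqrt (hg0 x)
    have h4 := Real.sq_sqrt (hh0 x)
    have h5 : |f x * t| ≤ Real.sqrt (g x) * Real.sqrt (h x) * |t| := by
      rw [abs_mul]; gcongr
    have h6 := neg_abs_le (f x * t)
    have h7 := sq_abs t
    have h8 : g x * (t * t) = (Real.sqrt (g x) * |t|) ^ 2 := by rw [mul_pow, h3, h7]; ring
    simp only [Pi.zero_apply]
    rw [h8]
    nlinarith [sq_nonneg (Real.sqrt (g x) * |t| - Real.sqrt (h x))]
  have := discrim_le_zero key
  unfold discrim at this
  linarith

end Flow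

end Pitt

namespace Pitt

/-! ### Abstract monotonicity along the Gaussian rotation -/

section Flow

variable {n : ℕ}

/-- The `j`-th standard basis vector. -/
noncomputable abbrev basisVec (j : Fin n) : Eu n := EuclideanSpace.single j (1 : ℝ)

theorem Adm.hasDerivAt_integral {u u' : ℝ → Eu n → Eu n → ℝ} (hu : Adm u) (hu' : Adm u')
    (hd : ∀ t x y, HasDerivAt (fun t => u t x y) (u' t x y) t) (t : ℝ) (x : Eu n) :
    HasDerivAt (fun t => ∫ y, u t x y ∂(gaussMeasure n)) (∫ y, u' t x y ∂(gaussMeasure n)) t := by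
  obtain ⟨C, B, hC, hB, h⟩ := hu'.bdd
  refine hasDerivAt_integral_gaussMeasure (fun t => hu.continuous_snd t x)
    (hu'.continuous_snd t x) (hu.expBdd_snd t x)
    ⟨C * Real.exp (B * ‖x‖), B, fun t _ y => (h (t, x, y)).trans_eq ?_⟩ (fun t y => hd t x y)
  rw [mul_assoc, ← Real.exp_add, mul_add]

theorem Adm.hasLineDerivAt_integral {u u' : ℝ → Eu n → Eu n → ℝ} (hu : Adm u) (hu' : Adm u')
    (v : Eu n) (hd : ∀ t x y, HasLineDerivAt ℝ (fun x => u t x y) (u' t x y) x v)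
    (t : ℝ) (x : Eu n) :
    HasLineDerivAt ℝ (fun x => ∫ y, u t x y ∂(gaussMeasure n))
      (∫ y, u' t x y ∂(gaussMeasure n)) x v := by
  obtain ⟨C, B, hC, hB, h⟩ := hu'.bdd
  have key := hasDerivAt_integral_gaussMeasure (n := n) (F := fun τ y => u t (x + τ • v) y)
    (F' := fun τ y => u' t (x + τ • v) y) (t₀ := 0)
    (fun τ => hu.continuous_snd t _) (hu'.continuous_snd t _) (hu.expBdd_snd t _)
    ⟨C * Real.exp (B * (‖x‖ + ‖v‖)), B, fun τ hτ y => (h (t, _, y)).trans ?_⟩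
    (fun τ y => hasDerivAt_comp_line (fun x => hd t x y) x τ)
  · simpa [HasLineDerivAt] using key
  · rw [mul_assoc, ← Real.exp_add, ← mul_add]
    have hτ' : |τ| ≤ 1 := by simpa using (Metric.mem_ball.1 hτ).le
    have h1 : ‖x + τ • v‖ ≤ ‖x‖ + ‖v‖ := by
      refine (norm_add_le _ _).trans ?_
      rw [norm_smul, Real.norm_eq_abs]
      nlinarith [norm_nonneg v]
    have h2 : ‖x + τ • v‖ + ‖y‖ ≤ ‖x‖ + ‖v‖ + ‖y‖ := by linarith
    gcongr

theorem AdmFst.hasDerivAt_integral {u u' : ℝ → Eu n → ℝ} (hu : AdmFst u) (hu' : AdmFst u')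
    (hd : ∀ t x, HasDerivAt (fun t => u t x) (u' t x) t) (t : ℝ) :
    HasDerivAt (fun t => ∫ x, u t x ∂(gaussMeasure n)) (∫ x, u' t x ∂(gaussMeasure n)) t := by
  obtain ⟨C, B, hC, hB, h⟩ := hu'.bdd
  exact hasDerivAt_integral_gaussMeasure hu.continuous (hu'.continuous t) (hu.expBdd t)
    ⟨C, B, fun t _ x => h (t, x)⟩ hd

theorem integral_coord_mul_gaussMeasure {f f' : Eu n → ℝ} (j : Fin n) (hf : Continuous f)
    (hf' : Continuous f') (hbf : ExpBdd (fun x : Eu n => ‖x‖) f)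
    (hbf' : ExpBdd (fun x : Eu n => ‖x‖) f')
    (hd : ∀ x, HasLineDerivAt ℝ f (f' x) x (basisVec j)) :
    ∫ x : Eu n, x j * f x ∂(gaussMeasure n) = ∫ x, f' x ∂(gaussMeasure n) := by
  rw [← integral_inner_mul_gaussMeasure (basisVec j) hf hf' hbf hbf' hd]
  simp [basisVec, EuclideanSpace.inner_single_left]

/-- Monotonicity of `θ ↦ ∫ (∫ P θ x y dγ(y)) ^ r dγ(x)` along a Gaussian rotation, under a
pointwise differential inequality. -/
theorem integral_rpow_integral_le {r p s δ : ℝ} (hr : 1 ≤ r) (hp : 0 ≤ p) (hδ : 0 < δ)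
    {P R : ℝ → Eu n → Eu n → ℝ} {Gu Gv Wu Wv T : Fin n → ℝ → Eu n → Eu n → ℝ}
    (aP : Adm P) (aR : Adm R) (aGu : ∀ j, Adm (Gu j)) (aGv : ∀ j, Adm (Gv j))
    (aWu : ∀ j, Adm (Wu j)) (aWv : ∀ j, Adm (Wv j)) (aT : ∀ j, Adm (T j))
    (hP : ∀ t x y, δ ≤ P t x y)
    (hPt : ∀ t x y, HasDerivAt (fun t => P t x y)
      (p * (Real.sin t * (∑ j, y j * Gv j t x y) - s * Real.cos t * (∑ j, x j * Gu j t x y)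
        - R t x y)) t)
    (hPx : ∀ j t x y, HasLineDerivAt ℝ (fun x => P t x y)
      (-(p * s * Real.sin t) * Gu j t x y) x (basisVec j))
    (hGu : ∀ j t x y, HasLineDerivAt ℝ (fun x => Gu j t x y) (Wu j t x y) x (basisVec j))
    (hGv : ∀ j t x y, HasLineDerivAt ℝ (fun y => Gv j t x y) (Wv j t x y) y (basisVec j))
    (hT : ∀ j t x y, 0 ≤ T j t x y) (hGT : ∀ j t x y, Gu j t x y ^ 2 ≤ P t x y * T j t x y)
    (hineq : ∀ t ∈ Set.Icc 0 (Real.pi / 2), ∀ x y,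
      Real.sin t * (∑ j, Wv j t x y) - s * Real.cos t * (∑ j, Wu j t x y) - R t x y
        + (r - 1) * p * s ^ 2 * (Real.sin t * Real.cos t) * (∑ j, T j t x y) ≤ 0) :
    ∫ x, (∫ y, P (Real.pi / 2) x y ∂(gaussMeasure n)) ^ r ∂(gaussMeasure n) ≤
      ∫ x, (∫ y, P 0 x y ∂(gaussMeasure n)) ^ r ∂(gaussMeasure n) := by
  set γ := gaussMeasure n with hγ
  set h : ℝ → Eu n → ℝ := fun t x => ∫ y, P t x y ∂γ with hh
  set A : Fin n → ℝ → Eu n → ℝ := fun j t x => ∫ y, Gu j t x y ∂γ with hA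
  set IU : Fin n → ℝ → Eu n → ℝ := fun j t x => ∫ y, Wu j t x y ∂γ with hIU
  set IV : Fin n → ℝ → Eu n → ℝ := fun j t x => ∫ y, Wv j t x y ∂γ with hIV
  set IT : Fin n → ℝ → Eu n → ℝ := fun j t x => ∫ y, T j t x y ∂γ with hIT
  set IR : ℝ → Eu n → ℝ := fun t x => ∫ y, R t x y ∂γ with hIR
  have ah : AdmFst h := aP.integral
  have aA : ∀ j, AdmFst (A j) := fun j => (aGu j).integral
  have aIU : ∀ j, AdmFst (IU j) := fun j => (aWu j).integral
  have aIV : ∀ j, AdmFst (IV j) := fun j => (aWv j).integral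
  have aIR : AdmFst IR := aR.integral
  have hδh : ∀ t x, δ ≤ h t x := fun t x => by
    have := integral_mono (μ := γ) (integrable_const δ) (aP.integrable t x) (hP t x)
    simpa using this
  have hh0 : ∀ t x, 0 < h t x := fun t x => hδ.trans_le (hδh t x)
  have aS : AdmFst fun (t : ℝ) (_ : Eu n) => Real.sin t := AdmFst.sin
  have aC : AdmFst fun (t : ℝ) (_ : Eu n) => Real.cos t := AdmFst.cos
  -- the derivative of `h` in `t`
  let h' : ℝ → Eu n → ℝ := fun t x => p * (Real.sin t * (∑ j, IV j t x)
    - s * Real.cos t * (∑ j, x j * A j t x) - IR t x)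
  have ah' : AdmFst h' := (AdmFst.const p).mul (((aS.mul (.sum _ fun j _ => aIV j)).sub
    (((AdmFst.const s).mul aC).mul (.sum _ fun j _ => (AdmFst.apply j).mul (aA j)))).sub aIR)
  -- The time derivative contains y_j Gv_j; integrating by parts in y turns it into Wv_j. The factor
  -- x_j is constant in y and is dealt with only after the outer integration.
  have hht : ∀ t x, HasDerivAt (fun t => h t x) (h' t x) t := by
    intro t x
    have i1 : ∀ j, Integrable (fun y : Eu n => y j * Gv j t x y) γ := fun j =>
      ((Adm.snd_apply j).mul (aGv j)).integrable t x
    have i2 : ∀ j, Integrable (fun y : Eu n => x j * Gu j t x y) γ := fun j =>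
      ((aGu j).integrable t x).const_mul _
    have key := Adm.hasDerivAt_integral aP (u' := fun t x y => p * (Real.sin t *
      (∑ j, y j * Gv j t x y) - s * Real.cos t * (∑ j, x j * Gu j t x y) - R t x y))
      ((Adm.const p).mul (((Adm.sin.mul (.sum _ fun j _ => (Adm.snd_apply j).mul (aGv j))).sub
      (((Adm.const s).mul Adm.cos).mul (.sum _ fun j _ => (Adm.fst_apply j).mul (aGu j)))).sub aR))
      hPt t x
    convert! key using 1
    have j1 : Integrable (fun y : Eu n => Real.sin t * ∑ j, y j * Gv j t x y) γ :=
      (integrable_finsetSum _ fun j _ => i1 j).const_mul _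
    have j2 : Integrable (fun y : Eu n => s * Real.cos t * ∑ j, x j * Gu j t x y) γ :=
      (integrable_finsetSum _ fun j _ => i2 j).const_mul _
    have j12 : Integrable (fun y : Eu n => Real.sin t * ∑ j, y j * Gv j t x y
      - s * Real.cos t * ∑ j, x j * Gu j t x y) γ := j1.sub j2
    rw [← hγ, integral_const_mul, integral_sub j12 (aR.integrable t x), integral_sub j1 j2,
      integral_const_mul, integral_const_mul, integral_finsetSum _ fun j _ => i1 j,
      integral_finsetSum _ fun j _ => i2 j]
    simp only [h', integral_const_mul]
    have : ∀ j, ∫ y : Eu n, y j * Gv j t x y ∂γ = IV j t x := fun j =>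
      integral_coord_mul_gaussMeasure j ((aGv j).continuous_snd t x) ((aWv j).continuous_snd t x)
        ((aGv j).expBdd_snd t x) ((aWv j).expBdd_snd t x) (hGv j t x)
    simp only [this]
    rfl
  have hhx : ∀ j t x, HasLineDerivAt ℝ (h t) (-(p * s * Real.sin t) * A j t x) x (basisVec j) := by
    intro j t x
    have := Adm.hasLineDerivAt_integral aP (u' := fun t x y => -(p * s * Real.sin t) * Gu j t x y)
      ((((Adm.const (p * s)).mul Adm.sin).neg).mul (aGu j)) _ (hPx j) t x
    rwa [integral_const_mul] at this
  have hAx : ∀ j t x, HasLineDerivAt ℝ (A j t) (IU j t x) x (basisVec j) := fun j t x =>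
    Adm.hasLineDerivAt_integral (aGu j) (aWu j) _ (hGu j) t x
  have apow : ∀ a : ℝ, AdmFst fun t x => h t x ^ a := fun a => ah.rpow hδ hδh a
  -- the derivative of the functional
  have hψ : ∀ t, HasDerivAt (fun t => ∫ x, h t x ^ r ∂γ)
      (∫ x, r * (h t x ^ (r - 1) * h' t x) ∂γ) t := by
    intro t
    refine AdmFst.hasDerivAt_integral (u' := fun t x => r * (h t x ^ (r - 1) * h' t x)) (apow r)
      ((AdmFst.const r).mul ((apow (r - 1)).mul ah')) (fun t x => ?_) t
    convert! (hht t x).rpow_const (p := r) (Or.inl (hh0 t x).ne') using 1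
    ring
  -- Z_j is the j-th partial derivative of h^{r−1} A_j, which is what integration by parts in x
  -- leaves. Its first term, from the derivative of h^{r−1}, is quadratic in A_j and carries the
  -- factor r − 1.
  let Z : Fin n → ℝ → Eu n → ℝ := fun j t x =>
    (r - 1) * h t x ^ (r - 2) * (-(p * s * Real.sin t) * A j t x) * A j t x
      + h t x ^ (r - 1) * IU j t x
  have aZ : ∀ j, AdmFst (Z j) := fun j =>
    ((((AdmFst.const (r - 1)).mul (apow (r - 2))).mul
      (((AdmFst.const (p * s)).mul aS).neg.mul (aA j))).mul (aA j)).add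
      ((apow (r - 1)).mul (aIU j))
  have hibp : ∀ j t, ∫ x : Eu n, x j * (h t x ^ (r - 1) * A j t x) ∂γ = ∫ x, Z j t x ∂γ := by
    intro j t
    have a1 : AdmFst fun t x => h t x ^ (r - 1) * A j t x := (apow (r - 1)).mul (aA j)
    refine integral_coord_mul_gaussMeasure j (a1.continuous t) ((aZ j).continuous t) (a1.expBdd t)
      ((aZ j).expBdd t) fun x => ?_
    have d1 : HasDerivAt (fun τ : ℝ => h t (x + τ • basisVec j))
      (-(p * s * Real.sin t) * A j t x) 0 := hhx j t x
    have d2 : HasDerivAt (fun τ : ℝ => A j t (x + τ • basisVec j)) (IU j t x) 0 := hAx j t x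
    have d3 := (d1.rpow_const (p := r - 1) (Or.inl (hh0 _ _).ne')).mul d2
    refine d3.congr_deriv ?_
    simp only [Z, zero_smul, add_zero]
    rw [show r - 1 - 1 = r - 2 by ring]
    ring
  have hneg : ∀ t ∈ Set.Icc 0 (Real.pi / 2), ∫ x, r * (h t x ^ (r - 1) * h' t x) ∂γ ≤ 0 := by
    intro t ht
    have hs0 : 0 ≤ Real.sin t := Real.sin_nonneg_of_nonneg_of_le_pi ht.1
      (by linarith [ht.2, Real.pi_pos])
    have hc0 : 0 ≤ Real.cos t := Real.cos_nonneg_of_neg_pi_div_two_le_of_le (by linarith [ht.1,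
      Real.pi_pos]) ht.2
    have k1 : ∀ j, Integrable (fun x : Eu n => x j * (h t x ^ (r - 1) * A j t x)) γ := fun j =>
      ((AdmFst.apply j).mul ((apow (r - 1)).mul (aA j))).integrable t
    have k2 : Integrable (fun x => h t x ^ (r - 1) * (Real.sin t * (∑ j, IV j t x) - IR t x)) γ :=
      ((apow (r - 1)).mul ((aS.mul (.sum _ fun j _ => aIV j)).sub aIR)).integrable t
    have k3 : ∀ j, Integrable (Z j t) γ := fun j => (aZ j).integrable t
    have e1 : ∫ x, r * (h t x ^ (r - 1) * h' t x) ∂γ =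
        ∫ x, r * p * (h t x ^ (r - 1) * (Real.sin t * (∑ j, IV j t x) - IR t x)
          - s * Real.cos t * ∑ j, Z j t x) ∂γ := by
      have k4 : Integrable (fun x : Eu n => s * Real.cos t *
          ∑ j, x j * (h t x ^ (r - 1) * A j t x)) γ :=
        (integrable_finsetSum _ fun j _ => k1 j).const_mul _
      have k5 : Integrable (fun x : Eu n => s * Real.cos t * ∑ j, Z j t x) γ :=
        (integrable_finsetSum _ fun j _ => k3 j).const_mul _
      have e2 : ∀ x, r * (h t x ^ (r - 1) * h' t x) =
          r * p * (h t x ^ (r - 1) * (Real.sin t * (∑ j, IV j t x) - IR t x)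
          - s * Real.cos t * ∑ j, x j * (h t x ^ (r - 1) * A j t x)) := by
        intro x
        have : ∑ j, x j * (h t x ^ (r - 1) * A j t x) = h t x ^ (r - 1) * ∑ j, x j * A j t x := by
          rw [Finset.mul_sum]; exact Finset.sum_congr rfl fun j _ => by ring
        rw [this]; simp only [h']; ring
      simp only [e2]
      rw [integral_const_mul, integral_const_mul, integral_sub k2 k4, integral_sub k2 k5,
        integral_const_mul, integral_const_mul, integral_finsetSum _ fun j _ => k1 j,
        integral_finsetSum _ fun j _ => k3 j]
      simp only [hibp]
    rw [e1]
    refine integral_nonpos fun x => ?_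
    refine mul_nonpos_of_nonneg_of_nonpos (by positivity) ?_
    -- Cauchy–Schwarz in y trades the quadratic term A_j² for h ∫ T_j. The integrand is then at most
    -- h^{r−1} times the y-integral of the left side of `hineq`, up to the factor r p.
    have hCS : ∀ j, A j t x ^ 2 ≤ h t x * IT j t x := fun j =>
      sq_integral_le ((aGu j).integrable t x) (aP.integrable t x) ((aT j).integrable t x)
        (fun y => hδ.le.trans (hP t x y)) (hT j t x) (hGT j t x)
    have hpw : h t x ^ (r - 1) = h t x ^ (r - 2) * h t x := by
      rw [← Real.rpow_add_one (hh0 t x).ne']; ring_nf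
    have hint : Real.sin t * (∑ j, IV j t x) - s * Real.cos t * (∑ j, IU j t x) - IR t x
        + (r - 1) * p * s ^ 2 * (Real.sin t * Real.cos t) * (∑ j, IT j t x) ≤ 0 := by
      have m1 := fun j => (aWv j).integrable t x
      have m2 := fun j => (aWu j).integrable t x
      have m3 := fun j => (aT j).integrable t x
      have M1 := (integrable_finsetSum Finset.univ fun j _ => m1 j).const_mul (Real.sin t)
      have M2 := (integrable_finsetSum Finset.univ fun j _ => m2 j).const_mul (s * Real.cos t)
      have M3 := (integrable_finsetSum Finset.univ fun j _ => m3 j).const_mul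
        ((r - 1) * p * s ^ 2 * (Real.sin t * Real.cos t))
      have M12 : Integrable (fun y => Real.sin t * (∑ j, Wv j t x y)
        - s * Real.cos t * (∑ j, Wu j t x y)) γ := M1.sub M2
      have M12R : Integrable (fun y => Real.sin t * (∑ j, Wv j t x y)
        - s * Real.cos t * (∑ j, Wu j t x y) - R t x y) γ := M12.sub (aR.integrable t x)
      have := integral_nonpos (μ := γ) (f := fun y => Real.sin t * (∑ j, Wv j t x y)
        - s * Real.cos t * (∑ j, Wu j t x y) - R t x y
        + (r - 1) * p * s ^ 2 * (Real.sin t * Real.cos t) * (∑ j, T j t x y))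
        (fun y => hineq t ht x y)
      rw [integral_add M12R M3,
        integral_sub M12 (aR.integrable t x), integral_sub M1 M2, integral_const_mul,
        integral_const_mul, integral_const_mul, integral_finsetSum _ fun j _ => m1 j,
        integral_finsetSum _ fun j _ => m2 j, integral_finsetSum _ fun j _ => m3 j] at this
      exact this
    have hsum : s * Real.cos t * ∑ j, Z j t x = h t x ^ (r - 1) * (s * Real.cos t * ∑ j, IU j t x)
        - h t x ^ (r - 2) * ((r - 1) * p * s ^ 2 * (Real.sin t * Real.cos t) *
          ∑ j, A j t x ^ 2) := by
      simp only [Z, Finset.mul_sum, ← Finset.sum_sub_distrib]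
      refine Finset.sum_congr rfl fun j _ => by ring
    have hq : 0 ≤ h t x ^ (r - 2) := Real.rpow_nonneg (hh0 t x).le _
    have hsumA : ∑ j, A j t x ^ 2 ≤ h t x * ∑ j, IT j t x := by
      rw [Finset.mul_sum]; exact Finset.sum_le_sum fun j _ => hCS j
    rw [hsum, hpw]
    have hk : 0 ≤ (r - 1) * p * s ^ 2 * (Real.sin t * Real.cos t) := by
      have : 0 ≤ r - 1 := by linarith
      positivity
    have h1 := mul_le_mul_of_nonneg_left (mul_le_mul_of_nonneg_left hsumA hk) hq
    have h2 := mul_nonpos_of_nonneg_of_nonpos (mul_nonneg hq (hh0 t x).le) hint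
    nlinarith [h1, h2]
  have hanti : AntitoneOn (fun t => ∫ x, h t x ^ r ∂γ) (Set.Icc 0 (Real.pi / 2)) := by
    refine antitoneOn_of_deriv_nonpos (convex_Icc _ _)
      (fun t _ => (hψ t).continuousAt.continuousWithinAt)
      (fun t _ => (hψ t).differentiableAt.differentiableWithinAt) fun t ht => ?_
    rw [(hψ t).deriv]
    exact hneg t (interior_subset ht)
  have hpi : 0 ≤ Real.pi / 2 := by positivity
  exact hanti ⟨le_rfl, hpi⟩ ⟨hpi, le_rfl⟩ hpi

end Flow

end Pitt

namespace Pitt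

open ComplexConjugate

/-! ### The flow of exponential sums -/

section TrigFlow

theorem hasDerivAt_conj_mul {K V : ℝ → ℂ} {K' V' : ℂ} {t : ℝ} (hK : HasDerivAt K K' t)
    (hV : HasDerivAt V V' t) :
    HasDerivAt (fun t => conj (K t) * V t) (conj K' * V t + conj (K t) * V') t :=
  hK.star.mul hV

theorem hasDerivAt_re_conj_mul {K V : ℝ → ℂ} {K' V' : ℂ} {t : ℝ} (hK : HasDerivAt K K' t)
    (hV : HasDerivAt V V' t) :
    HasDerivAt (fun t => (conj (K t) * V t).re) (conj K' * V t + conj (K t) * V').re t :=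
  Complex.reCLM.hasFDerivAt.comp_hasDerivAt t (hasDerivAt_conj_mul hK hV)

theorem hasDerivAt_im_conj_mul {K V : ℝ → ℂ} {K' V' : ℂ} {t : ℝ} (hK : HasDerivAt K K' t)
    (hV : HasDerivAt V V' t) :
    HasDerivAt (fun t => (conj (K t) * V t).im) (conj K' * V t + conj (K t) * V').im t :=
  Complex.imCLM.hasFDerivAt.comp_hasDerivAt t (hasDerivAt_conj_mul hK hV)

theorem re_conj_mul_self_nonneg (z : ℂ) : 0 ≤ (conj z * z).re := by
  simp [Complex.mul_re]; nlinarith [sq_nonneg z.re, sq_nonneg z.im]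

/-- Writing |K|² as `(conj K * K).re` keeps every derivative polynomial in real and imaginary parts,
so that later identities close by `ring`; ε > 0 keeps the base positive for every exponent. -/
theorem hasDerivAt_rpow_conj_mul_self {K : ℝ → ℂ} {K' : ℂ} {t ε : ℝ} (hε : 0 < ε)
    (hK : HasDerivAt K K' t) (a : ℝ) :
    HasDerivAt (fun t => ((conj (K t) * K t).re + ε) ^ a)
      (2 * a * ((conj (K t) * K t).re + ε) ^ (a - 1) * (conj (K t) * K').re) t := by
  have h := ((hasDerivAt_re_conj_mul hK hK).add_const ε).rpow_const (p := a)
    (Or.inl (add_pos_of_nonneg_of_pos (re_conj_mul_self_nonneg (K t)) hε).ne')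
  refine h.congr_deriv ?_
  simp only [Complex.add_re, Complex.mul_re, Complex.conj_re, Complex.conj_im]
  ring

variable {n : ℕ} {ι : Type*} [Fintype ι]

/-- The exponentials `exp (i cos θ b·y - s sin θ b·x - (p/2) sin² θ |b|²)`. -/
noncomputable def flowExp (p s : ℝ) (b : Eu n) (t : ℝ) (x y : Eu n) : ℂ :=
  Complex.exp (((Real.cos t * inner ℝ b y : ℝ) : ℂ) * Complex.I
    - ((s * Real.sin t * inner ℝ b x + p / 2 * Real.sin t ^ 2 * ‖b‖ ^ 2 : ℝ) : ℂ))

/-- Linear combinations of the exponentials `flowExp`, with additional real weights `d`. -/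
noncomputable def flowSum (p s : ℝ) (c : ι → ℂ) (b : ι → Eu n) (d : ι → ℝ) (t : ℝ) (x y : Eu n) :
    ℂ := ∑ k, c k * d k * flowExp p s (b k) t x y

variable {p s : ℝ} {c : ι → ℂ} {b : ι → Eu n}

theorem continuous_flowSum (d : ι → ℝ) :
    Continuous fun z : ℝ × Eu n × Eu n => flowSum p s c b d z.1 z.2.1 z.2.2 := by
  unfold flowSum flowExp
  refine continuous_finsetSum _ fun k _ => continuous_const.mul (Complex.continuous_exp.comp ?_)
  exact ((Complex.continuous_ofReal.comp (by fun_prop)).mul continuous_const).sub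
    (Complex.continuous_ofReal.comp (by fun_prop))

theorem expBdd_flowSum (hp : 0 ≤ p) (d : ι → ℝ) :
    ExpBdd (fun z : ℝ × Eu n × Eu n => ‖z.2.1‖ + ‖z.2.2‖)
      fun z => flowSum p s c b d z.1 z.2.1 z.2.2 := by
  refine ExpBdd.sum weight_nonneg _ fun k _ => (ExpBdd.const _).mul
    ⟨1, |s| * ‖b k‖, zero_le_one, by positivity, ?_⟩
  rintro ⟨t, x, y⟩
  simp only [flowExp]
  rw [Complex.norm_exp, one_mul]
  apply Real.exp_le_exp.2
  simp only [Complex.sub_re, Complex.mul_re, Complex.ofReal_re, Complex.I_re, Complex.ofReal_im,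
    Complex.I_im]
  have h1 : |s * Real.sin t * inner ℝ (b k) x| ≤ |s| * 1 * (‖b k‖ * ‖x‖) := by
    rw [abs_mul, abs_mul]
    gcongr
    · exact Real.abs_sin_le_one t
    · exact abs_real_inner_le_norm _ _
  have h2 := neg_abs_le (s * Real.sin t * inner ℝ (b k) x)
  have h3 : 0 ≤ p / 2 * Real.sin t ^ 2 * ‖b k‖ ^ 2 := by positivity
  have h4 : 0 ≤ |s| * ‖b k‖ * ‖y‖ := by positivity
  nlinarith

theorem adm_re_flowSum (hp : 0 ≤ p) (d d' : ι → ℝ) :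
    Adm fun t x y => (conj (flowSum p s c b d t x y) * flowSum p s c b d' t x y).re :=
  ⟨Complex.continuous_re.comp ((Complex.continuous_conj.comp (continuous_flowSum d)).mul
    (continuous_flowSum d')), ((expBdd_flowSum (s := s) (c := c) (b := b) hp d).mul (expBdd_flowSum (s := s) (c := c) (b := b)
      hp d')).of_le fun z => (Complex.abs_re_le_norm _).trans (by simp)⟩

theorem adm_im_flowSum (hp : 0 ≤ p) (d d' : ι → ℝ) :
    Adm fun t x y => (conj (flowSum p s c b d t x y) * flowSum p s c b d' t x y).im :=
  ⟨Complex.continuous_im.comp ((Complex.continuous_conj.comp (continuous_flowSum d)).mul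
    (continuous_flowSum d')), ((expBdd_flowSum (s := s) (c := c) (b := b) hp d).mul (expBdd_flowSum (s := s) (c := c) (b := b)
      hp d')).of_le fun z => (Complex.abs_im_le_norm _).trans (by simp)⟩

theorem Adm.rpow {u : ℝ → Eu n → Eu n → ℝ} (hu : Adm u) {δ : ℝ} (hδ : 0 < δ)
    (h : ∀ t x y, δ ≤ u t x y) (a : ℝ) : Adm fun t x y => u t x y ^ a := by
  have hc : Continuous fun z : ℝ × Eu n × Eu n => u z.1 z.2.1 z.2.2 ^ a :=
    hu.cont.rpow_const fun z => Or.inl (hδ.trans_le (h _ _ _)).ne'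
  rcases le_total 0 a with ha | ha
  · exact ⟨hc, hu.bdd.rpow (fun z => hδ.le.trans (h _ _ _)) ha⟩
  · refine of_bound hc (δ ^ a) fun t x y => ?_
    rw [abs_of_nonneg (Real.rpow_nonneg (hδ.le.trans (h _ _ _)) _)]
    exact Real.rpow_le_rpow_of_nonpos hδ (h t x y) ha

/-- Differentiating the exponent gives b·y, b·x and |b|². Expanding these in coordinates puts
factors b_j into the sums, which is the purpose of the extra weights `d`: the family of weighted
sums is closed under all derivatives used. -/
theorem hasDerivAt_flowSum (t : ℝ) (x y : Eu n) :
    HasDerivAt (fun t => flowSum p s c b (fun _ => 1) t x y)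
      (-Complex.I * Real.sin t * (∑ j, y j * flowSum p s c b (fun k => b k j) t x y)
        - s * Real.cos t * (∑ j, x j * flowSum p s c b (fun k => b k j) t x y)
        - p * Real.sin t * Real.cos t *
          ∑ j, flowSum p s c b (fun k => b k j * b k j) t x y) t := by
  have hk : ∀ k, HasDerivAt (fun t => c k * ((1 : ℝ) : ℂ) * flowExp p s (b k) t x y)
      (c k * ((1 : ℝ) : ℂ) * (flowExp p s (b k) t x y *
        (((-Real.sin t * inner ℝ (b k) y : ℝ) : ℂ) * Complex.I
        - ((s * Real.cos t * inner ℝ (b k) x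
          + p / 2 * (2 * Real.sin t * Real.cos t) * ‖b k‖ ^ 2 : ℝ) : ℂ)))) t := by
    intro k
    refine HasDerivAt.const_mul _ (HasDerivAt.cexp ?_)
    have h1 := (((Real.hasDerivAt_cos t).mul_const (inner ℝ (b k) y)).ofReal_comp).mul_const
      Complex.I
    have h2 := ((((Real.hasDerivAt_sin t).const_mul s).mul_const (inner ℝ (b k) x)).add
      ((((Real.hasDerivAt_sin t).pow 2).const_mul (p / 2)).mul_const (‖b k‖ ^ 2))).ofReal_comp
    refine (h1.sub h2).congr_deriv ?_
    simp
  have := HasDerivAt.fun_sum (u := Finset.univ) fun k _ => hk k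
  refine this.congr_deriv ?_
  simp only [flowSum, Finset.mul_sum]
  rw [Finset.sum_comm, Finset.sum_comm (s := Finset.univ (α := Fin n)),
    Finset.sum_comm (s := Finset.univ (α := Fin n)), ← Finset.sum_sub_distrib,
    ← Finset.sum_sub_distrib]
  refine Finset.sum_congr rfl fun k _ => ?_
  have e : ∀ z : Eu n, ((inner ℝ (b k) z : ℝ) : ℂ) = ∑ j, (b k j : ℂ) * z j := fun z => by
    simp [PiLp.inner_apply, mul_comm]
  have e2 : ((‖b k‖ : ℝ) : ℂ) ^ 2 = ∑ j, (b k j : ℂ) * b k j := by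
    rw [← e, real_inner_self_eq_norm_sq]; simp
  push_cast
  rw [e, e, e2]
  simp only [Finset.mul_sum, Finset.sum_mul, mul_sub, mul_add, ← Finset.sum_sub_distrib,
    ← Finset.sum_add_distrib]
  refine Finset.sum_congr rfl fun j _ => ?_
  ring

theorem hasDerivAt_flowSum_snd (d : ι → ℝ) (j : Fin n) (t : ℝ) (x y : Eu n) :
    HasDerivAt (fun τ : ℝ => flowSum p s c b d t x (y + τ • basisVec j))
      (Complex.I * Real.cos t * flowSum p s c b (fun k => d k * b k j) t x y) 0 := by
  have hk : ∀ k, HasDerivAt (fun τ : ℝ => c k * d k * flowExp p s (b k) t x (y + τ • basisVec j))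
      (c k * d k * (flowExp p s (b k) t x y * (((Real.cos t * b k j : ℝ) : ℂ) * Complex.I))) 0 := by
    intro k
    have h0 : HasDerivAt (fun τ : ℝ => Real.cos t * inner ℝ (b k) (y + τ • basisVec j))
        (Real.cos t * b k j) 0 := by
      simp only [inner_add_right, inner_smul_right]
      have := (((hasDerivAt_id (0 : ℝ)).mul_const (inner ℝ (b k) (basisVec j))).const_add
        (inner ℝ (b k) y)).const_mul (Real.cos t)
      refine this.congr_deriv ?_
      simp [basisVec, EuclideanSpace.inner_single_right]
    have h1 := (((h0.ofReal_comp).mul_const Complex.I).sub_const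
      ((s * Real.sin t * inner ℝ (b k) x + p / 2 * Real.sin t ^ 2 * ‖b k‖ ^ 2 : ℝ) : ℂ)).cexp
    refine (h1.const_mul (c k * d k)).congr_deriv ?_
    simp [flowExp]
  have := HasDerivAt.fun_sum (u := Finset.univ) fun k _ => hk k
  refine this.congr_deriv ?_
  simp only [flowSum, Finset.mul_sum]
  refine Finset.sum_congr rfl fun k _ => ?_
  push_cast; ring

theorem hasDerivAt_flowSum_fst (d : ι → ℝ) (j : Fin n) (t : ℝ) (x y : Eu n) :
    HasDerivAt (fun τ : ℝ => flowSum p s c b d t (x + τ • basisVec j) y)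
      (-(s * Real.sin t) * flowSum p s c b (fun k => d k * b k j) t x y) 0 := by
  have hk : ∀ k, HasDerivAt (fun τ : ℝ => c k * d k * flowExp p s (b k) t (x + τ • basisVec j) y)
      (c k * d k * (flowExp p s (b k) t x y * (-((s * Real.sin t * b k j : ℝ) : ℂ)))) 0 := by
    intro k
    have h0 : HasDerivAt (fun τ : ℝ => s * Real.sin t * inner ℝ (b k) (x + τ • basisVec j)
        + p / 2 * Real.sin t ^ 2 * ‖b k‖ ^ 2) (s * Real.sin t * b k j) 0 := by
      simp only [inner_add_right, inner_smul_right]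
      have := ((((hasDerivAt_id (0 : ℝ)).mul_const (inner ℝ (b k) (basisVec j))).const_add
        (inner ℝ (b k) x)).const_mul (s * Real.sin t)).add_const
        (p / 2 * Real.sin t ^ 2 * ‖b k‖ ^ 2)
      refine this.congr_deriv ?_
      simp [basisVec, EuclideanSpace.inner_single_right]
    have h1 := ((h0.ofReal_comp).const_sub
      (((Real.cos t * inner ℝ (b k) y : ℝ) : ℂ) * Complex.I)).cexp
    refine (h1.const_mul (c k * d k)).congr_deriv ?_
    simp [flowExp]
  have := HasDerivAt.fun_sum (u := Finset.univ) fun k _ => hk k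
  refine this.congr_deriv ?_
  simp only [flowSum, Finset.mul_sum]
  refine Finset.sum_congr rfl fun k _ => ?_
  push_cast; ring

/-- The flow inequality for exponential sums, regularised by `ε`. -/
theorem integral_flowSum_rpow_le {q ε : ℝ} (hp1 : 1 < p) (hp2 : p ≤ 2) (hs : s ^ 2 = p - 1)
    (hq : (q / p - 1) * (p - 1) = 2 - p) (hε : 0 < ε) (c : ι → ℂ) (b : ι → Eu n) :
    ∫ x, (∫ y, (‖flowSum p s c b (fun _ => 1) (Real.pi / 2) x y‖ ^ 2 + ε) ^ (p / 2)
        ∂(gaussMeasure n)) ^ (q / p) ∂(gaussMeasure n) ≤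
      ∫ x, (∫ y, (‖flowSum p s c b (fun _ => 1) 0 x y‖ ^ 2 + ε) ^ (p / 2)
        ∂(gaussMeasure n)) ^ (q / p) ∂(gaussMeasure n) := by
  have hp0 : 0 ≤ p := by linarith
  have hnorm : ∀ z : ℂ, ‖z‖ ^ 2 = (conj z * z).re := fun z => by
    rw [← Complex.normSq_eq_norm_sq, ← Complex.normSq_eq_conj_mul_self, Complex.ofReal_re]
  simp only [hnorm]
  have hr : 1 ≤ q / p := by
    by_contra! h
    nlinarith
  set K := flowSum p s c b (fun _ => 1) with hK
  set V : Fin n → ℝ → Eu n → Eu n → ℂ := fun j => flowSum p s c b (fun k => b k j) with hV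
  set V2 : Fin n → ℝ → Eu n → Eu n → ℂ := fun j => flowSum p s c b (fun k => b k j * b k j)
    with hV2
  set N : ℝ → Eu n → Eu n → ℝ := fun t x y => (conj (K t x y) * K t x y).re + ε with hN
  have aN : Adm N := (adm_re_flowSum hp0 _ _).add (.const ε)
  have hNε : ∀ t x y, ε ≤ N t x y := fun t x y => by
    simpa [N] using re_conj_mul_self_nonneg (K t x y)
  have aNp : ∀ a : ℝ, Adm fun t x y => N t x y ^ a := fun a => aN.rpow hε hNε a
  have hN0 : ∀ t x y, 0 < N t x y := fun t x y => hε.trans_le (hNε t x y)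
  have au : ∀ j, Adm fun t x y => (conj (K t x y) * V j t x y).re := fun j =>
    adm_re_flowSum hp0 _ _
  have av : ∀ j, Adm fun t x y => (conj (K t x y) * V j t x y).im := fun j =>
    adm_im_flowSum hp0 _ _
  have ak : ∀ j, Adm fun t x y => (conj (K t x y) * V2 j t x y).re := fun j =>
    adm_re_flowSum hp0 _ _
  have aD : ∀ j, Adm fun t x y => (conj (V j t x y) * V j t x y).re := fun j =>
    adm_re_flowSum hp0 _ _
  have dKx : ∀ j t x y, HasDerivAt (fun τ : ℝ => K t (x + τ • basisVec j) y)
      (-(s * Real.sin t) * V j t x y) 0 := fun j t x y => by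
    simpa [K, V] using hasDerivAt_flowSum_fst (p := p) (s := s) (c := c) (b := b)
      (fun _ => 1) j t x y
  have dKy : ∀ j t x y, HasDerivAt (fun τ : ℝ => K t x (y + τ • basisVec j))
      (Complex.I * Real.cos t * V j t x y) 0 := fun j t x y => by
    simpa [K, V] using hasDerivAt_flowSum_snd (p := p) (s := s) (c := c) (b := b)
      (fun _ => 1) j t x y
  have dVx : ∀ j t x y, HasDerivAt (fun τ : ℝ => V j t (x + τ • basisVec j) y)
      (-(s * Real.sin t) * V2 j t x y) 0 := fun j t x y => hasDerivAt_flowSum_fst _ j t x y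
  have dVy : ∀ j t x y, HasDerivAt (fun τ : ℝ => V j t x (y + τ • basisVec j))
      (Complex.I * Real.cos t * V2 j t x y) 0 := fun j t x y => hasDerivAt_flowSum_snd _ j t x y
  have dKt := fun t x y => hasDerivAt_flowSum (p := p) (s := s) (c := c) (b := b) t x y
  -- With m = N^{p/2−2}, u_j = Re(K̄ V_j) and v_j = Im(K̄ V_j): a y-derivative multiplies by i cos
  -- t, so imaginary parts appear in `Gv` where real parts appear in `Gu`. `T` is m u_j², for which
  -- Gu_j² = P T_j holds with equality. `R` is the contribution of the |b|² term of the exponent.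
  refine integral_rpow_integral_le (r := q / p) (p := p) (s := s) (δ := ε ^ (p / 2))
    (P := fun t x y => N t x y ^ (p / 2))
    (R := fun t x y => p * (Real.sin t * Real.cos t) * (N t x y ^ (p / 2 - 1) *
      ∑ j, (conj (K t x y) * V2 j t x y).re))
    (Gu := fun j t x y => N t x y ^ (p / 2 - 1) * (conj (K t x y) * V j t x y).re)
    (Gv := fun j t x y => N t x y ^ (p / 2 - 1) * (conj (K t x y) * V j t x y).im)
    (Wu := fun j t x y => -(s * Real.sin t) * (N t x y ^ (p / 2 - 1) *
      ((conj (K t x y) * V2 j t x y).re + (conj (V j t x y) * V j t x y).re)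
      - (2 - p) * (N t x y ^ (p / 2 - 2) * ((conj (K t x y) * V j t x y).re *
        (conj (K t x y) * V j t x y).re))))
    (Wv := fun j t x y => Real.cos t * (N t x y ^ (p / 2 - 1) *
      ((conj (K t x y) * V2 j t x y).re - (conj (V j t x y) * V j t x y).re)
      + (2 - p) * (N t x y ^ (p / 2 - 2) * ((conj (K t x y) * V j t x y).im *
        (conj (K t x y) * V j t x y).im))))
    (T := fun j t x y => N t x y ^ (p / 2 - 2) * ((conj (K t x y) * V j t x y).re *
        (conj (K t x y) * V j t x y).re))
    hr hp0 (by positivity) (aNp _)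
    (((Adm.const p).mul (Adm.sin.mul Adm.cos)).mul ((aNp _).mul (.sum _ fun j _ => ak j)))
    (fun j => (aNp _).mul (au j)) (fun j => (aNp _).mul (av j))
    (fun j => ((Adm.const s).mul Adm.sin).neg.mul (((aNp _).mul ((ak j).add (aD j))).sub
      ((Adm.const (2 - p)).mul ((aNp _).mul ((au j).mul (au j))))))
    (fun j => Adm.cos.mul (((aNp _).mul ((ak j).sub (aD j))).add
      ((Adm.const (2 - p)).mul ((aNp _).mul ((av j).mul (av j))))))
    (fun j => (aNp _).mul ((au j).mul (au j)))
    (fun t x y => Real.rpow_le_rpow hε.le (hNε t x y) (by positivity))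
    ?_ ?_ ?_ ?_ ?_ ?_ ?_
  · intro t x y
    have h := hasDerivAt_rpow_conj_mul_self hε (dKt t x y) (p / 2)
    refine h.congr_deriv ?_
    have e1 : ∀ (w : Fin n → ℝ) (Y : Fin n → ℂ) (z : ℂ), (z * ∑ j, (w j : ℂ) * Y j) =
        (((∑ j, w j * (z * Y j).re : ℝ)) : ℂ) + ((∑ j, w j * (z * Y j).im : ℝ) : ℂ) *
          Complex.I := by
      intro w Y z
      push_cast
      rw [Finset.mul_sum, Finset.sum_mul, ← Finset.sum_add_distrib]
      refine Finset.sum_congr rfl fun j _ => ?_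
      conv_lhs => rw [mul_left_comm, ← Complex.re_add_im (z * Y j)]
      ring
    have e2 := e1 (fun j => y j) (fun j => V j t x y) (conj (K t x y))
    have e3 := e1 (fun j => x j) (fun j => V j t x y) (conj (K t x y))
    have e4 : (conj (K t x y) * ∑ j, V2 j t x y).re = ∑ j, (conj (K t x y) * V2 j t x y).re := by
      rw [Finset.mul_sum, Complex.re_sum]
    have e5 : (conj (K t x y) * (-Complex.I * Real.sin t * (∑ j, y j * V j t x y)
        - s * Real.cos t * (∑ j, x j * V j t x y)
        - p * Real.sin t * Real.cos t * ∑ j, V2 j t x y)).re =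
        Real.sin t * (∑ j, y j * (conj (K t x y) * V j t x y).im)
        - s * Real.cos t * (∑ j, x j * (conj (K t x y) * V j t x y).re)
        - p * (Real.sin t * Real.cos t) * ∑ j, (conj (K t x y) * V2 j t x y).re := by
      rw [← e4]
      have : conj (K t x y) * (-Complex.I * Real.sin t * (∑ j, y j * V j t x y)
        - s * Real.cos t * (∑ j, x j * V j t x y)
        - p * Real.sin t * Real.cos t * ∑ j, V2 j t x y) =
        -Complex.I * Real.sin t * (conj (K t x y) * ∑ j, y j * V j t x y)
        - ((s * Real.cos t : ℝ) : ℂ) * (conj (K t x y) * ∑ j, x j * V j t x y)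
        - ((p * (Real.sin t * Real.cos t) : ℝ) : ℂ) * (conj (K t x y) * ∑ j, V2 j t x y) := by
        push_cast; ring
      rw [this, e2, e3]
      rw [Complex.sub_re, Complex.sub_re, Complex.re_ofReal_mul, Complex.re_ofReal_mul]
      simp only [Complex.mul_re, Complex.neg_re, Complex.I_re, Complex.neg_im, Complex.I_im,
        Complex.ofReal_re, Complex.ofReal_im, Complex.add_re, Complex.add_im, Complex.mul_im]
      ring
    have e6 : ∀ (m : ℝ) (w g : Fin n → ℝ), ∑ j, w j * (m * g j) = m * ∑ j, w j * g j := by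
      intro m w g
      rw [Finset.mul_sum]; exact Finset.sum_congr rfl fun j _ => by ring
    simp only [e6]
    refine (congrArg (fun z => 2 * (p / 2) * N t x y ^ (p / 2 - 1) * z) e5).trans ?_
    ring
  · intro j t x y
    have h := hasDerivAt_rpow_conj_mul_self hε (dKx j t x y) (p / 2)
    refine h.congr_deriv ?_
    simp only [zero_smul, add_zero, N, Complex.mul_re, Complex.conj_re, Complex.conj_im,
      Complex.neg_re, Complex.neg_im, Complex.mul_im, Complex.ofReal_re, Complex.ofReal_im]
    ring
  · intro j t x y
    have h := (hasDerivAt_rpow_conj_mul_self hε (dKx j t x y) (p / 2 - 1)).mul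
      (hasDerivAt_re_conj_mul (dKx j t x y) (dVx j t x y))
    refine h.congr_deriv ?_
    rw [show p / 2 - 1 - 1 = p / 2 - 2 by ring]
    simp only [zero_smul, add_zero, N, Complex.mul_re, Complex.conj_re, Complex.conj_im,
      Complex.neg_re, Complex.neg_im, Complex.mul_im, Complex.ofReal_re, Complex.ofReal_im,
      Complex.add_re, map_mul, map_neg]
    ring
  · intro j t x y
    have h := (hasDerivAt_rpow_conj_mul_self hε (dKy j t x y) (p / 2 - 1)).mul
      (hasDerivAt_im_conj_mul (dKy j t x y) (dVy j t x y))
    refine h.congr_deriv ?_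
    rw [show p / 2 - 1 - 1 = p / 2 - 2 by ring]
    simp only [zero_smul, add_zero, N, Complex.mul_re, Complex.conj_re, Complex.conj_im,
      Complex.mul_im, Complex.ofReal_re, Complex.ofReal_im, Complex.add_im, map_mul,
      Complex.I_re, Complex.I_im]
    ring
  · intro j t x y
    exact mul_nonneg (Real.rpow_nonneg (hN0 t x y).le _) (mul_self_nonneg _)
  · intro j t x y
    have h0 := hN0 t x y
    have e1 : N t x y ^ (p / 2) = N t x y ^ (p / 2 - 2) * N t x y ^ 2 := by
      rw [← Real.rpow_natCast, ← Real.rpow_add h0]; norm_num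
    have e2 : N t x y ^ (p / 2 - 1) = N t x y ^ (p / 2 - 2) * N t x y := by
      rw [← Real.rpow_add_one h0.ne']; ring_nf
    simp only [e1, e2]
    apply le_of_eq; ring
  · intro t ht x y
    have hs0 : 0 ≤ Real.sin t := Real.sin_nonneg_of_nonneg_of_le_pi ht.1
      (by linarith [ht.2, Real.pi_pos])
    have hc0 : 0 ≤ Real.cos t := Real.cos_nonneg_of_neg_pi_div_two_le_of_le (by linarith [ht.1,
      Real.pi_pos]) ht.2
    have h0 := hN0 t x y
    have e2 : N t x y ^ (p / 2 - 1) = N t x y ^ (p / 2 - 2) * N t x y := by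
      rw [← Real.rpow_add_one h0.ne']; ring_nf
    have hm : 0 ≤ N t x y ^ (p / 2 - 2) := Real.rpow_nonneg h0.le _
    have hNk : (conj (K t x y) * K t x y).re ≤ N t x y := by simp only [N]; linarith
    simp only [e2, Finset.mul_sum, ← Finset.sum_sub_distrib, ← Finset.sum_add_distrib]
    refine Finset.sum_nonpos fun j _ => ?_
    set m := N t x y ^ (p / 2 - 2)
    set u := (conj (K t x y) * V j t x y).re with hu
    set v := (conj (K t x y) * V j t x y).im with hv
    set D := (conj (V j t x y) * V j t x y).re with hD
    set κ := (conj (K t x y) * V2 j t x y).re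
    have hD0 : 0 ≤ D := re_conj_mul_self_nonneg _
    have huv : u * u + v * v = (conj (K t x y) * K t x y).re * D := by
      simp only [hu, hv, hD, Complex.mul_re, Complex.mul_im, Complex.conj_re, Complex.conj_im]
      ring
    have huv' : u * u + v * v ≤ N t x y * D := huv ▸ mul_le_mul_of_nonneg_right hNk hD0
    have hk : (q / p - 1) * s ^ 2 = 2 - p := by rw [hs, hq]
    -- The exponents meet here. The second-order terms κ cancel because 1 + s² = p; the terms in u²
    -- combine to 2 − p because (q/p − 1) s² = 2 − p. What remains has the sign of |K V|² − N |V|²,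
    -- which is nonpositive since |K|² ≤ N.
    have : Real.sin t * (Real.cos t * (m * N t x y * (κ - D) + (2 - p) * (m * (v * v))))
        - s * Real.cos t * (-(s * Real.sin t) * (m * N t x y * (κ + D) - (2 - p) * (m * (u * u))))
        - p * (Real.sin t * Real.cos t) * (m * N t x y * κ)
        + (q / p - 1) * p * s ^ 2 * (Real.sin t * Real.cos t) * (m * (u * u)) =
        -(Real.sin t * Real.cos t * (2 - p) * m * (N t x y * D - (u * u + v * v))) := by
      linear_combination (Real.sin t * Real.cos t * (m * N t x y * (κ + D)
        - (2 - p) * (m * (u * u)))) * hs + (p * (Real.sin t * Real.cos t) * (m * (u * u))) * hk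
    rw [this]
    have h2p : 0 ≤ 2 - p := by linarith
    have : 0 ≤ N t x y * D - (u * u + v * v) := by linarith
    rw [neg_nonpos]
    positivity

end TrigFlow

end Pitt

namespace Pitt

open ComplexConjugate Filter Topology

/-! ### Hypercontractivity with imaginary parameter -/

section Hypercontractivity

variable {n : ℕ} {ι : Type*} [Fintype ι] {p q s : ℝ}

theorem flowSum_zero (c : ι → ℂ) (b : ι → Eu n) (x y : Eu n) :
    flowSum p s c b (fun _ => 1) 0 x y =
      ∑ k, c k * Complex.exp (((inner ℝ (b k) y : ℝ) : ℂ) * Complex.I) := by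
  simp [flowSum, flowExp]

theorem flowSum_pi_div_two (c : ι → ℂ) (b : ι → Eu n) (x y : Eu n) :
    flowSum p s c b (fun _ => 1) (Real.pi / 2) x y =
      ∑ k, c k * Complex.exp ((-(s * inner ℝ (b k) x) - p / 2 * ‖b k‖ ^ 2 : ℝ) : ℂ) := by
  simp only [flowSum, flowExp]
  refine Finset.sum_congr rfl fun k _ => ?_
  simp only [Real.cos_pi_div_two, Real.sin_pi_div_two]
  push_cast
  ring_nf

theorem adm_norm_rpow_flowSum (hp : 0 ≤ p) {a : ℝ} (ha : 0 ≤ a) (c : ι → ℂ) (b : ι → Eu n) :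
    Adm fun t x y => ‖flowSum p s c b (fun _ => 1) t x y‖ ^ a :=
  ⟨(continuous_flowSum _).norm.rpow_const fun _ => Or.inr ha,
    ExpBdd.rpow ((expBdd_flowSum (s := s) (c := c) (b := b) hp (fun _ => 1)).of_le
      fun z => by simp) (fun z => norm_nonneg _) ha⟩

theorem Adm.admFst {u : ℝ → Eu n → Eu n → ℝ} (hu : Adm u) : AdmFst fun t x => u t x 0 :=
  ⟨hu.cont.comp (by fun_prop : Continuous fun z : ℝ × Eu n => (z.1, z.2, (0 : Eu n))),
    hu.bdd.comp (fun z : ℝ × Eu n => (z.1, z.2, (0 : Eu n))) fun z => by simp⟩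

/-- Complex hypercontractivity for exponential sums. -/
theorem integral_exp_sum_rpow_le (hp1 : 1 < p) (hp2 : p ≤ 2) (hpq : 1 / p + 1 / q = 1)
    (c : ι → ℂ) (b : ι → Eu n) :
    ∫ x, ‖∑ k, c k * Complex.exp ((-(Real.sqrt (p - 1) * inner ℝ (b k) x)
        - p / 2 * ‖b k‖ ^ 2 : ℝ) : ℂ)‖ ^ q ∂(gaussMeasure n) ≤
      (∫ y, ‖∑ k, c k * Complex.exp (((inner ℝ (b k) y : ℝ) : ℂ) * Complex.I)‖ ^ p
        ∂(gaussMeasure n)) ^ (q / p) := by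
  have hp0 : 0 < p := by linarith
  have hconj : p.HolderConjugate q := by
    rw [Real.holderConjugate_iff]; exact ⟨hp1, by simpa using hpq⟩
  have hq0 : 0 < q := hconj.symm.pos
  have hqeq : q * (p - 1) = p := by
    have := hconj.mul_eq_add; linarith
  have hq : (q / p - 1) * (p - 1) = 2 - p := by
    field_simp; linear_combination hqeq
  have hs : Real.sqrt (p - 1) ^ 2 = p - 1 := Real.sq_sqrt (by linarith)
  simp only [← flowSum_zero (p := p) (s := Real.sqrt (p - 1)) c b 0,
    ← flowSum_pi_div_two c b _ 0]
  set s := Real.sqrt (p - 1)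
  have aφ : ∀ a : ℝ, 0 ≤ a → Adm fun t x y => ‖flowSum p s c b (fun _ => 1) t x y‖ ^ a :=
    fun a ha => adm_norm_rpow_flowSum hp0.le ha c b
  -- At θ = π/2 the integrand does not depend on y, at θ = 0 it does not depend on x. As γ is a
  -- probability measure, one of the two integrations disappears at each end of the flow.
  have key : ∀ ε : ℝ, 0 < ε →
      ∫ x, ‖flowSum p s c b (fun _ => 1) (Real.pi / 2) x 0‖ ^ q ∂(gaussMeasure n) ≤
      (∫ y, ‖flowSum p s c b (fun _ => 1) 0 0 y‖ ^ p ∂(gaussMeasure n) + ε ^ (p / 2)) ^ (q / p) := by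
    intro ε hε
    have h1 := integral_flowSum_rpow_le hp1 hp2 hs hq hε c b
    have e0 : ∀ x y, flowSum p s c b (fun _ => 1) 0 x y = flowSum p s c b (fun _ => 1) 0 0 y :=
      fun x y => by rw [flowSum_zero, flowSum_zero]
    have e1 : ∀ x y, flowSum p s c b (fun _ => 1) (Real.pi / 2) x y =
        flowSum p s c b (fun _ => 1) (Real.pi / 2) x 0 :=
      fun x y => by rw [flowSum_pi_div_two, flowSum_pi_div_two]
    have e2 : ∀ x, ∫ y, (‖flowSum p s c b (fun _ => 1) (Real.pi / 2) x y‖ ^ 2 + ε) ^ (p / 2)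
        ∂(gaussMeasure n) = (‖flowSum p s c b (fun _ => 1) (Real.pi / 2) x 0‖ ^ 2 + ε) ^ (p / 2) := by
      intro x; simp [e1 x]
    have e3 : ∀ x, ∫ y, (‖flowSum p s c b (fun _ => 1) 0 x y‖ ^ 2 + ε) ^ (p / 2)
        ∂(gaussMeasure n) =
        ∫ y, (‖flowSum p s c b (fun _ => 1) 0 0 y‖ ^ 2 + ε) ^ (p / 2) ∂(gaussMeasure n) := by
      intro x; simp only [e0 x]
    simp only [e2, e3] at h1
    rw [integral_const] at h1
    simp only [probReal_univ, one_smul] at h1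
    have aN : Adm fun t x y => (‖flowSum p s c b (fun _ => 1) t x y‖ ^ 2 + ε) := by
      simpa using (aφ 2 (by norm_num)).add (.const ε)
    have hNε : ∀ t x y, ε ≤ ‖flowSum p s c b (fun _ => 1) t x y‖ ^ 2 + ε := fun t x y => by
      linarith [sq_nonneg ‖flowSum p s c b (fun _ => 1) t x y‖]
    have hsq : ∀ z : ℂ, (‖z‖ ^ 2) ^ (p / 2) = ‖z‖ ^ p := fun z => by
      rw [← Real.rpow_natCast, ← Real.rpow_mul (norm_nonneg _)]; congr 1; push_cast; ring
    calc _ ≤ ∫ x, ((‖flowSum p s c b (fun _ => 1) (Real.pi / 2) x 0‖ ^ 2 + ε) ^ (p / 2)) ^ (q / p)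
          ∂(gaussMeasure n) := by
          refine integral_mono ?_ ?_ fun x => ?_
          · exact (aφ q hq0.le).admFst.integrable _
          · exact ((aN.rpow hε hNε (p / 2)).rpow (δ := ε ^ (p / 2)) (by positivity)
              (fun t x y => Real.rpow_le_rpow hε.le (hNε t x y) (by positivity))
              (q / p)).admFst.integrable _
          · have : ‖flowSum p s c b (fun _ => 1) (Real.pi / 2) x 0‖ ^ q =
                ((‖flowSum p s c b (fun _ => 1) (Real.pi / 2) x 0‖ ^ 2) ^ (p / 2)) ^ (q / p) := by
              rw [hsq, ← Real.rpow_mul (norm_nonneg _)]; congr 1; field_simp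
            simp only [this]
            gcongr
            simp [hε.le]
      _ ≤ _ := h1
      _ ≤ _ := by
        -- Subadditivity of t^{p/2}, valid since p ≤ 2, isolates the error ε^{p/2}, which vanishes
        -- in the limit.
        have hpow : ∀ y, (‖flowSum p s c b (fun _ => 1) 0 0 y‖ ^ 2 + ε) ^ (p / 2) ≤
            ‖flowSum p s c b (fun _ => 1) 0 0 y‖ ^ p + ε ^ (p / 2) := fun y => by
          rw [← hsq]
          exact Real.rpow_add_le_add_rpow (by positivity) hε.le (by positivity) (by linarith)
        have i1 := (aφ p hp0.le).integrable 0 0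
        have := integral_mono ((aN.rpow hε hNε (p / 2)).integrable 0 0)
          (i1.add (integrable_const (ε ^ (p / 2)))) hpow
        rw [integral_add' i1 (integrable_const _)] at this
        refine Real.rpow_le_rpow (integral_nonneg fun y => by positivity) ?_ (by positivity)
        simpa using this
  have hlim : Tendsto (fun ε : ℝ => (∫ y, ‖flowSum p s c b (fun _ => 1) 0 0 y‖ ^ p
      ∂(gaussMeasure n) + ε ^ (p / 2)) ^ (q / p)) (𝓝[>] 0)
      (𝓝 ((∫ y, ‖flowSum p s c b (fun _ => 1) 0 0 y‖ ^ p ∂(gaussMeasure n)) ^ (q / p))) := by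
    have h1 : Tendsto (fun ε : ℝ => ε ^ (p / 2)) (𝓝[>] 0) (𝓝 0) := by
      have := (Real.continuousAt_rpow_const 0 (p / 2) (Or.inr (by positivity))).tendsto
      rw [Real.zero_rpow (by positivity)] at this
      exact this.mono_left nhdsWithin_le_nhds
    have h2 := (h1.const_add (∫ y, ‖flowSum p s c b (fun _ => 1) 0 0 y‖ ^ p
      ∂(gaussMeasure n))).rpow_const (p := q / p) (Or.inr (by positivity))
    simpa using h2
  exact ge_of_tendsto hlim (eventually_mem_nhdsWithin.mono fun ε hε => key ε hε)

end Hypercontractivity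

/-! ### From Gauss space to Lebesgue measure: constants and the explicit transform -/

section HausdorffYoung

variable {n : ℕ} {p q : ℝ}

/-- The sharp constant in the Hausdorff–Young inequality on `ℝⁿ`. -/
noncomputable def babenkoConst (n : ℕ) (p q : ℝ) : ℝ :=
  (p ^ (1 / p) / q ^ (1 / q)) ^ ((n : ℝ) / 2)

/-- On the left: the constant of the Gaussian Fourier transform to the power q, the Jacobian of the
dilation by 2πp/√(p−1), and the normalisation of γ; the second factor on the right is the
normalisation on the side of f. All factors are exponentials in log 2π, log p and log(p−1), with log
q = log p − log(p−1), so the identity is linear in these logarithms. -/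
theorem babenkoConst_eq (hp1 : 1 < p) (hpq : 1 / p + 1 / q = 1) :
    (2 * Real.pi * p) ^ ((n : ℝ) / 2 * q) * (Real.sqrt (p - 1) / (2 * Real.pi * p)) ^ (n : ℝ)
        * (2 * Real.pi) ^ ((n : ℝ) / 2) =
      babenkoConst n p q ^ q * ((2 * Real.pi) ^ ((n : ℝ) / 2)) ^ (q / p) := by
  have hp0 : 0 < p := by linarith
  have hm : 0 < p - 1 := by linarith
  have hconj : p.HolderConjugate q := by
    rw [Real.holderConjugate_iff]; exact ⟨hp1, by simpa using hpq⟩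
  have hq0 : 0 < q := hconj.symm.pos
  have hqeq : q * (p - 1) = p := by
    have := hconj.mul_eq_add; linarith
  have h2pi : 0 < 2 * Real.pi := by positivity
  have hq : q / p = q - 1 := by field_simp; linear_combination -hqeq
  have hp' : 1 / p = 1 - 1 / q := by linarith
  have E : 2 * Real.pi = Real.exp (Real.log (2 * Real.pi)) := (Real.exp_log h2pi).symm
  have Ep : p = Real.exp (Real.log p) := (Real.exp_log hp0).symm
  have Em : Real.sqrt (p - 1) = Real.exp (Real.log (p - 1) / 2) := by
    rw [← Real.sqrt_eq_iff_mul_self_eq_of_pos (Real.exp_pos _) |>.2]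
    rw [← Real.exp_add, add_halves, Real.exp_log hm]
  have Eq : q = Real.exp (Real.log p - Real.log (p - 1)) := by
    rw [Real.exp_sub, Real.exp_log hp0, Real.exp_log hm]; field_simp; exact hqeq
  have h3 : p ^ (1 / p) = Real.exp (Real.log p * (1 / p)) := by
    rw [Real.exp_mul, Real.exp_log hp0]
  have h4 : q ^ (1 / q) = Real.exp ((Real.log p - Real.log (p - 1)) * (1 / q)) := by
    rw [Real.exp_mul, ← Eq]
  have h5 : 2 * Real.pi * p = Real.exp (Real.log (2 * Real.pi) + Real.log p) := by
    rw [Real.exp_add, Real.exp_log hp0, Real.exp_log h2pi]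
  unfold babenkoConst
  rw [h3, h4, h5, Em, hq, E, Real.log_exp]
  simp only [← Real.exp_sub, ← Real.exp_mul, ← Real.exp_add]
  congr 1
  rw [hp']
  field_simp
  ring

/-- A modulated Gaussian transforms into a translated one. Expanding |b/(2π) − ξ|² splits off a
Gaussian common to all frequencies and leaves the exponentials of the flow at θ = π/2, evaluated at
a multiple of ξ. -/
theorem norm_fourier_trig_mul_gauss {ι : Type*} [Fintype ι] (hp1 : 1 < p) (c : ι → ℂ)
    (b : ι → Eu n) (ξ : Eu n) :
    ‖𝓕 (fun y : Eu n => (∑ k, c k * Complex.exp (((inner ℝ (b k) y : ℝ) : ℂ) * Complex.I)) *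
      ((Real.exp (-(1 / (2 * p)) * ‖y‖ ^ 2) : ℝ) : ℂ)) ξ‖ =
    (2 * Real.pi * p) ^ ((n : ℝ) / 2) * Real.exp (-(2 * p * Real.pi ^ 2) * ‖ξ‖ ^ 2) *
      ‖∑ k, c k * Complex.exp ((-(Real.sqrt (p - 1) * inner ℝ (b k)
        ((-(2 * Real.pi * p / Real.sqrt (p - 1))) • ξ)) - p / 2 * ‖b k‖ ^ 2 : ℝ) : ℂ)‖ := by
  have hp0 : 0 < p := by linarith
  have hs : 0 < Real.sqrt (p - 1) := Real.sqrt_pos.2 (by linarith)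
  have hb : 0 < (((1 / (2 * p) : ℝ) : ℂ)).re := by
    rw [Complex.ofReal_re]; positivity
  have hpi := Real.pi_pos
  set g : ι → Eu n → ℂ := fun k v => Complex.exp (-((1 / (2 * p) : ℝ) : ℂ) * ‖v‖ ^ 2
      + 2 * Real.pi * Complex.I * ((inner ℝ ((1 / (2 * Real.pi)) • b k) v : ℝ) : ℂ)) with hg
  have hfun : (fun y : Eu n =>
      (∑ k, c k * Complex.exp (((inner ℝ (b k) y : ℝ) : ℂ) * Complex.I)) *
      ((Real.exp (-(1 / (2 * p)) * ‖y‖ ^ 2) : ℝ) : ℂ)) = fun y => ∑ k, c k * g k y := by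
    ext y
    rw [Finset.sum_mul]
    refine Finset.sum_congr rfl fun k _ => ?_
    rw [hg, mul_assoc, Complex.ofReal_exp, ← Complex.exp_add]
    congr 2
    rw [inner_smul_left]
    push_cast
    simp
    field_simp
    ring
  have hint : ∀ k, Integrable (g k) := fun k =>
    GaussianFourier.integrable_cexp_neg_mul_sq_norm_add hb _ _
  have hF : 𝓕 (fun y => ∑ k, c k * g k y) ξ = ∑ k, c k * 𝓕 (g k) ξ := by
    simp only [Real.fourier_eq, Finset.smul_sum]
    rw [integral_finsetSum]
    · refine Finset.sum_congr rfl fun k _ => ?_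
      rw [← integral_const_mul]
      congr 1; ext v
      simp only [Circle.smul_def, smul_eq_mul]; ring
    · intro k _
      exact (Real.fourierIntegral_convergent_iff ξ).2 ((hint k).const_mul (c k))
  rw [hfun, hF]
  have hk : ∀ k, 𝓕 (g k) ξ = ((Real.pi / (1 / (2 * p) : ℝ) : ℝ) : ℂ) ^ ((n : ℂ) / 2) *
      (((Real.exp (-(2 * p * Real.pi ^ 2) * ‖ξ‖ ^ 2) : ℝ) : ℂ) *
      Complex.exp ((-(Real.sqrt (p - 1) * inner ℝ (b k)
        ((-(2 * Real.pi * p / Real.sqrt (p - 1))) • ξ)) - p / 2 * ‖b k‖ ^ 2 : ℝ) : ℂ)) := by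
    intro k
    have := fourier_gaussian_innerProductSpace' hb ((1 / (2 * Real.pi)) • b k) ξ
    rw [hg]
    rw [this, finrank_euclideanSpace, Fintype.card_fin, Complex.ofReal_exp, ← Complex.exp_add]
    push_cast
    congr 2
    have e1 : ‖(1 / (2 * Real.pi)) • b k - ξ‖ ^ 2 = 1 / (2 * Real.pi) ^ 2 * ‖b k‖ ^ 2
        - 2 * (1 / (2 * Real.pi) * inner ℝ (b k) ξ) + ‖ξ‖ ^ 2 := by
      rw [norm_sub_sq_real, norm_smul, inner_smul_left, Real.norm_of_nonneg (by positivity)]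
      simp; ring
    have e2 : (((‖(1 / (2 * Real.pi)) • b k - ξ‖ : ℝ) : ℂ)) ^ 2 = ((1 / (2 * Real.pi) ^ 2 *
        ‖b k‖ ^ 2 - 2 * (1 / (2 * Real.pi) * inner ℝ (b k) ξ) + ‖ξ‖ ^ 2 : ℝ) : ℂ) := by
      rw [← e1]; push_cast; rfl
    rw [e2, inner_smul_right]
    push_cast
    have hsC : ((Real.sqrt (p - 1) : ℝ) : ℂ) ≠ 0 := by exact_mod_cast hs.ne'
    have hpC : (p : ℂ) ≠ 0 := by exact_mod_cast hp0.ne'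
    have hpiC : (Real.pi : ℂ) ≠ 0 := by exact_mod_cast hpi.ne'
    field_simp
    ring
  simp only [hk]
  have hsum : ∀ (A B : ℂ) (e : ι → ℂ), ∑ k, c k * (A * (B * e k)) = A * B * ∑ k, c k * e k := by
    intro A B e
    rw [Finset.mul_sum]; exact Finset.sum_congr rfl fun k _ => by ring
  rw [hsum, norm_mul, norm_mul, Complex.norm_real, Real.norm_of_nonneg (Real.exp_pos _).le,
    Complex.norm_cpow_eq_rpow_re_of_pos (by positivity)]
  congr 3
  · field_simp
  · simp

end HausdorffYoung

end Pitt

namespace Pitt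

open ComplexConjugate Filter Topology

/-! ### The sharp Hausdorff–Young inequality, by approximation -/

section HausdorffYoung

variable {n : ℕ} {p q : ℝ}

/-- `f` satisfies the sharp Hausdorff–Young inequality. -/
def SharpHY (p q : ℝ) (f : Eu n → ℂ) : Prop :=
  ∫⁻ ξ, ‖𝓕 f ξ‖ₑ ^ q ≤
    ENNReal.ofReal (babenkoConst n p q ^ q) * (∫⁻ x, ‖f x‖ₑ ^ p) ^ (q / p)

/-- The width of the Gaussian is chosen so that |f|^p is |φ|^p times the Gaussian density, up to a
constant. Because q (p − 1) = p, the dilation found on the Fourier side also turns |𝓕 f|^q into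
|M|^q times the Gaussian density. Hypercontractivity and a change of variables conclude. -/
theorem sharpHY_trig_mul_gauss {ι : Type*} [Fintype ι] (hp1 : 1 < p) (hp2 : p ≤ 2)
    (hpq : 1 / p + 1 / q = 1) (c : ι → ℂ) (b : ι → Eu n) :
    SharpHY p q fun y : Eu n =>
      (∑ k, c k * Complex.exp (((inner ℝ (b k) y : ℝ) : ℂ) * Complex.I)) *
      ((Real.exp (-(1 / (2 * p)) * ‖y‖ ^ 2) : ℝ) : ℂ) := by
  have hp0 : 0 < p := by linarith
  have hm : 0 < p - 1 := by linarith
  have hconj : p.HolderConjugate q := by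
    rw [Real.holderConjugate_iff]; exact ⟨hp1, by simpa using hpq⟩
  have hq0 : 0 < q := hconj.symm.pos
  have hqeq : q * (p - 1) = p := by
    have := hconj.mul_eq_add; linarith
  have hs : 0 < Real.sqrt (p - 1) := Real.sqrt_pos.2 hm
  have hpi := Real.pi_pos
  set φ : Eu n → ℂ := fun y => ∑ k, c k * Complex.exp (((inner ℝ (b k) y : ℝ) : ℂ) * Complex.I)
    with hφ
  set M : Eu n → ℂ := fun x => ∑ k, c k * Complex.exp ((-(Real.sqrt (p - 1) * inner ℝ (b k) x)
        - p / 2 * ‖b k‖ ^ 2 : ℝ) : ℂ) with hM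
  set a : ℝ := -(2 * Real.pi * p / Real.sqrt (p - 1)) with ha
  have ha0 : a ≠ 0 := by rw [ha]; exact neg_ne_zero.2 (by positivity)
  have hhyp : ∫ x, ‖M x‖ ^ q ∂(gaussMeasure n) ≤ (∫ y, ‖φ y‖ ^ p ∂(gaussMeasure n)) ^ (q / p) :=
    integral_exp_sum_rpow_le hp1 hp2 hpq c b
  have iφ : Integrable (fun y => ‖φ y‖ ^ p) (gaussMeasure n) := by
    have := (adm_norm_rpow_flowSum (p := p) (s := 0) hp0.le hp0.le c b).integrable 0 0
    simpa only [flowSum_zero] using this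
  have iM : Integrable (fun y => ‖M y‖ ^ q) (gaussMeasure n) := by
    have := (adm_norm_rpow_flowSum (p := p) (s := Real.sqrt (p - 1)) hp0.le hq0.le c
      b).admFst.integrable (Real.pi / 2)
    simpa only [flowSum_pi_div_two] using this
  rw [integral_gaussMeasure, integral_gaussMeasure] at hhyp
  rw [integrable_gaussMeasure_iff] at iφ iM
  set f : Eu n → ℂ := fun y => φ y * ((Real.exp (-(1 / (2 * p)) * ‖y‖ ^ 2) : ℝ) : ℂ) with hf
  have h2pi : ((2 * Real.pi) ^ (-(n : ℝ) / 2)) * ((2 * Real.pi) ^ ((n : ℝ) / 2)) = 1 := by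
    rw [← Real.rpow_add (by positivity), neg_div, neg_add_cancel, Real.rpow_zero]
  have efp : ∀ y, ‖f y‖ ^ p = (2 * Real.pi) ^ ((n : ℝ) / 2) * (gaussDensity y • ‖φ y‖ ^ p) := by
    intro y
    rw [hf]
    simp only
    rw [norm_mul, Complex.norm_real, Real.norm_of_nonneg (Real.exp_pos _).le,
      Real.mul_rpow (norm_nonneg _) (Real.exp_pos _).le, ← Real.exp_mul, gaussDensity, smul_eq_mul,
      show -(1 / (2 * p)) * ‖y‖ ^ 2 * p = -(1 / 2) * ‖y‖ ^ 2 by field_simp]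
    linear_combination (-(‖φ y‖ ^ p * Real.exp (-(1 / 2) * ‖y‖ ^ 2))) * h2pi
  have eFq : ∀ ξ, ‖𝓕 f ξ‖ ^ q = (2 * Real.pi * p) ^ ((n : ℝ) / 2 * q) *
      (2 * Real.pi) ^ ((n : ℝ) / 2) * (gaussDensity (a • ξ) • ‖M (a • ξ)‖ ^ q) := by
    intro ξ
    rw [show 𝓕 f ξ = 𝓕 (fun y : Eu n => (∑ k, c k *
      Complex.exp (((inner ℝ (b k) y : ℝ) : ℂ) * Complex.I)) *
      ((Real.exp (-(1 / (2 * p)) * ‖y‖ ^ 2) : ℝ) : ℂ)) ξ from rfl, norm_fourier_trig_mul_gauss hp1,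
      Real.mul_rpow (by positivity) (norm_nonneg _), Real.mul_rpow (by positivity)
      (Real.exp_pos _).le, ← Real.exp_mul, gaussDensity, smul_eq_mul,
      ← Real.rpow_mul (by positivity), norm_smul, Real.norm_eq_abs, mul_pow, sq_abs]
    have : -(2 * p * Real.pi ^ 2) * ‖ξ‖ ^ 2 * q = -(1 / 2) * (a ^ 2 * ‖ξ‖ ^ 2) := by
      rw [ha, neg_sq, div_pow, Real.sq_sqrt hm.le]
      field_simp
      linear_combination (-‖ξ‖ ^ 2) * hqeq
    rw [this]
    linear_combination (-((2 * Real.pi * p) ^ ((n : ℝ) / 2 * q) *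
      Real.exp (-(1 / 2) * (a ^ 2 * ‖ξ‖ ^ 2)) * ‖M (a • ξ)‖ ^ q)) * h2pi
  have iF : Integrable (fun ξ => ‖𝓕 f ξ‖ ^ q) := by
    simp only [eFq]
    exact (iM.comp_smul ha0).const_mul _
  have if' : Integrable (fun ξ => ‖f ξ‖ ^ p) := by
    simp only [efp]
    exact iφ.const_mul _
  have hreal : ∫ ξ, ‖𝓕 f ξ‖ ^ q ≤ babenkoConst n p q ^ q * (∫ x, ‖f x‖ ^ p) ^ (q / p) := by
    simp only [eFq, efp]
    have e1 : ∫ ξ, gaussDensity (a • ξ) • ‖M (a • ξ)‖ ^ q =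
        |(a ^ n)⁻¹| * ∫ x, gaussDensity x • ‖M x‖ ^ q := by
      have := Measure.integral_comp_smul volume (fun x : Eu n => gaussDensity x • ‖M x‖ ^ q) a
      rwa [finrank_euclideanSpace, Fintype.card_fin, smul_eq_mul] at this
    have e2 : 0 ≤ ∫ y, gaussDensity y • ‖φ y‖ ^ p := integral_nonneg fun y =>
      mul_nonneg (gaussDensity_nonneg _) (by positivity)
    rw [integral_const_mul, integral_const_mul, e1, Real.mul_rpow (by positivity) e2]
    have hab : |(a ^ n)⁻¹| = (Real.sqrt (p - 1) / (2 * Real.pi * p)) ^ (n : ℝ) := by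
      rw [Real.rpow_natCast, abs_inv, abs_pow, ha, abs_neg, abs_of_pos (by positivity),
        ← inv_pow, inv_div]
    have hB : 0 ≤ babenkoConst n p q ^ q * ((2 * Real.pi) ^ ((n : ℝ) / 2)) ^ (q / p) := by
      unfold babenkoConst
      positivity
    refine le_trans (le_of_eq ?_) ((mul_le_mul_of_nonneg_left hhyp hB).trans (le_of_eq ?_))
    · rw [hab, ← babenkoConst_eq hp1 hpq]; ring
    · ring
  unfold SharpHY
  have l1 : ∀ ξ, ‖𝓕 f ξ‖ₑ ^ q = ENNReal.ofReal (‖𝓕 f ξ‖ ^ q) := fun ξ => by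
    rw [← ENNReal.ofReal_rpow_of_nonneg (norm_nonneg _) hq0.le, ofReal_norm]
  have l2 : ∀ ξ, ‖f ξ‖ₑ ^ p = ENNReal.ofReal (‖f ξ‖ ^ p) := fun ξ => by
    rw [← ENNReal.ofReal_rpow_of_nonneg (norm_nonneg _) hp0.le, ofReal_norm]
  change ∫⁻ ξ, ‖𝓕 f ξ‖ₑ ^ q ≤
    ENNReal.ofReal (babenkoConst n p q ^ q) * (∫⁻ x, ‖f x‖ₑ ^ p) ^ (q / p)
  simp only [l1, l2]
  rw [← ofReal_integral_eq_lintegral_ofReal iF (.of_forall fun _ => by positivity),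
    ← ofReal_integral_eq_lintegral_ofReal if' (.of_forall fun _ => by positivity),
    ENNReal.ofReal_rpow_of_nonneg (integral_nonneg fun _ => by positivity) (by positivity),
    ← ENNReal.ofReal_mul (by unfold babenkoConst; positivity)]
  exact ENNReal.ofReal_le_ofReal hreal

/-- The sharp Hausdorff–Young inequality passes to dominated limits. -/
theorem SharpHY.of_tendsto (hp : 0 < p) {F : ℕ → Eu n → ℂ} {f : Eu n → ℂ}
    {g : Eu n → ℝ} (hF : ∀ m, SharpHY p q (F m)) (hm : ∀ m, AEStronglyMeasurable (F m))
    (hg : Integrable g) (hgp : ∫⁻ x, ENNReal.ofReal (g x) ^ p ≠ ⊤)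
    (hbound : ∀ m x, ‖F m x‖ ≤ g x) (hlim : ∀ x, Tendsto (fun m => F m x) atTop (𝓝 (f x))) :
    SharpHY p q f := by
  have hiF : ∀ m, Integrable (F m) := fun m => hg.mono' (hm m) (.of_forall (hbound m))
  have hFT : ∀ ξ, Tendsto (fun m => 𝓕 (F m) ξ) atTop (𝓝 (𝓕 f ξ)) := by
    intro ξ
    simp only [Real.fourier_eq]
    refine tendsto_integral_of_dominated_convergence g (fun m =>
      ((Real.fourierIntegral_convergent_iff ξ).2 (hiF m)).aestronglyMeasurable) hg
      (fun m => .of_forall fun x => by simpa using hbound m x) (.of_forall fun x => ?_)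
    exact (hlim x).const_smul _
  have hcont : ∀ m, Continuous (𝓕 (F m)) := fun m =>
    VectorFourier.fourierIntegral_continuous Real.continuous_fourierChar
      (by exact continuous_inner) (hiF m)
  have hlimp : Tendsto (fun m => ∫⁻ x, ‖F m x‖ₑ ^ p) atTop (𝓝 (∫⁻ x, ‖f x‖ₑ ^ p)) := by
    refine tendsto_lintegral_of_dominated_convergence' (fun x => ENNReal.ofReal (g x) ^ p)
      (fun m => (hm m).enorm.pow_const p) (fun m => .of_forall fun x => ?_) hgp
      (.of_forall fun x => ?_)
    · refine ENNReal.rpow_le_rpow ?_ hp.le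
      rw [← ofReal_norm]
      exact ENNReal.ofReal_le_ofReal (hbound m x)
    · exact ((ENNReal.continuous_rpow_const).tendsto _).comp ((hlim x).enorm)
  unfold SharpHY
  -- Domination in L¹ gives pointwise convergence of the transforms, enough for Fatou on the left;
  -- domination in L^p gives convergence of the right side.
  calc ∫⁻ ξ, ‖𝓕 f ξ‖ₑ ^ q = ∫⁻ ξ, liminf (fun m => ‖𝓕 (F m) ξ‖ₑ ^ q) atTop := by
        refine lintegral_congr fun ξ => ?_
        exact (Tendsto.liminf_eq (((ENNReal.continuous_rpow_const).tendsto _).comp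
          ((hFT ξ).enorm))).symm
    _ ≤ liminf (fun m => ∫⁻ ξ, ‖𝓕 (F m) ξ‖ₑ ^ q) atTop :=
        lintegral_liminf_le fun m => ((hcont m).enorm.measurable.pow_const q)
    _ ≤ liminf (fun m => ENNReal.ofReal (babenkoConst n p q ^ q) *
          (∫⁻ x, ‖F m x‖ₑ ^ p) ^ (q / p)) atTop :=
        liminf_le_liminf (.of_forall fun m => hF m)
    _ = _ := by
        refine Tendsto.liminf_eq (ENNReal.Tendsto.const_mul ?_ (Or.inr ENNReal.ofReal_ne_top))
        exact ((ENNReal.continuous_rpow_const).tendsto _).comp hlimp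

/-- The sharp Hausdorff–Young inequality for smooth compactly supported functions. -/
theorem sharpHY_of_hasCompactSupport (hp1 : 1 < p) (hp2 : p ≤ 2) (hpq : 1 / p + 1 / q = 1)
    {f : Eu n → ℂ} (hf : ContDiff ℝ (⊤ : ℕ∞) f) (hc : HasCompactSupport f) : SharpHY p q f := by
  have hp0 : 0 < p := by linarith
  have hconj : p.HolderConjugate q := by
    rw [Real.holderConjugate_iff]; exact ⟨hp1, by simpa using hpq⟩
  have hq0 : 0 < q := hconj.symm.pos
  -- Dividing f by the Gaussian of the previous case is harmless: compact support keeps the quotient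
  -- φ a Schwartz function.
  set w : Eu n → ℝ := fun y => Real.exp (1 / (2 * p) * ‖y‖ ^ 2) with hw
  have hφs : ContDiff ℝ (⊤ : ℕ∞) (fun y => f y * (w y : ℂ)) := by
    refine hf.mul (Complex.ofRealCLM.contDiff.comp ?_)
    exact Real.contDiff_exp.comp (contDiff_const.mul (contDiff_norm_sq ℝ))
  have hφc : HasCompactSupport (fun y => f y * (w y : ℂ)) := hc.mul_right
  set φ : 𝓢(Eu n, ℂ) := hφc.toSchwartzMap hφs with hφ
  have hφv : ∀ y, φ y = f y * (w y : ℂ) := fun y => rfl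
  set ψ : 𝓢(Eu n, ℂ) := 𝓕 φ with hψ
  have hinv : ∀ y, φ y = ∫ a, ψ a * Complex.exp (((2 * Real.pi * inner ℝ a y : ℝ) : ℂ) *
      Complex.I) := by
    intro y
    have : 𝓕⁻ ψ = φ := by rw [hψ]; simp
    rw [← this, SchwartzMap.fourierInv_coe, Real.fourierInv_eq']
    congr 1; ext a
    rw [smul_eq_mul, mul_comm]
  -- Rounding the frequency to S_m(a) in the inversion formula for φ leaves finitely many
  -- frequencies, hence a trigonometric polynomial Φ_m. These converge pointwise to φ and are
  -- bounded uniformly by ∫ |ψ|, so the Gaussian factor supplies the dominating function.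
  set S : ℕ → SimpleFunc (Eu n) (Eu n) := fun m =>
    (stronglyMeasurable_id (α := Eu n)).approx m with hS
  have hSlim : ∀ a, Tendsto (fun m => S m a) atTop (𝓝 a) := fun a =>
    (stronglyMeasurable_id (α := Eu n)).tendsto_approx a
  have hψi : Integrable ψ := ψ.integrable
  set Φ : ℕ → Eu n → ℂ := fun m y => ∫ a, ψ a * Complex.exp (((2 * Real.pi * inner ℝ (S m a) y :
    ℝ) : ℂ) * Complex.I) with hΦ
  have hnorm : ∀ (t : ℝ) (z : ℂ), ‖z * Complex.exp ((t : ℂ) * Complex.I)‖ = ‖z‖ := fun t z => by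
    rw [norm_mul, Complex.norm_exp_ofReal_mul_I, mul_one]
  have hΦsum : ∀ m y, Φ m y = ∑ v : (S m).range, (∫ a in (S m) ⁻¹' {v.1}, ψ a) *
      Complex.exp (((inner ℝ ((2 * Real.pi) • v.1) y : ℝ) : ℂ) * Complex.I) := by
    intro m y
    have hpart : ∀ a, ψ a * Complex.exp (((2 * Real.pi * inner ℝ (S m a) y : ℝ) : ℂ) * Complex.I)
        = ∑ v ∈ (S m).range, ((S m) ⁻¹' {v}).indicator ψ a *
          Complex.exp (((inner ℝ ((2 * Real.pi) • v) y : ℝ) : ℂ) * Complex.I) := by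
      intro a
      rw [Finset.sum_eq_single (S m a)]
      · rw [Set.indicator_of_mem (by simp), inner_smul_left]; simp
      · intro v _ hv
        rw [Set.indicator_of_notMem (by simpa using hv.symm), zero_mul]
      · intro h; exact absurd (SimpleFunc.mem_range_self _ _) h
    simp only [hΦ, hpart]
    rw [integral_finsetSum, ← Finset.sum_coe_sort]
    · refine Finset.sum_congr rfl fun v _ => ?_
      rw [integral_mul_const, integral_indicator ((S m).measurableSet_fiber _)]
    · intro v _
      exact (hψi.indicator ((S m).measurableSet_fiber _)).mul_const _
  have hΦlim : ∀ y, Tendsto (fun m => Φ m y) atTop (𝓝 (φ y)) := by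
    intro y
    rw [hinv]
    refine tendsto_integral_of_dominated_convergence (fun a => ‖ψ a‖) (fun m => ?_) hψi.norm
      (fun m => .of_forall fun a => (hnorm _ _).le) (.of_forall fun a => ?_)
    · refine hψi.aestronglyMeasurable.mul ?_
      have : Continuous fun v : Eu n => Complex.exp (((2 * Real.pi * inner ℝ v y : ℝ) : ℂ) *
        Complex.I) := by fun_prop
      exact (this.comp_stronglyMeasurable (S m).stronglyMeasurable).aestronglyMeasurable
    · have : Continuous fun v : Eu n => ψ a * Complex.exp (((2 * Real.pi * inner ℝ v y : ℝ) : ℂ) *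
        Complex.I) := by fun_prop
      exact (this.tendsto a).comp (hSlim a)
  have hΦb : ∀ m y, ‖Φ m y‖ ≤ ∫ a, ‖ψ a‖ := fun m y =>
    (norm_integral_le_integral_norm _).trans_eq (by simp only [hnorm])
  set G : Eu n → ℝ := fun y => Real.exp (-(1 / (2 * p)) * ‖y‖ ^ 2) with hG
  have hwG : ∀ y, w y * G y = 1 := fun y => by
    rw [← Real.exp_add, ← add_mul, add_neg_cancel, zero_mul, Real.exp_zero]
  have hGi : ∀ r : ℝ, 0 < r → Integrable fun y => G y ^ r := fun r hr => by
    simp only [hG, ← Real.exp_mul]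
    have := integrable_exp_neg_mul_sq_norm (n := n) (b := 1 / (2 * p) * r) (by positivity)
    refine this.congr (.of_forall fun y => ?_)
    simp only
    congr 1
    ring
  set L : ℝ := ∫ a, ‖ψ a‖ with hL
  have hL0 : 0 ≤ L := integral_nonneg fun _ => norm_nonneg _
  refine SharpHY.of_tendsto hp0 (F := fun m y => Φ m y * (G y : ℂ)) (g := fun y => L * G y)
    (fun m => ?_) (fun m => ?_) ?_ ?_ (fun m y => ?_) fun y => ?_
  · simp only [hΦsum]
    exact sharpHY_trig_mul_gauss hp1 hp2 hpq _ _
  · simp only [hΦsum, hG]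
    refine Continuous.aestronglyMeasurable ?_
    fun_prop
  · have := (hGi 1 one_pos).const_mul L
    simpa using this
  · have h1 : ∀ y, ENNReal.ofReal (L * G y) ^ p = ENNReal.ofReal (L ^ p * G y ^ p) := fun y => by
      rw [ENNReal.ofReal_rpow_of_nonneg (mul_nonneg hL0 (Real.exp_pos _).le) hp0.le,
        Real.mul_rpow hL0 (Real.exp_pos _).le]
    simp only [h1]
    exact ((hGi p hp0).const_mul (L ^ p)).lintegral_lt_top.ne
  · rw [norm_mul, Complex.norm_real, Real.norm_of_nonneg (Real.exp_pos _).le]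
    exact mul_le_mul_of_nonneg_right (hΦb m y) (Real.exp_pos _).le
  · have h1 := (hΦlim y).mul_const (G y : ℂ)
    rwa [hφv, mul_assoc, ← Complex.ofReal_mul, hwG, Complex.ofReal_one, mul_one] at h1

/-- The sharp Hausdorff–Young (Babenko–Beckner) inequality for smooth functions in `L¹ ∩ Lᵖ`. -/
theorem sharpHY_of_contDiff (hp1 : 1 < p) (hp2 : p ≤ 2) (hpq : 1 / p + 1 / q = 1)
    {f : Eu n → ℂ} (hf : ContDiff ℝ (⊤ : ℕ∞) f) (hf1 : Integrable f)
    (hfp : ∫⁻ x, ‖f x‖ₑ ^ p ≠ ⊤) : SharpHY p q f := by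
  have hp0 : 0 < p := by linarith
  have hconj : p.HolderConjugate q := by
    rw [Real.holderConjugate_iff]; exact ⟨hp1, by simpa using hpq⟩
  -- Smooth cut-offs equal to 1 on the ball of radius m + 1; each point is eventually inside, and
  -- |f| dominates.
  let χ : ℕ → ContDiffBump (0 : Eu n) := fun m => ⟨m + 1, m + 2, by positivity, by linarith⟩
  refine SharpHY.of_tendsto hp0 (F := fun m x => ((χ m x : ℝ) : ℂ) * f x)
    (g := fun x => ‖f x‖) (fun m => ?_) (fun m => ?_) hf1.norm ?_ (fun m x => ?_) fun x => ?_
  · refine sharpHY_of_hasCompactSupport hp1 hp2 hpq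
      ((Complex.ofRealCLM.contDiff.comp (χ m).contDiff).mul hf) ?_
    refine HasCompactSupport.mul_right ?_
    exact (χ m).hasCompactSupport.comp_left Complex.ofReal_zero
  · refine AEStronglyMeasurable.mul ?_ hf1.aestronglyMeasurable
    exact (Complex.continuous_ofReal.comp (χ m).continuous).aestronglyMeasurable
  · simpa only [ofReal_norm] using hfp
  · rw [norm_mul, Complex.norm_real, Real.norm_of_nonneg (χ m).nonneg]
    exact mul_le_of_le_one_left (norm_nonneg _) (χ m).le_one
  · refine tendsto_const_nhds.congr' ?_
    obtain ⟨N, hN⟩ := exists_nat_ge ‖x‖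
    filter_upwards [eventually_ge_atTop N] with m hm
    have : χ m x = 1 := (χ m).one_of_mem_closedBall (by
      rw [mem_closedBall_zero_iff]
      have : (N : ℝ) ≤ m := by exact_mod_cast hm
      change ‖x‖ ≤ (m : ℝ) + 1
      linarith)
    rw [this]; simp

end HausdorffYoung

end Pitt

namespace Pitt

open Filter Topology
open scoped ENNReal

/-! ### Minkowski's integral inequality -/

section Minkowski

/-- Minkowski's integral inequality, when the left side is finite. -/
theorem lintegral_lintegral_rpow_le {α β : Type*} [MeasurableSpace α] [MeasurableSpace β]
    {μ : Measure α} {ν : Measure β} [SFinite μ] [SFinite ν] {r : ℝ} (hr : 1 ≤ r)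
    {G : α → β → ℝ≥0∞} (hG : Measurable (Function.uncurry G))
    (hfin : ∫⁻ a, (∫⁻ b, G a b ∂ν) ^ r ∂μ ≠ ⊤) :
    (∫⁻ a, (∫⁻ b, G a b ∂ν) ^ r ∂μ) ^ (1 / r) ≤ ∫⁻ b, (∫⁻ a, G a b ^ r ∂μ) ^ (1 / r) ∂ν := by
  rcases hr.eq_or_lt with rfl | hr1
  · simp only [ENNReal.rpow_one, div_one]
    exact (lintegral_lintegral_swap hG.aemeasurable).le
  have hr0 : 0 < r := by linarith
  set S : α → ℝ≥0∞ := fun a => ∫⁻ b, G a b ∂ν with hS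
  have hSm : Measurable S := hG.lintegral_prod_right'
  set T := ∫⁻ a, S a ^ r ∂μ with hT
  rcases eq_or_ne T 0 with h0 | h0
  · rw [h0, ENNReal.zero_rpow_of_pos (by positivity)]; exact zero_le
  have hconj : r.HolderConjugate (r / (r - 1)) := Real.HolderConjugate.conjExponent hr1
  have hG1 : ∀ b, Measurable fun a => G a b := fun b => hG.comp (measurable_id.prodMk measurable_const)
  -- S^r = S · S^{r−1}, Tonelli, and Hölder in a with exponents r and r/(r−1). The factor T^{1−1/r}
  -- is then divided out, which is where the finiteness of T is needed.
  have hle : T ≤ (∫⁻ b, (∫⁻ a, G a b ^ r ∂μ) ^ (1 / r) ∂ν) * T ^ (1 - 1 / r) := by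
    calc T = ∫⁻ a, ∫⁻ b, G a b * S a ^ (r - 1) ∂ν ∂μ := by
          refine lintegral_congr fun a => ?_
          have hm : Measurable fun b => G a b := hG.comp (measurable_const.prodMk measurable_id)
          rw [lintegral_mul_const _ hm]
          change S a ^ r = S a * S a ^ (r - 1)
          conv_lhs => rw [← add_sub_cancel 1 r]
          rw [ENNReal.rpow_add_of_nonneg _ _ zero_le_one (by linarith), ENNReal.rpow_one]
      _ = ∫⁻ b, ∫⁻ a, G a b * S a ^ (r - 1) ∂μ ∂ν := by
          refine lintegral_lintegral_swap (Measurable.aemeasurable ?_)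
          exact hG.mul ((hSm.comp measurable_fst).pow_const _)
      _ ≤ ∫⁻ b, (∫⁻ a, G a b ^ r ∂μ) ^ (1 / r) * T ^ (1 - 1 / r) ∂ν := by
          refine lintegral_mono fun b => ?_
          refine (ENNReal.lintegral_mul_le_Lp_mul_Lq μ hconj (hG1 b).aemeasurable
            (hSm.pow_const (r - 1)).aemeasurable).trans_eq ?_
          congr 1
          have e1 : ∀ a, (S a ^ (r - 1)) ^ (r / (r - 1)) = S a ^ r := fun a => by
            rw [← ENNReal.rpow_mul]; congr 1
            have : r - 1 ≠ 0 := by linarith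
            field_simp
          simp only [e1]
          congr 1
          have : r - 1 ≠ 0 := by linarith
          field_simp
      _ = _ := by
          rw [lintegral_mul_const]
          exact Measurable.pow_const (Measurable.lintegral_prod_right'
            (f := fun z : β × α => G z.2 z.1 ^ r)
            ((hG.comp measurable_swap).pow_const r)) _
  have hTpos : T ^ (1 - 1 / r) ≠ 0 := by
    rw [Ne, ENNReal.rpow_eq_zero_iff]; push Not
    exact ⟨fun h => absurd h h0, fun h => absurd h hfin⟩
  have hTtop : T ^ (1 - 1 / r) ≠ ⊤ := ENNReal.rpow_ne_top_of_nonneg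
    (by rw [sub_nonneg, div_le_one hr0]; exact hr) hfin
  refine (ENNReal.mul_le_mul_iff_left hTpos hTtop).1 ?_
  refine le_trans (le_of_eq ?_) hle
  rw [← ENNReal.rpow_add _ _ h0 hfin]; simp

end Minkowski

/-! ### Kernels homogeneous under dilations and isometries -/

section Homogeneous

variable {n : ℕ}

/-- The reflection in the hyperplane orthogonal to x − y; it serves in every dimension, including n
= 1. -/
theorem exists_linearIsometryEquiv_apply_eq {x y : Eu n} (h : ‖x‖ = ‖y‖) :
    ∃ T : Eu n ≃ₗᵢ[ℝ] Eu n, T x = y := ⟨_, Submodule.reflection_sub h⟩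

theorem exists_smul_isometry_eq {η x : Eu n} (hη : ‖η‖ = 1) :
    ∃ T : Eu n ≃ₗᵢ[ℝ] Eu n, ‖x‖ • T η = x := by
  have h : ‖‖x‖ • η‖ = ‖x‖ := by rw [norm_smul, norm_norm, hη, mul_one]
  obtain ⟨T, hT⟩ := exists_linearIsometryEquiv_apply_eq h
  exact ⟨T, by rw [← map_smul]; exact hT⟩

theorem lintegral_eq_smul_isometry (F : Eu n → ℝ≥0∞) {c : ℝ} (hc : 0 < c)
    (T : Eu n ≃ₗᵢ[ℝ] Eu n) :
    ∫⁻ x, F x = ENNReal.ofReal (c ^ (n : ℝ)) * ∫⁻ x, F (c • T x) := by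
  have h1 : ∫⁻ x, F (c • T x) = ∫⁻ x, F (c • x) :=
    T.measurePreserving.lintegral_comp_emb T.toHomeomorph.measurableEmbedding fun x => F (c • x)
  have h2 : ∫⁻ x, F (c • x) = ENNReal.ofReal |(c ^ n)⁻¹| * ∫⁻ x, F x := by
    have he : MeasurableEmbedding fun x : Eu n => c • x :=
      (Homeomorph.smulOfNeZero c hc.ne').measurableEmbedding
    rw [← he.lintegral_map, Measure.map_addHaar_smul _ hc.ne', lintegral_smul_measure,
      finrank_euclideanSpace, Fintype.card_fin, smul_eq_mul]
  rw [h1, h2, ← mul_assoc, ← ENNReal.ofReal_mul (by positivity), Real.rpow_natCast,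
    abs_of_pos (by positivity), mul_inv_cancel₀ (by positivity)]
  simp

/-- `Q` is homogeneous of degree `-d` under simultaneous dilations, and invariant under
simultaneous isometries. -/
def HomogInv (d : ℝ) (Q : Eu n → Eu n → ℝ≥0∞) : Prop :=
  ∀ c : ℝ, 0 < c → ∀ T : Eu n ≃ₗᵢ[ℝ] Eu n, ∀ x y,
    Q (c • T x) (c • T y) = ENNReal.ofReal (c ^ (-d)) * Q x y

theorem HomogInv.swap {d : ℝ} {Q : Eu n → Eu n → ℝ≥0∞} (hQ : HomogInv d Q) :
    HomogInv d fun x y => Q y x := fun c hc T x y => hQ c hc T y x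

theorem HomogInv.lintegral_right {d : ℝ} {Q : Eu n → Eu n → ℝ≥0∞} (hQ : HomogInv d Q)
    {η x : Eu n} (hη : ‖η‖ = 1) (hx : x ≠ 0) :
    ∫⁻ y, Q x y = ENNReal.ofReal (‖x‖ ^ (n - d)) * ∫⁻ z, Q η z := by
  obtain ⟨T, hT⟩ := exists_smul_isometry_eq (x := x) hη
  have hc : 0 < ‖x‖ := norm_pos_iff.2 hx
  rw [lintegral_eq_smul_isometry _ hc T]
  have : ∀ y, Q x (‖x‖ • T y) = ENNReal.ofReal (‖x‖ ^ (-d)) * Q η y := fun y => by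
    have h := hQ _ hc T η y
    rwa [hT] at h
  simp only [this]
  rw [lintegral_const_mul' _ _ ENNReal.ofReal_ne_top, ← mul_assoc,
    ← ENNReal.ofReal_mul (by positivity), ← Real.rpow_add hc, sub_eq_add_neg]

/-- A mass-transport argument replacing polar coordinates: |x|^n W(x) Q(x, y), with W a Gaussian, is
integrated in both orders. Integrating in y first gives ω ∫ Q(η, z) dz directly. Integrating in x
first, the substitution x = |y| T z moves the dependence on y into W(|z| y), whose integral in y is
|z|^{−n} ω. The total mass ω then cancels. -/
theorem HomogInv.lintegral_swap_of_degree {Q : Eu n → Eu n → ℝ≥0∞} (hQ : HomogInv (2 * n) Q)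
    (hQm : Measurable (Function.uncurry Q)) [Nontrivial (Eu n)] {η : Eu n} (hη : ‖η‖ = 1) :
    ∫⁻ z, Q z η = ∫⁻ z, Q η z := by
  have h0 : ∀ᵐ x : Eu n, x ≠ 0 := Measure.ae_ne volume 0
  set W : Eu n → ℝ≥0∞ := fun x => ENNReal.ofReal (Real.exp (-1 * ‖x‖ ^ 2)) with hW
  have hWm : Measurable W := by
    refine ENNReal.measurable_ofReal.comp (Continuous.measurable ?_); fun_prop
  set ω := ∫⁻ x, W x with hω
  have hωtop : ω ≠ ⊤ := (integrable_exp_neg_mul_sq_norm one_pos).lintegral_lt_top.ne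
  have hω0 : ω ≠ 0 := by
    rw [hω, Ne, lintegral_eq_zero_iff hWm]
    intro h
    have := h.mono (p := fun x => W x = 0) (q := fun _ => False) fun x hx => by
      have h2 := Real.exp_pos (-1 * ‖x‖ ^ 2)
      exact absurd (ENNReal.ofReal_eq_zero.1 hx) (not_le.2 h2)
    simp only [eventually_false_iff_eq_bot, ae_eq_bot] at this
    exact NeZero.ne _ this
  have e1 : ∫⁻ x, ∫⁻ y, ENNReal.ofReal (‖x‖ ^ (n : ℝ)) * W x * Q x y = ω * ∫⁻ z, Q η z := by
    rw [hω, ← lintegral_mul_const _ hWm]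
    refine lintegral_congr_ae (h0.mono fun x hx => ?_)
    simp only
    rw [lintegral_const_mul' _ _ (by finiteness), hQ.lintegral_right hη hx]
    have h1 : ENNReal.ofReal (‖x‖ ^ (n : ℝ)) * ENNReal.ofReal (‖x‖ ^ ((n : ℝ) - 2 * n)) = 1 := by
      rw [← ENNReal.ofReal_mul (by positivity), ← Real.rpow_add (norm_pos_iff.2 hx)]
      ring_nf; simp
    calc _ = (ENNReal.ofReal (‖x‖ ^ (n : ℝ)) * ENNReal.ofReal (‖x‖ ^ ((n : ℝ) - 2 * n))) *
          (W x * ∫⁻ z, Q η z) := by ring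
      _ = _ := by rw [h1, one_mul]
  have e2 : ∫⁻ x, ∫⁻ y, ENNReal.ofReal (‖x‖ ^ (n : ℝ)) * W x * Q x y = ω * ∫⁻ z, Q z η := by
    rw [lintegral_lintegral_swap (Measurable.aemeasurable (by
      refine ((Measurable.mul ?_ ?_)).mul hQm
      · fun_prop
      · exact hWm.comp measurable_fst))]
    have e3 : ∀ y : Eu n, y ≠ 0 → ∫⁻ x, ENNReal.ofReal (‖x‖ ^ (n : ℝ)) * W x * Q x y =
        ∫⁻ z, ENNReal.ofReal (‖z‖ ^ (n : ℝ)) * W (‖z‖ • y) * Q z η := by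
      intro y hy
      obtain ⟨T, hT⟩ := exists_smul_isometry_eq (x := y) hη
      have hc : 0 < ‖y‖ := norm_pos_iff.2 hy
      rw [lintegral_eq_smul_isometry _ hc T, ← lintegral_const_mul' _ _ ENNReal.ofReal_ne_top]
      refine lintegral_congr fun z => ?_
      have : Q (‖y‖ • T z) y = ENNReal.ofReal (‖y‖ ^ (-(2 * n : ℝ))) * Q z η := by
        have h := hQ _ hc T z η
        rwa [hT] at h
      have hWe : W (‖y‖ • T z) = W (‖z‖ • y) := by
        simp only [hW, norm_smul, LinearIsometryEquiv.norm_map, norm_norm, mul_comm]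
      rw [this, hWe, norm_smul, LinearIsometryEquiv.norm_map, norm_norm,
        Real.mul_rpow hc.le (norm_nonneg z), ENNReal.ofReal_mul (by positivity)]
      have h1 : ENNReal.ofReal (‖y‖ ^ (n : ℝ)) * (ENNReal.ofReal (‖y‖ ^ (n : ℝ)) *
          ENNReal.ofReal (‖y‖ ^ (-(2 * n : ℝ)))) = 1 := by
        rw [← ENNReal.ofReal_mul (by positivity), ← ENNReal.ofReal_mul (by positivity),
          ← Real.rpow_add hc, ← Real.rpow_add hc]
        ring_nf; simp
      calc _ = (ENNReal.ofReal (‖y‖ ^ (n : ℝ)) * (ENNReal.ofReal (‖y‖ ^ (n : ℝ)) *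
          ENNReal.ofReal (‖y‖ ^ (-(2 * n : ℝ))))) *
          (ENNReal.ofReal (‖z‖ ^ (n : ℝ)) * W (‖z‖ • y) * Q z η) := by ring
        _ = _ := by rw [h1, one_mul]
    rw [lintegral_congr_ae (h0.mono e3), lintegral_lintegral_swap (Measurable.aemeasurable (by
      refine ((Measurable.mul ?_ ?_)).mul (hQm.comp (by fun_prop :
        Measurable fun z : Eu n × Eu n => (z.2, η)))
      · fun_prop
      · exact hWm.comp (by fun_prop)))]
    rw [← lintegral_const_mul' _ _ hωtop]
    refine lintegral_congr_ae (h0.mono fun z hz => ?_)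
    have hc : 0 < ‖z‖ := norm_pos_iff.2 hz
    simp only
    have hm : Measurable fun x : Eu n => ENNReal.ofReal (‖z‖ ^ (n : ℝ)) * W (‖z‖ • x) :=
      (hWm.comp (measurable_const_smul _)).const_mul _
    rw [lintegral_mul_const _ hm,
      lintegral_const_mul' _ _ ENNReal.ofReal_ne_top, hω,
      lintegral_eq_smul_isometry W hc (LinearIsometryEquiv.refl ℝ _)]
    rfl
  exact (ENNReal.mul_right_inj hω0 hωtop).1 (e2.symm.trans e1)

/-- The factor |y|^{d−2n} corrects the degree to −2n and equals 1 at y = η. -/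
theorem HomogInv.lintegral_swap {d : ℝ} {Q : Eu n → Eu n → ℝ≥0∞} (hQ : HomogInv d Q)
    (hQm : Measurable (Function.uncurry Q)) [Nontrivial (Eu n)] {η : Eu n} (hη : ‖η‖ = 1) :
    ∫⁻ z, Q z η = ∫⁻ z, ENNReal.ofReal (‖z‖ ^ (d - 2 * n)) * Q η z := by
  have hm : Measurable fun z : Eu n × Eu n => ENNReal.ofReal (‖z.2‖ ^ (d - 2 * n)) := by fun_prop
  have h : HomogInv (2 * n) fun x y : Eu n => ENNReal.ofReal (‖y‖ ^ (d - 2 * n)) * Q x y := by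
    intro c hc T x y
    simp only
    rw [hQ c hc T x y, norm_smul, LinearIsometryEquiv.norm_map, Real.norm_of_nonneg hc.le,
      Real.mul_rpow hc.le (norm_nonneg _), ENNReal.ofReal_mul (by positivity),
      show (-(2 * n) : ℝ) = (d - 2 * n) + (-d) by ring, Real.rpow_add hc,
      ENNReal.ofReal_mul (by positivity)]
    ring
  have := h.lintegral_swap_of_degree (hm.mul hQm) hη
  simpa [hη] using this

end Homogeneous

/-! ### Integrability of radial powers -/

section RadialIntegrability

variable {n : ℕ}

/-- The model singularity for the kernels below, with κ = n + qβ: decay at infinity needs κ > n,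
that is β > 0; at the origin the factor |w|^q compensates as long as κ < n + q, that is β < 1. -/
theorem integrable_min_rpow_mul_rpow [Nontrivial (Eu n)] {q κ : ℝ} (h1 : (n : ℝ) < κ)
    (h2 : κ < n + q) : Integrable fun w : Eu n => min 1 ‖w‖ ^ q * ‖w‖ ^ (-κ) := by
  have hn : 0 < n := by
    have h := Module.finrank_pos (R := ℝ) (M := Eu n)
    rwa [finrank_euclideanSpace_fin] at h
  rw [integrable_fun_norm_addHaar (μ := (volume : Measure (Eu n)))
    (f := fun t : ℝ => min 1 t ^ q * t ^ (-κ)), finrank_euclideanSpace, Fintype.card_fin,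
    ← Set.Ioc_union_Ioi_eq_Ioi zero_le_one]
  have hcast : ((n - 1 : ℕ) : ℝ) = n - 1 := by
    rw [Nat.cast_sub hn, Nat.cast_one]
  refine IntegrableOn.union ?_ ?_
  · have : IntegrableOn (fun t : ℝ => t ^ ((n : ℝ) - 1 + q - κ)) (Set.Ioc 0 1) :=
      (intervalIntegrable_iff_integrableOn_Ioc_of_le zero_le_one).1
        (intervalIntegral.intervalIntegrable_rpow' (by linarith))
    refine this.congr_fun (fun t ht => ?_) measurableSet_Ioc
    have ht0 : 0 < t := ht.1
    simp only [smul_eq_mul]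
    rw [min_eq_right ht.2, ← Real.rpow_natCast, hcast, ← Real.rpow_add ht0, ← Real.rpow_add ht0]
    congr 1; ring
  · have : IntegrableOn (fun t : ℝ => t ^ ((n : ℝ) - 1 - κ)) (Set.Ioi 1) :=
      integrableOn_Ioi_rpow_of_lt (by linarith) one_pos
    refine this.congr_fun (fun t ht => ?_) measurableSet_Ioi
    have ht0 : 0 < t := one_pos.trans ht
    simp only [smul_eq_mul]
    rw [min_eq_left (le_of_lt ht), Real.one_rpow, one_mul, ← Real.rpow_natCast, hcast,
      ← Real.rpow_add ht0]
    congr 1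

theorem integrableOn_ball_norm_rpow [Nontrivial (Eu n)] {a : ℝ} (h : a < n) (R : ℝ) :
    IntegrableOn (fun w : Eu n => ‖w‖ ^ (-a)) (Metric.ball 0 R) := by
  have hn : 0 < n := by
    have h := Module.finrank_pos (R := ℝ) (M := Eu n)
    rwa [finrank_euclideanSpace_fin] at h
  rw [integrableOn_fun_norm_addHaar (μ := (volume : Measure (Eu n)))
    (f := fun t : ℝ => t ^ (-a)), finrank_euclideanSpace, Fintype.card_fin]
  have hcast : ((n - 1 : ℕ) : ℝ) = n - 1 := by
    rw [Nat.cast_sub hn, Nat.cast_one]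
  rcases le_or_gt R 0 with hR | hR
  · rw [Set.Ioo_eq_empty (not_lt.2 hR)]; exact integrableOn_empty
  have : IntegrableOn (fun t : ℝ => t ^ ((n : ℝ) - 1 - a)) (Set.Ioo 0 R) :=
    ((intervalIntegrable_iff_integrableOn_Ioc_of_le hR.le).1
      (intervalIntegral.intervalIntegrable_rpow' (by linarith))).mono_set Set.Ioo_subset_Ioc_self
  refine this.congr_fun (fun t ht => ?_) measurableSet_Ioo
  have ht0 : 0 < t := ht.1
  simp only [smul_eq_mul]
  rw [← Real.rpow_natCast, hcast, ← Real.rpow_add ht0]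
  congr 1

end RadialIntegrability

end Pitt

namespace Pitt

open Filter Topology
open scoped ENNReal

/-! ### Kernels depending on |y|/|x| and |x − y| -/

section RadialKernel

variable {n : ℕ} {κ : ℝ} {g : ℝ → ℝ}

/-- The kernel `g (|y| / |x|) |x - y|^{-κ}`. -/
noncomputable def radialKernel (κ : ℝ) (g : ℝ → ℝ) (x y : Eu n) : ℝ≥0∞ :=
  ENNReal.ofReal (g (‖y‖ / ‖x‖)) * ENNReal.ofReal (‖x - y‖ ^ (-κ))

theorem homogInv_radialKernel : HomogInv κ (radialKernel (n := n) κ g) := by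
  intro c hc T x y
  have h1 : c * ‖y‖ / (c * ‖x‖) = ‖y‖ / ‖x‖ := mul_div_mul_left _ _ hc.ne'
  rw [radialKernel, radialKernel, ← smul_sub, ← map_sub]
  simp only [norm_smul, LinearIsometryEquiv.norm_map, Real.norm_of_nonneg hc.le]
  rw [h1, Real.mul_rpow hc.le (norm_nonneg _), ENNReal.ofReal_mul (by positivity)]
  ring

theorem measurable_radialKernel (hg : Measurable g) :
    Measurable (Function.uncurry (radialKernel (n := n) κ g)) := by
  have h1 : Measurable fun z : Eu n × Eu n => ENNReal.ofReal (g (‖z.2‖ / ‖z.1‖)) :=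
    ENNReal.measurable_ofReal.comp (hg.comp (by fun_prop))
  have h2 : Measurable fun z : Eu n × Eu n => ENNReal.ofReal (‖z.1 - z.2‖ ^ (-κ)) := by fun_prop
  exact h1.mul h2

/-- The integral `∫ g(|z|) |η - z|^{-κ} dz`. -/
noncomputable def radialIntegral (κ : ℝ) (g : ℝ → ℝ) (η : Eu n) : ℝ≥0∞ :=
  ∫⁻ z, ENNReal.ofReal (g ‖z‖) * ENNReal.ofReal (‖η - z‖ ^ (-κ))

variable {η : Eu n}

theorem lintegral_radialKernel_right (hη : ‖η‖ = 1) {x : Eu n} (hx : x ≠ 0) :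
    ∫⁻ y, radialKernel κ g x y = ENNReal.ofReal (‖x‖ ^ (n - κ)) * radialIntegral κ g η := by
  rw [homogInv_radialKernel.lintegral_right hη hx]
  simp [radialKernel, radialIntegral, hη]

/-- This is the change of variables z ↦ z/|z|², obtained from the swap of the two arguments of a
homogeneous kernel, without computing a Jacobian. -/
theorem radialIntegral_inv [Nontrivial (Eu n)] (hη : ‖η‖ = 1) (hg : Measurable g) :
    radialIntegral κ (fun t => g t⁻¹) η = radialIntegral κ (fun t => t ^ (κ - 2 * n) * g t) η := by
  have := (homogInv_radialKernel (n := n) (κ := κ) (g := g)).lintegral_swap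
    (measurable_radialKernel hg) hη
  simp only [radialKernel, hη, div_one, one_div] at this
  simp only [radialIntegral, norm_sub_rev η]
  simp only [norm_sub_rev η] at this
  rw [this]
  refine lintegral_congr fun z => ?_
  rw [ENNReal.ofReal_mul (by positivity), mul_assoc]

theorem lintegral_radialKernel_left [Nontrivial (Eu n)] (hη : ‖η‖ = 1) (hg : Measurable g)
    {y : Eu n} (hy : y ≠ 0) :
    ∫⁻ x, radialKernel κ g x y =
      ENNReal.ofReal (‖y‖ ^ (n - κ)) * radialIntegral κ (fun t => t ^ (κ - 2 * n) * g t) η := by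
  rw [homogInv_radialKernel.swap.lintegral_right hη hy, ← radialIntegral_inv hη hg]
  simp [radialKernel, radialIntegral, hη, norm_sub_rev η]

theorem radialIntegral_add {g' : ℝ → ℝ} (hg : Measurable g) (h0 : ∀ t, 0 ≤ g t)
    (h0' : ∀ t, 0 ≤ g' t) :
    radialIntegral κ (fun t => g t + g' t) η =
      radialIntegral κ g η + radialIntegral κ g' η := by
  unfold radialIntegral
  rw [← lintegral_add_left]
  · refine lintegral_congr fun z => ?_
    rw [ENNReal.ofReal_add (h0 _) (h0' _), add_mul]
  · refine Measurable.mul ?_ (by fun_prop :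
      Measurable fun z : Eu n => ENNReal.ofReal (‖η - z‖ ^ (-κ)))
    exact ENNReal.measurable_ofReal.comp (hg.comp measurable_norm)

theorem radialIntegral_congr [Nontrivial (Eu n)] {g' : ℝ → ℝ} (h : ∀ t, 0 < t → g t = g' t) :
    radialIntegral κ g η = radialIntegral κ g' η := by
  refine lintegral_congr_ae ((Measure.ae_ne volume (0 : Eu n)).mono fun z hz => ?_)
  simp only
  rw [h _ (norm_pos_iff.2 hz)]

end RadialKernel

/-! ### The sharp fractional Hardy inequality -/

section Hardy

theorem lintegral_lintegral_add_left {α γ : Type*} [MeasurableSpace α] [MeasurableSpace γ]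
    {μ : Measure α} {ν : Measure γ} [SFinite ν] {f g : α → γ → ℝ≥0∞}
    (hf : Measurable (Function.uncurry f)) :
    ∫⁻ x, ∫⁻ y, (f x y + g x y) ∂ν ∂μ = ∫⁻ x, ∫⁻ y, f x y ∂ν ∂μ + ∫⁻ x, ∫⁻ y, g x y ∂ν ∂μ := by
  have hm : Measurable fun x => ∫⁻ y, f x y ∂ν := hf.lintegral_prod_right'
  rw [← lintegral_add_left hm]
  exact lintegral_congr fun x => lintegral_add_left hf.of_uncurry_left _

/-- Convexity of t^q at the points d/(1−c) and b/c with weights 1−c and c. Equality holds for b = c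
a, d = (1−c) a; taking c to be the ratio of two values of the ground state therefore loses nothing
on the ground state. -/
theorem one_sub_rpow_mul_rpow_le {a b c d q : ℝ} (hc0 : 0 < c) (hc1 : c < 1) (hb : 0 ≤ b)
    (hd : 0 ≤ d) (ha : 0 ≤ a) (h : a ≤ d + b) (hq : 1 ≤ q) :
    (1 - c) ^ (q - 1) * a ^ q ≤ d ^ q + (1 - c) ^ (q - 1) * c ^ (1 - q) * b ^ q := by
  have h1c : 0 < 1 - c := by linarith
  have hconv := (convexOn_rpow hq).2 (x := d / (1 - c)) (y := b / c)
    (Set.mem_Ici.2 (by positivity)) (Set.mem_Ici.2 (by positivity)) h1c.le hc0.le (by ring)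
  simp only [smul_eq_mul] at hconv
  rw [mul_div_cancel₀ _ h1c.ne', mul_div_cancel₀ _ hc0.ne', Real.div_rpow hd h1c.le,
    Real.div_rpow hb hc0.le] at hconv
  have e1 : (1 - c) ^ q = (1 - c) ^ (q - 1) * (1 - c) := by
    rw [← Real.rpow_add_one h1c.ne']; ring_nf
  have e2 : c ^ (1 - q) * c ^ q = c := by
    rw [← Real.rpow_add hc0]; simp
  have hpc : 0 < c ^ q := by positivity
  have hp1 : 0 < (1 - c) ^ (q - 1) := by positivity
  calc (1 - c) ^ (q - 1) * a ^ q ≤ (1 - c) ^ (q - 1) * (d + b) ^ q := by gcongr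
    _ ≤ (1 - c) ^ (q - 1) * ((1 - c) * (d ^ q / (1 - c) ^ q) + c * (b ^ q / c ^ q)) := by gcongr
    _ = d ^ q + (1 - c) ^ (q - 1) * c ^ (1 - q) * b ^ q := by
      rw [e1]
      field_simp
      rw [mul_assoc, mul_assoc ((1 - c) ^ (q - 1))]
      linear_combination (-(b ^ q * (1 - c) ^ (q - 1))) * e2

variable {n : ℕ} {β q : ℝ}

theorem nontrivial_of_norm_eq_one {η : Eu n} (hη : ‖η‖ = 1) : Nontrivial (Eu n) :=
  ⟨η, 0, fun h => by simp [h] at hη⟩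

/-- Inversion exchanges the inside and the outside of the unit ball. The resulting power t^{qβ−n}
equals (t^{−l})^q and turns |1 − t^l|^q into |1 − t^{−l}|^q, so both regions contribute equally. -/
theorem lintegral_steinWeissKernel {η : Eu n} (hη : ‖η‖ = 1) (hq : 1 ≤ q)
    (hqβ : q * β ≤ n) :
    ∫⁻ x, ENNReal.ofReal (steinWeissKernel n β q η x) =
      2 * radialIntegral (n + q * β)
        (fun t => if 1 < t then (1 - t ^ (-((n - q * β) / q))) ^ q else 0) η := by
  have := nontrivial_of_norm_eq_one hη
  have hq0 : 0 < q := by linarith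
  set l := (n - q * β) / q with hl
  set gP : ℝ → ℝ := fun t => if 1 < t then |1 - t ^ (-l)| ^ q else 0 with hgP
  set gM : ℝ → ℝ := fun t => if t < 1 then |1 - t ^ (-l)| ^ q else 0 with hgM
  set h : ℝ → ℝ := fun t => if 1 < t then |1 - t ^ l| ^ q else 0 with hh
  have hPm : Measurable gP := Measurable.ite measurableSet_Ioi (by fun_prop) measurable_const
  have hhm : Measurable h := Measurable.ite measurableSet_Ioi (by fun_prop) measurable_const
  have hP0 : ∀ t, 0 ≤ gP t := fun t => by simp only [gP]; split_ifs <;> positivity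
  have hM0 : ∀ t, 0 ≤ gM t := fun t => by simp only [gM]; split_ifs <;> positivity
  have e1 : ∫⁻ x, ENNReal.ofReal (steinWeissKernel n β q η x) =
      radialIntegral (n + q * β) (fun t => gP t + gM t) η := by
    refine lintegral_congr fun x => ?_
    rw [steinWeissKernel, ENNReal.ofReal_mul (by positivity), norm_sub_rev, neg_add']
    congr 2
    simp only [gP, gM]
    rcases lt_trichotomy ‖x‖ 1 with h1 | h1 | h1
    · rw [if_neg h1.not_gt, if_pos h1, zero_add]
    · simp [h1, hq0.ne']
    · rw [if_pos h1, if_neg h1.not_gt, add_zero]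
  have e2 : radialIntegral (n + q * β) gM η = radialIntegral (n + q * β) gP η := by
    calc radialIntegral (n + q * β) gM η
        = radialIntegral (n + q * β) (fun t => h t⁻¹) η := by
          refine radialIntegral_congr fun t ht => ?_
          simp only [gM, h, one_lt_inv₀ ht]
          rw [Real.inv_rpow ht.le, Real.rpow_neg ht.le]
      _ = radialIntegral (n + q * β) (fun t => t ^ ((n + q * β) - 2 * n) * h t) η :=
          radialIntegral_inv hη hhm
      _ = _ := by
          refine radialIntegral_congr fun t ht => ?_
          simp only [gP, h]
          split_ifs with h1
          · have : (n + q * β) - 2 * n = -l * q := by rw [hl]; field_simp; ring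
            rw [this, Real.rpow_mul ht.le, ← Real.mul_rpow (by positivity) (by positivity)]
            congr 1
            have h2 : 0 < t ^ (-l) := by positivity
            rw [← abs_of_pos h2, ← abs_mul, abs_of_pos h2, mul_sub, ← Real.rpow_add ht,
              neg_add_cancel, Real.rpow_zero, mul_one, abs_sub_comm]
          · simp
  rw [e1, radialIntegral_add hPm hP0 hM0, e2, two_mul]
  have hl0 : 0 ≤ l := div_nonneg (by linarith) hq0.le
  have e3 : radialIntegral (n + q * β) gP η = radialIntegral (n + q * β)
      (fun t => if 1 < t then (1 - t ^ (-l)) ^ q else 0) η := radialIntegral_congr fun t ht => ?_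
  · rw [e3]
  simp only [gP]
  split_ifs with h1
  · rw [abs_of_nonneg]
    rw [sub_nonneg]
    exact Real.rpow_le_one_of_one_le_of_nonpos h1.le (by linarith)
  · rfl

/-- The contribution to the fractional Hardy inequality of the region `(1 + δ) |x| < |y|`. -/
theorem radialIntegral_mul_le {η : Eu n} (hη : ‖η‖ = 1) (hβ0 : 0 < β) (hβ1 : β < 1) (hq : 1 ≤ q)
    (hqβ : q * β < n) {F : Eu n → ℂ} (hF : Continuous F)
    (hS : ∫⁻ x, ENNReal.ofReal (‖x‖ ^ (-(q * β))) * ‖F x‖ₑ ^ q ≠ ⊤) {δ : ℝ} (hδ : 0 < δ) :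
    radialIntegral (n + q * β)
        (fun t => if 1 + δ < t then (1 - t ^ (-((n - q * β) / q))) ^ q else 0) η *
      (∫⁻ x, ENNReal.ofReal (‖x‖ ^ (-(q * β))) * ‖F x‖ₑ ^ q) ≤
    ∫⁻ x, ∫⁻ y, if ‖x‖ < ‖y‖ then
      ‖F x - F y‖ₑ ^ q * ENNReal.ofReal (‖x - y‖ ^ (-(n + q * β))) else 0 := by
  have := nontrivial_of_norm_eq_one hη
  have hq0 : 0 < q := by linarith
  set l := (n - q * β) / q with hl
  set κ : ℝ := n + q * β with hκ
  set S := ∫⁻ x, ENNReal.ofReal (‖x‖ ^ (-(q * β))) * ‖F x‖ₑ ^ q with hSdef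
  have hl0 : 0 < l := div_pos (by linarith) hq0
  have hc : ∀ t : ℝ, 1 + δ < t → 0 < t ^ (-l) ∧ t ^ (-l) < 1 := fun t ht =>
    ⟨Real.rpow_pos_of_pos (by linarith) _,
      Real.rpow_lt_one_of_one_lt_of_neg (by linarith) (by linarith)⟩
  -- With c = t^{−l} and t = |y|/|x|: `g1` and `g2` are the coefficients of |F(x)|^q and |F(y)|^q in
  -- the convexity inequality. Since (1−c)^{q−1} = (1−c)^q + (1−c)^{q−1} c, `g1` is the wanted gain
  -- `gE` plus the remainder `g3`, and inversion will identify the integral of `g2` with that of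
  -- `g3`.
  set gE : ℝ → ℝ := fun t => if 1 + δ < t then (1 - t ^ (-l)) ^ q else 0 with hgE
  set g1 : ℝ → ℝ := fun t => if 1 + δ < t then (1 - t ^ (-l)) ^ (q - 1) else 0 with hg1
  set g2 : ℝ → ℝ := fun t => if 1 + δ < t then
    (1 - t ^ (-l)) ^ (q - 1) * (t ^ (-l)) ^ (1 - q) else 0 with hg2
  set g3 : ℝ → ℝ := fun t => if 1 + δ < t then (1 - t ^ (-l)) ^ (q - 1) * t ^ (-l) else 0 with hg3
  have mE : Measurable gE := Measurable.ite measurableSet_Ioi (by fun_prop) measurable_const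
  have m1 : Measurable g1 := Measurable.ite measurableSet_Ioi (by fun_prop) measurable_const
  have m2 : Measurable g2 := Measurable.ite measurableSet_Ioi (by fun_prop) measurable_const
  have pE : ∀ t, 0 ≤ gE t := fun t => by
    simp only [gE]
    split_ifs with h
    · have := hc t h; exact Real.rpow_nonneg (by linarith) _
    · rfl
  have p3 : ∀ t, 0 ≤ g3 t := fun t => by
    simp only [g3]
    split_ifs with h
    · have := hc t h; exact mul_nonneg (Real.rpow_nonneg (by linarith) _) this.1.le
    · rfl
  have i1 : radialIntegral κ g1 η = radialIntegral κ gE η + radialIntegral κ g3 η := by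
    rw [← radialIntegral_add mE pE p3]
    refine radialIntegral_congr fun t _ => ?_
    simp only [g1, gE, g3]
    split_ifs with h
    · have h1 : 0 < 1 - t ^ (-l) := by linarith [(hc t h).2]
      have e1 : (1 - t ^ (-l)) ^ q = (1 - t ^ (-l)) ^ (q - 1) * (1 - t ^ (-l)) := by
        rw [← Real.rpow_add_one h1.ne']; ring_nf
      rw [e1]; ring
    · simp
  have i2 : radialIntegral κ (fun t => t ^ (κ - 2 * n) * g2 t) η = radialIntegral κ g3 η := by
    refine radialIntegral_congr fun t ht => ?_
    simp only [g2, g3]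
    split_ifs with h
    · have e1 : κ - 2 * n = -l * q := by rw [hκ, hl]; field_simp; ring
      rw [e1, Real.rpow_mul ht.le, mul_left_comm, ← Real.rpow_add (hc t h).1, add_sub_cancel,
        Real.rpow_one]
    · simp
  -- The cut-off δ is there for this: it keeps z at distance at least δ from η, whereas for δ = 0
  -- the power (1−c)^{q−1} need not tame the singularity at η.
  have hfin : radialIntegral κ g3 η ≠ ⊤ := by
    have hint := ((integrable_min_rpow_mul_rpow (n := n) (q := q) (κ := κ)
      (by rw [hκ]; nlinarith) (by rw [hκ]; nlinarith)).comp_sub_left η).const_mul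
      (min 1 δ ^ (-q))
    refine ne_top_of_le_ne_top hint.lintegral_lt_top.ne (lintegral_mono fun z => ?_)
    rw [← ENNReal.ofReal_mul (p3 _), ← mul_assoc]
    refine ENNReal.ofReal_le_ofReal (mul_le_mul_of_nonneg_right ?_ (by positivity))
    simp only [g3]
    split_ifs with h
    · have h1 := hc _ h
      have h2 : (1 - ‖z‖ ^ (-l)) ^ (q - 1) ≤ 1 :=
        Real.rpow_le_one (by linarith) (by linarith) (by linarith)
      have h3 : δ ≤ ‖η - z‖ := by
        have := norm_sub_norm_le z η
        rw [norm_sub_rev] at this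
        linarith
      have hm : 0 < min 1 δ := lt_min one_pos hδ
      have h4 : min 1 δ ^ q ≤ min 1 ‖η - z‖ ^ q := by gcongr
      calc (1 - ‖z‖ ^ (-l)) ^ (q - 1) * ‖z‖ ^ (-l) ≤ 1 * 1 :=
            mul_le_mul h2 h1.2.le h1.1.le zero_le_one
        _ = min 1 δ ^ (-q) * min 1 δ ^ q := by rw [← Real.rpow_add hm]; simp
        _ ≤ _ := by gcongr
    · positivity
  have hpt : ∀ x y : Eu n, radialKernel κ g1 x y * ‖F x‖ₑ ^ q ≤
      (if ‖x‖ < ‖y‖ then ‖F x - F y‖ₑ ^ q * ENNReal.ofReal (‖x - y‖ ^ (-κ)) else 0)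
        + radialKernel κ g2 x y * ‖F y‖ₑ ^ q := by
    intro x y
    by_cases h : 1 + δ < ‖y‖ / ‖x‖
    · have hx : 0 < ‖x‖ := by
        by_contra hx
        rw [le_antisymm (not_lt.1 hx) (norm_nonneg x), div_zero] at h
        linarith
      have hxy : ‖x‖ < ‖y‖ := by
        rw [lt_div_iff₀ hx] at h
        nlinarith
      have hc' := hc _ h
      have key := one_sub_rpow_mul_rpow_le (q := q) hc'.1 hc'.2 (norm_nonneg (F y))
        (norm_nonneg (F x - F y)) (norm_nonneg (F x))
        (by simpa using norm_add_le (F x - F y) (F y)) hq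
      rw [if_pos hxy, radialKernel, radialKernel]
      simp only [g1, g2, if_pos h]
      have he : ∀ z : ℂ, ‖z‖ₑ ^ q = ENNReal.ofReal (‖z‖ ^ q) := fun z => by
        rw [← ENNReal.ofReal_rpow_of_nonneg (norm_nonneg _) hq0.le, ofReal_norm]
      have hA : 0 ≤ (1 - (‖y‖ / ‖x‖) ^ (-l)) ^ (q - 1) := Real.rpow_nonneg (by linarith) _
      have hB := hc'.1
      rw [he, he, he, ← ENNReal.ofReal_mul hA, ← ENNReal.ofReal_mul (by positivity),
        ← ENNReal.ofReal_mul (by positivity), ← ENNReal.ofReal_mul (by positivity),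
        ← ENNReal.ofReal_mul (by positivity), ← ENNReal.ofReal_add (by positivity) (by positivity)]
      refine ENNReal.ofReal_le_ofReal ?_
      have := mul_le_mul_of_nonneg_right key (Real.rpow_nonneg (norm_nonneg (x - y)) (-κ))
      refine le_trans (le_of_eq (by ring)) (this.trans (le_of_eq (by ring)))
    · simp only [radialKernel, g1, if_neg h]
      simp
  have hFm : Measurable fun x => ‖F x‖ₑ ^ q := hF.enorm.measurable.pow_const q
  have h0 : ∀ᵐ x : Eu n, x ≠ 0 := Measure.ae_ne volume 0
  have hexp : (n : ℝ) - κ = -(q * β) := by rw [hκ]; ring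
  have L1 : ∫⁻ x, ∫⁻ y, radialKernel κ g1 x y * ‖F x‖ₑ ^ q = radialIntegral κ g1 η * S := by
    rw [hSdef, ← lintegral_const_mul _ (by fun_prop)]
    refine lintegral_congr_ae (h0.mono fun x hx => ?_)
    simp only
    rw [lintegral_mul_const _ (measurable_radialKernel m1).of_uncurry_left,
      lintegral_radialKernel_right hη hx, hexp]
    ring
  have L2 : ∫⁻ x, ∫⁻ y, radialKernel κ g2 x y * ‖F y‖ₑ ^ q = radialIntegral κ g3 η * S := by
    rw [lintegral_lintegral_swap ((measurable_radialKernel m2).mul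
      (hFm.comp measurable_snd)).aemeasurable]
    rw [hSdef, ← lintegral_const_mul _ (by fun_prop)]
    refine lintegral_congr_ae (h0.mono fun y hy => ?_)
    simp only
    rw [lintegral_mul_const _ (measurable_radialKernel m2).of_uncurry_right,
      lintegral_radialKernel_left hη m2 hy, hexp, i2]
    ring
  -- The remainder occurs on both sides. It is finite, by `hfin` and `hS`, and can be cancelled.
  have hmain : radialIntegral κ gE η * S + radialIntegral κ g3 η * S ≤
      (∫⁻ x, ∫⁻ y, if ‖x‖ < ‖y‖ then
      ‖F x - F y‖ₑ ^ q * ENNReal.ofReal (‖x - y‖ ^ (-κ)) else 0) +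
        radialIntegral κ g3 η * S := by
    rw [← add_mul, ← i1, ← L1, ← L2]
    have hm : Measurable (Function.uncurry fun x y : Eu n => if ‖x‖ < ‖y‖ then
      ‖F x - F y‖ₑ ^ q * ENNReal.ofReal (‖x - y‖ ^ (-κ)) else 0) := by
      refine Measurable.ite (measurableSet_lt (by fun_prop) (by fun_prop)) ?_ measurable_const
      have hd : Measurable fun z : Eu n × Eu n => F z.1 - F z.2 := by
        have := hF.measurable
        fun_prop
      exact (hd.enorm.pow_const q).mul (by fun_prop)
    calc _ ≤ ∫⁻ x, ∫⁻ y, ((if ‖x‖ < ‖y‖ then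
          ‖F x - F y‖ₑ ^ q * ENNReal.ofReal (‖x - y‖ ^ (-κ)) else 0) +
            radialKernel κ g2 x y * ‖F y‖ₑ ^ q) :=
          lintegral_mono fun x => lintegral_mono fun y => hpt x y
      _ = _ := lintegral_lintegral_add_left hm
  exact (ENNReal.add_le_add_iff_right (ENNReal.mul_ne_top hfin hS)).1 hmain

/-- The sharp fractional Hardy (Stein–Weiss) inequality. -/
theorem lintegral_steinWeissKernel_mul_le {η : Eu n} (hη : ‖η‖ = 1) (hβ0 : 0 < β) (hβ1 : β < 1)
    (hq : 1 ≤ q) (hqβ : q * β < n) {F : Eu n → ℂ} (hF : Continuous F)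
    (hS : ∫⁻ x, ENNReal.ofReal (‖x‖ ^ (-(q * β))) * ‖F x‖ₑ ^ q ≠ ⊤) :
    (∫⁻ x, ENNReal.ofReal (steinWeissKernel n β q η x)) *
      (∫⁻ x, ENNReal.ofReal (‖x‖ ^ (-(q * β))) * ‖F x‖ₑ ^ q) ≤
    ∫⁻ x, ∫⁻ y, ‖F x - F y‖ₑ ^ q * ENNReal.ofReal (‖x - y‖ ^ (-(n + q * β))) := by
  rw [lintegral_steinWeissKernel hη hq hqβ.le, mul_assoc]
  have hbound := fun δ hδ => radialIntegral_mul_le (δ := δ) hη hβ0 hβ1 hq hqβ hF hS hδ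
  set l := (n - q * β) / q with hl
  set κ : ℝ := n + q * β with hκ
  set S := ∫⁻ x, ENNReal.ofReal (‖x‖ ^ (-(q * β))) * ‖F x‖ₑ ^ q with hSdef
  set G : Eu n → Eu n → ℝ≥0∞ := fun x y =>
    ‖F x - F y‖ₑ ^ q * ENNReal.ofReal (‖x - y‖ ^ (-κ)) with hG
  have hGm : Measurable fun z : Eu n × Eu n => G z.1 z.2 := by
    have hd : Measurable fun z : Eu n × Eu n => F z.1 - F z.2 := by
      have := hF.measurable
      fun_prop
    exact (hd.enorm.pow_const q).mul (by fun_prop)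
  set J := ∫⁻ x, ∫⁻ y, if ‖x‖ < ‖y‖ then G x y else 0 with hJ
  -- δ = 1/(m+1) → 0 by Fatou; for fixed z the truncated integrand is eventually equal to its limit.
  have hJ' : radialIntegral κ (fun t => if 1 < t then (1 - t ^ (-l)) ^ q else 0) η * S ≤ J := by
    rcases eq_or_ne S 0 with h0 | h0
    · rw [h0, mul_zero]; exact zero_le
    rw [← ENNReal.le_div_iff_mul_le (Or.inl h0) (Or.inl hS)]
    have hlim : ∀ z : Eu n, Tendsto (fun m : ℕ => ENNReal.ofReal (if 1 + 1 / ((m : ℝ) + 1) < ‖z‖ then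
        (1 - ‖z‖ ^ (-l)) ^ q else 0) * ENNReal.ofReal (‖η - z‖ ^ (-κ))) atTop
        (𝓝 (ENNReal.ofReal (if 1 < ‖z‖ then (1 - ‖z‖ ^ (-l)) ^ q else 0) *
          ENNReal.ofReal (‖η - z‖ ^ (-κ)))) := by
      intro z
      refine tendsto_const_nhds.congr' ?_
      by_cases h : 1 < ‖z‖
      · have h1 : ∀ᶠ m : ℕ in atTop, 1 / ((m : ℝ) + 1) < ‖z‖ - 1 :=
          tendsto_one_div_add_atTop_nhds_zero_nat.eventually (gt_mem_nhds (by linarith))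
        filter_upwards [h1] with m hm
        rw [if_pos h, if_pos (by linarith)]
      · refine .of_forall fun m => ?_
        have : (0 : ℝ) < 1 / ((m : ℝ) + 1) := by positivity
        have h2 : ¬ 1 + 1 / ((m : ℝ) + 1) < ‖z‖ := by linarith
        simp only [if_neg h, if_neg h2]
    calc _ = ∫⁻ z, liminf (fun m : ℕ => ENNReal.ofReal (if 1 + 1 / ((m : ℝ) + 1) < ‖z‖ then
        (1 - ‖z‖ ^ (-l)) ^ q else 0) * ENNReal.ofReal (‖η - z‖ ^ (-κ))) atTop :=
          lintegral_congr fun z => ((hlim z).liminf_eq).symm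
      _ ≤ liminf (fun m : ℕ => ∫⁻ z, ENNReal.ofReal (if 1 + 1 / ((m : ℝ) + 1) < ‖z‖ then
        (1 - ‖z‖ ^ (-l)) ^ q else 0) * ENNReal.ofReal (‖η - z‖ ^ (-κ))) atTop := by
          refine lintegral_liminf_le fun m => Measurable.mul ?_
            (by fun_prop : Measurable fun z : Eu n => ENNReal.ofReal (‖η - z‖ ^ (-κ)))
          refine ENNReal.measurable_ofReal.comp (Measurable.ite
            (measurableSet_lt measurable_const measurable_norm) (by fun_prop) measurable_const)
      _ ≤ J / S := by
          refine liminf_le_of_frequently_le' (Frequently.of_forall fun m => ?_)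
          rw [ENNReal.le_div_iff_mul_le (Or.inl h0) (Or.inl hS)]
          exact hbound _ (by positivity)
  have hGpm : Measurable fun z : Eu n × Eu n => if ‖z.1‖ < ‖z.2‖ then G z.1 z.2 else 0 :=
    Measurable.ite (measurableSet_lt (by fun_prop) (by fun_prop)) hGm measurable_const
  -- The integrand is symmetric in x and y, so the region |y| < |x| supplies the second copy needed
  -- for the factor 2 in front of the radial integral.
  have hsymm : ∫⁻ x, ∫⁻ y, (if ‖y‖ < ‖x‖ then G x y else 0) = J := by
    rw [hJ, lintegral_lintegral_swap (f := fun x y => if ‖x‖ < ‖y‖ then G x y else 0)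
      hGpm.aemeasurable]
    refine lintegral_congr fun x => lintegral_congr fun y => ?_
    simp only [hG, norm_sub_rev x y]
    rw [← enorm_neg (F x - F y), neg_sub]
  calc 2 * _ ≤ 2 * J := by gcongr
    _ = ∫⁻ x, ∫⁻ y, ((if ‖x‖ < ‖y‖ then G x y else 0) + if ‖y‖ < ‖x‖ then G x y else 0) := by
        rw [lintegral_lintegral_add_left (f := fun x y => if ‖x‖ < ‖y‖ then G x y else 0) hGpm,
          hsymm, two_mul]
    _ ≤ _ := by
        refine lintegral_mono fun x => lintegral_mono fun y => ?_
        simp only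
        rcases lt_trichotomy ‖x‖ ‖y‖ with h | h | h
        · rw [if_pos h, if_neg h.not_gt, add_zero]
        · simp [h]
        · rw [if_pos h, if_neg h.not_gt, zero_add]

end Hardy

end Pitt

namespace Pitt

open Filter Topology
open scoped ENNReal

/-! ### The two kernels in the constant -/

section Kernels

variable {n : ℕ} {β q : ℝ}

theorem norm_exp_inner_sub_one_le (w ξ : Eu n) :
    ‖Complex.exp (2 * (Real.pi : ℂ) * Complex.I * ((inner ℝ w ξ : ℝ) : ℂ)) - 1‖ ≤
      2 * Real.pi * (1 + ‖ξ‖) * min 1 ‖w‖ := by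
  have e : 2 * (Real.pi : ℂ) * Complex.I * ((inner ℝ w ξ : ℝ) : ℂ) =
      Complex.I * ((2 * Real.pi * inner ℝ w ξ : ℝ) : ℂ) := by push_cast; ring
  rw [e]
  have hpi := Real.pi_gt_three
  have hξ := norm_nonneg ξ
  rcases le_total 1 ‖w‖ with h | h
  · rw [min_eq_left h, mul_one]
    refine (norm_sub_le _ _).trans ?_
    rw [Complex.norm_exp_I_mul_ofReal, norm_one]
    nlinarith
  · rw [min_eq_right h]
    refine (Real.norm_exp_I_mul_ofReal_sub_one_le).trans ?_
    rw [Real.norm_eq_abs, abs_mul, abs_of_pos (by positivity : 0 < 2 * Real.pi)]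
    have h1 := abs_real_inner_le_norm w ξ
    have h2 := norm_nonneg w
    have h3 : |inner ℝ w ξ| ≤ (1 + ‖ξ‖) * ‖w‖ := by nlinarith
    rw [mul_assoc (2 * Real.pi)]
    exact mul_le_mul_of_nonneg_left h3 (by positivity)

theorem diffKernel_eq (w ξ : Eu n) : diffKernel n β q ξ w =
    ‖Complex.exp (2 * (Real.pi : ℂ) * Complex.I * ((inner ℝ w ξ : ℝ) : ℂ)) - 1‖ ^ q
      * ‖w‖ ^ (-((n : ℝ) + q * β)) := by
  rw [diffKernel, Real.rpow_neg (norm_nonneg _), one_div]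

theorem measurable_diffKernel (ξ : Eu n) : Measurable (diffKernel n β q ξ) := by
  have h1 : Measurable fun w : Eu n =>
      ‖Complex.exp (2 * (Real.pi : ℂ) * Complex.I * ((inner ℝ w ξ : ℝ) : ℂ)) - 1‖ :=
    Continuous.measurable (by fun_prop)
  have h2 : Measurable fun w : Eu n => ‖w‖ ^ (-((n : ℝ) + q * β)) := by fun_prop
  have : diffKernel n β q ξ = fun w : Eu n =>
      ‖Complex.exp (2 * (Real.pi : ℂ) * Complex.I * ((inner ℝ w ξ : ℝ) : ℂ)) - 1‖ ^ q
      * ‖w‖ ^ (-((n : ℝ) + q * β)) := funext fun w => diffKernel_eq w ξ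
  rw [this]
  exact (h1.pow_const q).mul h2

theorem diffKernel_nonneg (w ξ : Eu n) : 0 ≤ diffKernel n β q ξ w := by
  unfold diffKernel; positivity

theorem integrable_diffKernel [Nontrivial (Eu n)] (hβ0 : 0 < β) (hβ1 : β < 1) (hq : 0 < q)
    (ξ : Eu n) : Integrable (diffKernel n β q ξ) := by
  have h := (integrable_min_rpow_mul_rpow (n := n) (q := q) (κ := n + q * β)
    (by nlinarith) (by nlinarith)).const_mul ((2 * Real.pi * (1 + ‖ξ‖)) ^ q)
  refine h.mono' (measurable_diffKernel ξ).aestronglyMeasurable (.of_forall fun w => ?_)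
  rw [Real.norm_of_nonneg (diffKernel_nonneg w ξ), diffKernel_eq, ← mul_assoc,
    ← Real.mul_rpow (by positivity) (by positivity)]
  gcongr
  exact norm_exp_inner_sub_one_le w ξ

/-- Rotate ξ to the direction of η and rescale w by 1/|ξ|; the homogeneity of |w|^{−n−qβ} dw leaves
|ξ|^{qβ}. This is the origin of the weight |x|^β, and of the independence of the constant from the
choice of η. -/
theorem lintegral_diffKernel {η : Eu n} (hη : ‖η‖ = 1) {ξ : Eu n} (hξ : ξ ≠ 0) :
    ∫⁻ w, ENNReal.ofReal (diffKernel n β q ξ w) =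
      ENNReal.ofReal (‖ξ‖ ^ (q * β)) * ∫⁻ w, ENNReal.ofReal (diffKernel n β q η w) := by
  obtain ⟨T, hT⟩ := exists_smul_isometry_eq (x := ξ) hη
  have hc : 0 < ‖ξ‖ := norm_pos_iff.2 hξ
  rw [lintegral_eq_smul_isometry _ (inv_pos.2 hc) T, ← lintegral_const_mul' _ _
    ENNReal.ofReal_ne_top, ← lintegral_const_mul' _ _ ENNReal.ofReal_ne_top]
  refine lintegral_congr fun w => ?_
  have h1 : inner ℝ (‖ξ‖⁻¹ • T w) ξ = inner ℝ w η := by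
    have h2 : inner ℝ (‖ξ‖⁻¹ • T w) ξ = inner ℝ (‖ξ‖⁻¹ • T w) (‖ξ‖ • T η) := by rw [hT]
    rw [h2, inner_smul_left, inner_smul_right, LinearIsometryEquiv.inner_map_map]
    simp [hc.ne']
  rw [← ENNReal.ofReal_mul (by positivity), ← ENNReal.ofReal_mul (by positivity), diffKernel_eq,
    diffKernel_eq, h1, norm_smul, LinearIsometryEquiv.norm_map, norm_inv, norm_norm,
    Real.mul_rpow (by positivity) (norm_nonneg _), Real.inv_rpow hc.le, Real.inv_rpow hc.le,
    Real.rpow_neg hc.le, inv_inv, Real.rpow_add hc]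
  congr 1
  field_simp

theorem steinWeissKernel_nonneg (η x : Eu n) : 0 ≤ steinWeissKernel n β q η x := by
  unfold steinWeissKernel; positivity

theorem rpow_neg_le_two_rpow {u a : ℝ} (hu : 1 / 2 ≤ u) (ha : 0 ≤ a) : u ^ (-a) ≤ 2 ^ a := by
  have h : (1 / 2 : ℝ) ^ (-a) = 2 ^ a := by
    rw [one_div, Real.inv_rpow (by norm_num), Real.rpow_neg (by norm_num), inv_inv]
  exact h ▸ Real.rpow_le_rpow_of_nonpos (by norm_num) hu (neg_nonpos.2 ha)

/-- Near t = 1 this is the mean value inequality on [1/2, ∞), where the derivative of t^{−l} is at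
most l 2^{l+1} in absolute value; away from 1 boundedness suffices. -/
theorem abs_one_sub_rpow_neg_le {l t : ℝ} (hl : 0 ≤ l) (ht : 1 / 2 ≤ t) :
    |1 - t ^ (-l)| ≤ (2 ^ l + l * 2 ^ (l + 1)) * min 1 |1 - t| := by
  have ht0 : 0 < t := by linarith
  have h2l : (1 : ℝ) ≤ 2 ^ l := Real.one_le_rpow (by norm_num) hl
  have hp := rpow_neg_le_two_rpow ht hl
  have hp0 : 0 < t ^ (-l) := by positivity
  have hnn : 0 ≤ l * 2 ^ (l + 1) := by positivity
  rcases le_total 1 |1 - t| with h | h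
  · rw [min_eq_left h, mul_one, abs_le]
    constructor <;> linarith
  · rw [min_eq_right h]
    have hd : ∀ u ∈ Set.Ici (1 / 2 : ℝ), HasDerivWithinAt (fun u : ℝ => u ^ (-l))
        (-l * u ^ (-l - 1)) (Set.Ici (1 / 2)) u := fun u hu => by
      have hu' : (1 / 2 : ℝ) ≤ u := hu
      exact (Real.hasDerivAt_rpow_const (Or.inl (by linarith))).hasDerivWithinAt
    have hb : ∀ u ∈ Set.Ici (1 / 2 : ℝ), ‖-l * u ^ (-l - 1)‖ ≤ l * 2 ^ (l + 1) := fun u hu => by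
      have hu' : (1 / 2 : ℝ) ≤ u := hu
      have hu0 : 0 < u := by linarith
      rw [norm_mul, norm_neg, Real.norm_of_nonneg hl, Real.norm_of_nonneg (by positivity)]
      have := rpow_neg_le_two_rpow (a := l + 1) hu' (by linarith)
      rw [neg_add'] at this
      gcongr
    have := (convex_Ici (1 / 2 : ℝ)).norm_image_sub_le_of_norm_hasDerivWithin_le hd hb
      (Set.mem_Ici.2 ht) (Set.mem_Ici.2 (by norm_num : (1 / 2 : ℝ) ≤ 1))
    simp only [Real.norm_eq_abs, Real.one_rpow] at this
    refine this.trans ?_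
    gcongr
    linarith

theorem integrable_steinWeissKernel (hβ0 : 0 < β) (hβ1 : β < 1) (hq : 0 < q) (hqβ : q * β < n)
    {η : Eu n} (hη : ‖η‖ = 1) : Integrable (steinWeissKernel n β q η) := by
  have := nontrivial_of_norm_eq_one hη
  set l := ((n : ℝ) - q * β) / q with hl
  have hl0 : 0 ≤ l := div_nonneg (by linarith) hq.le
  set κ : ℝ := n + q * β with hκ
  have hκ0 : 0 < κ := by rw [hκ]; positivity
  set C : ℝ := 2 ^ l + l * 2 ^ (l + 1) with hC
  have hC0 : 0 ≤ C := by positivity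
  have i1 := ((integrable_min_rpow_mul_rpow (n := n) (q := q) (κ := κ)
    (by rw [hκ]; nlinarith) (by rw [hκ]; nlinarith)).comp_sub_right η).const_mul (C ^ q)
  have i2 := ((integrableOn_ball_norm_rpow (n := n) (a := l * q) (by
    rw [hl, div_mul_cancel₀ _ hq.ne']; nlinarith) (1 / 2)).integrable_indicator
      measurableSet_ball).const_mul (2 ^ κ)
  -- Split at |x| = 1/2. Inside, the singularity is |x|^{−lq} with lq = n − qβ < n. Outside, the
  -- first factor vanishes at |x| = 1 at a linear rate and, with | |x| − 1 | ≤ |x − η|, tames the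
  -- singularity at η.
  refine (i1.add i2).mono' ?_ ((Measure.ae_ne volume 0).mono fun x hx0 => ?_)
  · refine Measurable.aestronglyMeasurable ?_
    unfold steinWeissKernel
    have h1 : Measurable fun x : Eu n => |1 - ‖x‖ ^ (-(((n : ℝ) - q * β) / q))| ^ q := by
      fun_prop
    have h2 : Measurable fun x : Eu n => ‖x - η‖ ^ (-(n : ℝ) - q * β) := by fun_prop
    exact h1.mul h2
  rw [Real.norm_of_nonneg (steinWeissKernel_nonneg η x), steinWeissKernel, ← hl, ← neg_add', ← hκ]
  simp only [Pi.add_apply]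
  have hn1 : 0 ≤ C ^ q * (min 1 ‖x - η‖ ^ q * ‖x - η‖ ^ (-κ)) := by positivity
  by_cases hx : x ∈ Metric.ball (0 : Eu n) (1 / 2)
  · rw [Set.indicator_of_mem hx]
    have hx' : ‖x‖ < 1 / 2 := by simpa using hx
    refine le_trans ?_ (le_add_of_nonneg_left hn1)
    have h1 : ‖x - η‖ ^ (-κ) ≤ 2 ^ κ := by
      have h2 : 1 / 2 ≤ ‖x - η‖ := by
        have := norm_sub_norm_le η x
        rw [norm_sub_rev, hη] at this
        linarith
      exact rpow_neg_le_two_rpow h2 hκ0.le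
    have hpos : 0 < ‖x‖ := norm_pos_iff.2 hx0
    have h3 : 1 ≤ ‖x‖ ^ (-l) :=
      Real.one_le_rpow_of_pos_of_le_one_of_nonpos hpos (by linarith) (by linarith)
    have h4 : |1 - ‖x‖ ^ (-l)| ≤ ‖x‖ ^ (-l) := by
      rw [abs_le]; constructor <;> linarith
    calc |1 - ‖x‖ ^ (-l)| ^ q * ‖x - η‖ ^ (-κ) ≤ (‖x‖ ^ (-l)) ^ q * 2 ^ κ := by gcongr
      _ = _ := by rw [← Real.rpow_mul hpos.le, neg_mul, mul_comm]
  · rw [Set.indicator_of_notMem hx, mul_zero, add_zero]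
    have hx' : 1 / 2 ≤ ‖x‖ := by simpa using hx
    rw [← mul_assoc, ← Real.mul_rpow hC0 (by positivity)]
    gcongr
    refine (abs_one_sub_rpow_neg_le hl0 hx').trans ?_
    gcongr
    rw [← hη, norm_sub_rev]
    exact abs_norm_sub_norm_le _ _

theorem integral_steinWeissKernel_pos (hβ0 : 0 < β) (hβ1 : β < 1) (hq : 0 < q) (hqβ : q * β < n)
    {η : Eu n} (hη : ‖η‖ = 1) : 0 < ∫ x, steinWeissKernel n β q η x := by
  have := nontrivial_of_norm_eq_one hη
  rw [integral_pos_iff_support_of_nonneg (steinWeissKernel_nonneg η)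
    (integrable_steinWeissKernel hβ0 hβ1 hq hqβ hη)]
  have hopen : IsOpen {x : Eu n | 1 < ‖x‖} := isOpen_lt continuous_const continuous_norm
  have hne : {x : Eu n | 1 < ‖x‖}.Nonempty := ⟨(2 : ℝ) • η, by
    simp [norm_smul, hη]⟩
  refine (hopen.measure_pos volume hne).trans_le (measure_mono fun x hx => ?_)
  have hx' : 1 < ‖x‖ := hx
  have hl : 0 < ((n : ℝ) - q * β) / q := div_pos (by linarith) hq
  have h1 : ‖x‖ ^ (-(((n : ℝ) - q * β) / q)) < 1 :=
    Real.rpow_lt_one_of_one_lt_of_neg hx' (by linarith)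
  have h2 : 0 < ‖x - η‖ := norm_pos_iff.2 (sub_ne_zero.2 fun h => by rw [h, hη] at hx'; linarith)
  have h3 : 0 < |1 - ‖x‖ ^ (-(((n : ℝ) - q * β) / q))| := abs_pos.2 (by linarith)
  rw [Function.mem_support, steinWeissKernel]
  positivity

end Kernels

/-! ### Weighted integrability of Schwartz functions -/

section Schwartz

variable {n : ℕ} {β : ℝ}

theorem integrable_one_add_norm_mul_rpow (g : 𝓢(Eu n, ℂ)) {a : ℝ} (ha : 1 ≤ a) :
    Integrable fun x => ((1 + ‖x‖) * ‖g x‖) ^ a := by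
  -- One power of 1 + |x| is spent on the weight; the other n + 1 give decay (1 + |x|)^{−(n+1)a},
  -- integrable for every a ≥ 1.
  obtain ⟨C, hC⟩ : ∃ C : ℝ, ∀ x, (1 + ‖x‖) ^ (n + 2) * ‖g x‖ ≤ C :=
    ⟨_, fun x => by
      simpa using SchwartzMap.one_add_le_sup_seminorm_apply (𝕜 := ℝ) (m := (n + 2, 0)) le_rfl
        le_rfl g x⟩
  have hC0 : 0 ≤ C := le_trans (by positivity) (hC 0)
  have hint : Integrable fun x : Eu n => C ^ a * (1 + ‖x‖) ^ (-((n + 1) * a)) := by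
    refine (integrable_one_add_norm ?_).const_mul _
    rw [finrank_euclideanSpace, Fintype.card_fin]
    nlinarith [(Nat.cast_nonneg n : (0 : ℝ) ≤ n)]
  refine hint.mono' ?_ (.of_forall fun x => ?_)
  · have hg := g.continuous
    refine Continuous.aestronglyMeasurable ?_
    exact Continuous.rpow_const (by fun_prop) fun x => Or.inr (by linarith)
  · have h1 : 0 < 1 + ‖x‖ := by positivity
    rw [Real.norm_of_nonneg (by positivity)]
    have h2 : (1 + ‖x‖) * ‖g x‖ ≤ C * (1 + ‖x‖) ^ (-((n : ℝ) + 1)) := by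
      rw [Real.rpow_neg h1.le, ← div_eq_mul_inv, le_div_iff₀ (by positivity)]
      refine le_trans (le_of_eq ?_) (hC x)
      have : (1 + ‖x‖) ^ ((n : ℝ) + 1) = (1 + ‖x‖) ^ (n + 1) := by
        rw [← Real.rpow_natCast]; push_cast; rfl
      rw [this]; ring
    calc ((1 + ‖x‖) * ‖g x‖) ^ a ≤ (C * (1 + ‖x‖) ^ (-((n : ℝ) + 1))) ^ a := by gcongr
      _ = _ := by
        rw [Real.mul_rpow hC0 (by positivity), ← Real.rpow_mul h1.le, neg_mul]

theorem integrable_norm_rpow_mul_rpow (g : 𝓢(Eu n, ℂ)) (hβ0 : 0 < β) (hβ1 : β < 1) {a : ℝ}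
    (ha : 1 ≤ a) : Integrable fun x => (‖x‖ ^ β * ‖g x‖) ^ a := by
  refine (integrable_one_add_norm_mul_rpow g ha).mono' ?_ (.of_forall fun x => ?_)
  · have hg := g.continuous
    refine Continuous.aestronglyMeasurable ?_
    refine Continuous.rpow_const ?_ fun x => Or.inr (by linarith)
    exact (continuous_norm.rpow_const fun x => Or.inr hβ0.le).mul hg.norm
  · rw [Real.norm_of_nonneg (by positivity)]
    have : ‖x‖ ^ β ≤ 1 + ‖x‖ := by
      calc ‖x‖ ^ β ≤ (1 + ‖x‖) ^ β := by gcongr; linarith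
        _ ≤ (1 + ‖x‖) ^ (1 : ℝ) :=
          Real.rpow_le_rpow_of_exponent_le (by linarith [norm_nonneg x]) hβ1.le
        _ = _ := Real.rpow_one _
    gcongr

theorem integrable_norm_rpow_neg_mul_rpow [Nontrivial (Eu n)] (g : 𝓢(Eu n, ℂ)) (hβ0 : 0 < β)
    {a : ℝ} (ha : 1 ≤ a) (haβ : a * β < n) :
    Integrable fun x => (‖x‖ ^ (-β) * ‖g x‖) ^ a := by
  obtain ⟨C, hC⟩ : ∃ C : ℝ, ∀ x, ‖g x‖ ≤ C :=
    ⟨_, fun x => by simpa using SchwartzMap.le_seminorm ℝ 0 0 g x⟩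
  have hC0 : 0 ≤ C := le_trans (norm_nonneg _) (hC 0)
  have i1 := ((integrableOn_ball_norm_rpow (n := n) (a := a * β) haβ 1).integrable_indicator
      measurableSet_ball).const_mul (C ^ a)
  refine (i1.add (integrable_one_add_norm_mul_rpow g ha)).mono' ?_ (.of_forall fun x => ?_)
  · have hg := g.continuous.measurable
    refine Measurable.aestronglyMeasurable ?_
    fun_prop
  · rw [Real.norm_of_nonneg (by positivity)]
    simp only [Pi.add_apply]
    by_cases hx : x ∈ Metric.ball (0 : Eu n) 1
    · rw [Set.indicator_of_mem hx]
      refine le_add_of_le_of_nonneg ?_ (by positivity)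
      rw [Real.mul_rpow (by positivity) (norm_nonneg _), ← Real.rpow_mul (norm_nonneg _), mul_comm,
        neg_mul, mul_comm β]
      gcongr
      exact hC x
    · rw [Set.indicator_of_notMem hx, mul_zero, zero_add]
      have hx' : 1 ≤ ‖x‖ := by simpa using hx
      have : ‖x‖ ^ (-β) ≤ 1 + ‖x‖ :=
        (Real.rpow_le_one_of_one_le_of_nonpos hx' (by linarith)).trans (by linarith)
      gcongr

end Schwartz

end Pitt

namespace Pitt

open scoped ENNReal

/-! ### Differences of the Fourier transform, and conclusion -/

section Pitt

variable {n : ℕ} {β p q : ℝ}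

/-- The character `v ↦ e^{2πi w·v}`, shifted by `-1`. -/
noncomputable def expSubOne (w v : Eu n) : ℂ :=
  Complex.exp (2 * (Real.pi : ℂ) * Complex.I * ((inner ℝ w v : ℝ) : ℂ)) - 1

theorem continuous_expSubOne : Continuous (Function.uncurry (expSubOne (n := n))) := by
  unfold Function.uncurry expSubOne
  fun_prop

theorem contDiff_expSubOne (w : Eu n) : ContDiff ℝ (⊤ : ℕ∞) (expSubOne w) := by
  unfold expSubOne
  have h : ContDiff ℝ (⊤ : ℕ∞) fun v : Eu n => ((inner ℝ w v : ℝ) : ℂ) :=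
    Complex.ofRealCLM.contDiff.comp (contDiff_const.inner ℝ contDiff_id)
  exact (contDiff_const.mul h).cexp.sub contDiff_const

theorem norm_expSubOne_le_two (w v : Eu n) : ‖expSubOne w v‖ ≤ 2 := by
  have e : 2 * (Real.pi : ℂ) * Complex.I * ((inner ℝ w v : ℝ) : ℂ) =
      Complex.I * ((2 * Real.pi * inner ℝ w v : ℝ) : ℂ) := by push_cast; ring
  refine (norm_sub_le _ _).trans ?_
  rw [e, Complex.norm_exp_I_mul_ofReal, norm_one]
  norm_num

theorem integrable_expSubOne_mul {f : Eu n → ℂ} (hf : Integrable f) (w : Eu n) :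
    Integrable fun v => expSubOne w v * f v :=
  hf.bdd_mul (contDiff_expSubOne w).continuous.aestronglyMeasurable
    (.of_forall (norm_expSubOne_le_two w))

/-- Modulation becomes translation. This identity is what lets Hausdorff–Young act on the
differences occurring in the Hardy inequality. -/
theorem fourier_expSubOne_mul {f : Eu n → ℂ} (hf : Integrable f) (w x : Eu n) :
    𝓕 (fun v => expSubOne w v * f v) x = 𝓕 f (x - w) - 𝓕 f x := by
  have hint : ∀ y : Eu n, Integrable fun v : Eu n =>
      Complex.exp (((-2 * Real.pi * inner ℝ v y : ℝ) : ℂ) * Complex.I) • f v := fun y => by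
    refine hf.bdd_mul (c := 1) ?_ (.of_forall fun v => ?_)
    · exact Continuous.aestronglyMeasurable (by fun_prop)
    · rw [Complex.norm_exp_ofReal_mul_I]
  rw [Real.fourier_eq', Real.fourier_eq', Real.fourier_eq', ← integral_sub (hint _) (hint _)]
  refine integral_congr_ae (.of_forall fun v => ?_)
  have e : Complex.exp (((-2 * Real.pi * inner ℝ v (x - w) : ℝ) : ℂ) * Complex.I) =
      Complex.exp (((-2 * Real.pi * inner ℝ v x : ℝ) : ℂ) * Complex.I) *
        Complex.exp (2 * (Real.pi : ℂ) * Complex.I * ((inner ℝ w v : ℝ) : ℂ)) := by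
    rw [← Complex.exp_add, inner_sub_right, real_inner_comm v w]
    congr 1
    push_cast
    ring
  simp only [smul_eq_mul, e, expSubOne]
  ring

theorem lintegral_lintegral_fourier_sub_eq {F : Eu n → ℂ} (hF : Continuous F) (κ : ℝ) :
    ∫⁻ x, ∫⁻ y, ‖F x - F y‖ₑ ^ q * ENNReal.ofReal (‖x - y‖ ^ (-κ)) =
      ∫⁻ w, ENNReal.ofReal (‖w‖ ^ (-κ)) * ∫⁻ x, ‖F (x - w) - F x‖ₑ ^ q := by
  calc ∫⁻ x, ∫⁻ y, ‖F x - F y‖ₑ ^ q * ENNReal.ofReal (‖x - y‖ ^ (-κ))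
      = ∫⁻ x, ∫⁻ w, ENNReal.ofReal (‖w‖ ^ (-κ)) * ‖F (x - w) - F x‖ₑ ^ q := by
        refine lintegral_congr fun x => ?_
        rw [← lintegral_sub_left_eq_self _ x]
        refine lintegral_congr fun w => ?_
        rw [sub_sub_cancel, mul_comm, enorm_sub_rev]
    _ = ∫⁻ w, ∫⁻ x, ENNReal.ofReal (‖w‖ ^ (-κ)) * ‖F (x - w) - F x‖ₑ ^ q := by
        refine lintegral_lintegral_swap (Measurable.aemeasurable ?_)
        refine Measurable.mul (by fun_prop) (Measurable.pow_const ?_ _)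
        exact Continuous.measurable (by fun_prop)
    _ = _ := lintegral_congr fun w => lintegral_const_mul' _ _ ENNReal.ofReal_ne_top

theorem lintegral_enorm_expSubOne_mul_rpow (hq : 0 ≤ q) (z : ℂ) (ξ : Eu n) :
    ∫⁻ w, ENNReal.ofReal (‖w‖ ^ (-((n : ℝ) + q * β))) * ‖expSubOne w ξ * z‖ₑ ^ q =
      ‖z‖ₑ ^ q * ∫⁻ w, ENNReal.ofReal (diffKernel n β q ξ w) := by
  rw [← lintegral_const_mul' _ _ (ENNReal.rpow_ne_top_of_nonneg hq enorm_ne_top)]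
  refine lintegral_congr fun w => ?_
  rw [diffKernel_eq, ENNReal.ofReal_mul (by positivity),
    ← ENNReal.ofReal_rpow_of_nonneg (norm_nonneg _) hq, ofReal_norm, enorm_mul,
    ENNReal.mul_rpow_of_nonneg _ _ hq, expSubOne]
  ring

theorem lintegral_enorm_expSubOne_mul_le (hp : 1 ≤ p) (f : 𝓢(Eu n, ℂ)) (w : Eu n) :
    ∫⁻ ξ, ‖expSubOne w ξ * f ξ‖ₑ ^ p ≤ ENNReal.ofReal (min 1 ‖w‖ ^ p) *
      ENNReal.ofReal (∫ ξ, (2 * Real.pi) ^ p * ((1 + ‖ξ‖) * ‖f ξ‖) ^ p) := by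
  have hp0 : 0 ≤ p := by linarith
  rw [ofReal_integral_eq_lintegral_ofReal ((integrable_one_add_norm_mul_rpow f hp).const_mul _)
    (.of_forall fun ξ => by positivity), ← lintegral_const_mul' _ _ ENNReal.ofReal_ne_top]
  refine lintegral_mono fun ξ => ?_
  rw [← ENNReal.ofReal_mul (by positivity), ← Real.mul_rpow (by positivity) (by positivity),
    ← Real.mul_rpow (by positivity) (by positivity),
    ← ENNReal.ofReal_rpow_of_nonneg (by positivity) hp0, ← ofReal_norm]
  gcongr
  rw [norm_mul]
  calc ‖expSubOne w ξ‖ * ‖f ξ‖ ≤ (2 * Real.pi * (1 + ‖ξ‖) * min 1 ‖w‖) * ‖f ξ‖ := by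
        gcongr; exact norm_exp_inner_sub_one_le w ξ
    _ = _ := by ring

/-- Minkowski in L^{q/p} of the measure |w|^{−κ} dw moves the integral in w inside. For fixed ξ that
integral is computed exactly by scaling, and its power p/q yields |ξ|^{βp}. -/
theorem lintegral_rpow_lintegral_expSubOne_le [Nontrivial (Eu n)] (hβ0 : 0 < β) (hβ1 : β < 1)
    (hp : 1 ≤ p) (hpq : p ≤ q) (f : 𝓢(Eu n, ℂ)) {η : Eu n} (hη : ‖η‖ = 1) :
    ∫⁻ w, ENNReal.ofReal (‖w‖ ^ (-((n : ℝ) + q * β))) *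
        (∫⁻ ξ, ‖expSubOne w ξ * f ξ‖ₑ ^ p) ^ (q / p) ≤
      (∫⁻ w, ENNReal.ofReal (diffKernel n β q η w)) *
        (∫⁻ ξ, ENNReal.ofReal ((‖ξ‖ ^ β * ‖f ξ‖) ^ p)) ^ (q / p) := by
  have hp0 : 0 < p := by linarith
  have hq0 : 0 < q := by linarith
  have hr : 1 ≤ q / p := (one_le_div hp0).2 hpq
  have hr0 : 0 < q / p := by linarith
  have hf := f.continuous
  set κ : ℝ := n + q * β with hκ
  have hk : Measurable fun w : Eu n => ENNReal.ofReal (‖w‖ ^ (-κ)) := by fun_prop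
  set μ : Measure (Eu n) := volume.withDensity fun w => ENNReal.ofReal (‖w‖ ^ (-κ)) with hμ
  have hG : Measurable (Function.uncurry fun w ξ : Eu n => ‖expSubOne w ξ * f ξ‖ₑ ^ p) := by
    refine Measurable.pow_const ?_ _
    refine (Continuous.measurable ?_).enorm
    exact continuous_expSubOne.mul (hf.comp continuous_snd)
  have hwd : ∫⁻ w, ENNReal.ofReal (‖w‖ ^ (-κ)) * (∫⁻ ξ, ‖expSubOne w ξ * f ξ‖ₑ ^ p) ^ (q / p) =
      ∫⁻ w, (∫⁻ ξ, ‖expSubOne w ξ * f ξ‖ₑ ^ p) ^ (q / p) ∂μ :=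
    (lintegral_withDensity_eq_lintegral_mul _ hk (hG.lintegral_prod_right'.pow_const _)).symm
  -- Finiteness, required by Minkowski: |e^{2πi w·ξ} − 1| ≤ 2π (1 + |ξ|) min(1, |w|), and the
  -- Schwartz decay absorbs 1 + |ξ|.
  have hfin : ∫⁻ w, (∫⁻ ξ, ‖expSubOne w ξ * f ξ‖ₑ ^ p) ^ (q / p) ∂μ ≠ ⊤ := by
    rw [← hwd]
    set M := ENNReal.ofReal (∫ ξ, (2 * Real.pi) ^ p * ((1 + ‖ξ‖) * ‖f ξ‖) ^ p)
    have hM : M ^ (q / p) ≠ ⊤ := ENNReal.rpow_ne_top_of_nonneg hr0.le ENNReal.ofReal_ne_top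
    refine ne_top_of_le_ne_top (b := ∫⁻ w : Eu n,
      ENNReal.ofReal (min 1 ‖w‖ ^ q * ‖w‖ ^ (-κ)) * M ^ (q / p)) ?_ (lintegral_mono fun w => ?_)
    · rw [lintegral_mul_const' _ _ hM]
      refine ENNReal.mul_ne_top ?_ hM
      have := (integrable_min_rpow_mul_rpow (n := n) (q := q) (κ := κ)
        (by rw [hκ]; nlinarith) (by rw [hκ]; nlinarith))
      exact this.lintegral_lt_top.ne
    · calc _ ≤ ENNReal.ofReal (‖w‖ ^ (-κ)) * (ENNReal.ofReal (min 1 ‖w‖ ^ p) * M) ^ (q / p) := by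
            gcongr; exact lintegral_enorm_expSubOne_mul_le hp f w
        _ = _ := by
          rw [ENNReal.mul_rpow_of_nonneg _ _ hr0.le,
            ENNReal.ofReal_rpow_of_nonneg (by positivity) hr0.le, ← Real.rpow_mul (by positivity),
            mul_div_cancel₀ _ hp0.ne', ENNReal.ofReal_mul (by positivity)]
          ring
  have hmink := lintegral_lintegral_rpow_le (μ := μ) (ν := volume) hr hG hfin
  set D := ∫⁻ w, ENNReal.ofReal (diffKernel n β q η w) with hD
  set P := ∫⁻ ξ, ENNReal.ofReal ((‖ξ‖ ^ β * ‖f ξ‖) ^ p) with hP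
  have hinner : ∫⁻ ξ, (∫⁻ w, (‖expSubOne w ξ * f ξ‖ₑ ^ p) ^ (q / p) ∂μ) ^ (1 / (q / p)) =
      P * D ^ (p / q) := by
    have hDt : D ≠ ⊤ := (integrable_diffKernel hβ0 hβ1 hq0 η).lintegral_lt_top.ne
    rw [hP, ← lintegral_mul_const' _ _ (ENNReal.rpow_ne_top_of_nonneg (by positivity) hDt)]
    refine lintegral_congr_ae ((Measure.ae_ne volume 0).mono fun ξ hξ => ?_)
    have h1 : ∫⁻ w, (‖expSubOne w ξ * f ξ‖ₑ ^ p) ^ (q / p) ∂μ =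
        ‖f ξ‖ₑ ^ q * (ENNReal.ofReal (‖ξ‖ ^ (q * β)) * D) := by
      rw [← lintegral_diffKernel hη hξ, ← lintegral_enorm_expSubOne_mul_rpow hq0.le, hμ,
        lintegral_withDensity_eq_lintegral_mul _ hk (hG.of_uncurry_right.pow_const _)]
      refine lintegral_congr fun w => ?_
      simp only [Pi.mul_apply]
      rw [← ENNReal.rpow_mul, mul_div_cancel₀ _ hp0.ne']
    have hpq0 : 0 ≤ p / q := by positivity
    simp only []
    rw [h1, one_div_div, ENNReal.mul_rpow_of_nonneg _ _ hpq0, ENNReal.mul_rpow_of_nonneg _ _ hpq0,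
      ← ENNReal.rpow_mul, mul_div_cancel₀ _ hq0.ne',
      ENNReal.ofReal_rpow_of_nonneg (by positivity) hpq0, ← Real.rpow_mul (norm_nonneg _),
      Real.mul_rpow (by positivity) (norm_nonneg _), ← Real.rpow_mul (norm_nonneg _),
      ENNReal.ofReal_mul (by positivity), ← ENNReal.ofReal_rpow_of_nonneg (norm_nonneg _) hp0.le,
      ofReal_norm, ← mul_assoc, mul_comm (‖f ξ‖ₑ ^ p)]
    rw [show q * β * (p / q) = β * p by field_simp]
  rw [hinner, one_div_div] at hmink
  have := ENNReal.rpow_le_rpow hmink hr0.le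
  rw [← ENNReal.rpow_mul, div_mul_div_cancel₀ hq0.ne', div_self hp0.ne', ENNReal.rpow_one,
    ENNReal.mul_rpow_of_nonneg _ _ hr0.le, ← ENNReal.rpow_mul, div_mul_div_cancel₀ hq0.ne',
    div_self hp0.ne', ENNReal.rpow_one] at this
  rw [hwd, mul_comm D]
  exact this

theorem lintegral_lintegral_fourier_sub_le [Nontrivial (Eu n)] (hβ0 : 0 < β) (hβ1 : β < 1)
    (hp1 : 1 < p) (hp2 : p ≤ 2) (hpq : 1 / p + 1 / q = 1) (f : 𝓢(Eu n, ℂ)) {η : Eu n}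
    (hη : ‖η‖ = 1) :
    ∫⁻ x, ∫⁻ y, ‖𝓕 (f : Eu n → ℂ) x - 𝓕 (f : Eu n → ℂ) y‖ₑ ^ q *
        ENNReal.ofReal (‖x - y‖ ^ (-((n : ℝ) + q * β))) ≤
      ENNReal.ofReal (babenkoConst n p q ^ q) *
        ((∫⁻ w, ENNReal.ofReal (diffKernel n β q η w)) *
          (∫⁻ ξ, ENNReal.ofReal ((‖ξ‖ ^ β * ‖f ξ‖) ^ p)) ^ (q / p)) := by
  have hp0 : 0 < p := by linarith
  have hconj : p.HolderConjugate q := by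
    rw [Real.holderConjugate_iff]; exact ⟨hp1, by simpa using hpq⟩
  have hple : p ≤ q := by
    have := hconj.symm.lt
    have := hconj.sub_one_mul_conj
    nlinarith
  have hF : Continuous (𝓕 (f : Eu n → ℂ)) := (𝓕 f : 𝓢(Eu n, ℂ)).continuous
  rw [lintegral_lintegral_fourier_sub_eq hF]
  refine le_trans ?_ (mul_le_mul_right
    (lintegral_rpow_lintegral_expSubOne_le hβ0 hβ1 hp1.le hple f hη) _)
  rw [← lintegral_const_mul' _ _ ENNReal.ofReal_ne_top]
  refine lintegral_mono fun w => ?_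
  have hfp : ∫⁻ ξ, ‖expSubOne w ξ * f ξ‖ₑ ^ p ≠ ⊤ :=
    ne_top_of_le_ne_top (ENNReal.mul_ne_top ENNReal.ofReal_ne_top ENNReal.ofReal_ne_top)
      (lintegral_enorm_expSubOne_mul_le hp1.le f w)
  -- The modulated function is smooth but in general neither compactly supported nor of Gaussian
  -- type, which is why the inequality was extended to smooth functions in L¹ ∩ L^p.
  have h := sharpHY_of_contDiff hp1 hp2 hpq ((contDiff_expSubOne w).mul (f.smooth ⊤))
    (integrable_expSubOne_mul f.integrable w) hfp
  unfold SharpHY at h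
  simp only [fourier_expSubOne_mul f.integrable] at h
  rw [mul_left_comm]
  gcongr

theorem rpow_one_div_le_of_mul_le {E S B D P : ℝ} (hp0 : 0 < p) (hq0 : 0 < q) (hE : 0 < E)
    (hS : 0 ≤ S) (hB : 0 ≤ B) (hD : 0 ≤ D) (hP : 0 ≤ P)
    (h : ENNReal.ofReal E * ENNReal.ofReal S ≤
      ENNReal.ofReal (B ^ q) * (ENNReal.ofReal D * ENNReal.ofReal P ^ (q / p))) :
    S ^ (1 / q) ≤ B * (D ^ (1 / q) / E ^ (1 / q)) * P ^ (1 / p) := by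
  rw [ENNReal.ofReal_rpow_of_nonneg hP (by positivity), ← ENNReal.ofReal_mul hE.le,
    ← ENNReal.ofReal_mul hD, ← ENNReal.ofReal_mul (by positivity),
    ENNReal.ofReal_le_ofReal_iff (by positivity)] at h
  have h2 : (E * S) ^ (1 / q) ≤ (B ^ q * (D * P ^ (q / p))) ^ (1 / q) := by gcongr
  have e : q / p * (1 / q) = 1 / p := by field_simp
  rw [Real.mul_rpow hE.le hS, Real.mul_rpow (by positivity) (by positivity),
    Real.mul_rpow hD (by positivity), ← Real.rpow_mul hB, ← Real.rpow_mul hP,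
    mul_one_div_cancel hq0.ne', Real.rpow_one, e] at h2
  have hE' : 0 < E ^ (1 / q) := by positivity
  calc S ^ (1 / q) ≤ (B * (D ^ (1 / q) * P ^ (1 / p))) / E ^ (1 / q) := by
        rw [le_div_iff₀ hE', mul_comm]; exact h2
    _ = _ := by ring

end Pitt

end Pitt

theorem theorem10 (n : ℕ) (β p q : ℝ) (hβ0 : 0 < β) (hβ1 : β < 1)
    (hp1 : 1 < p) (hp2 : p ≤ 2) (hpq : 1 / p + 1 / q = 1) (hqβ : q * β < n)
    (η : EuclideanSpace ℝ (Fin n)) (hη : ‖η‖ = 1) :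
    -- the two integrals in `A` are finite, and the one in the denominator does not vanish
    Integrable (diffKernel n β q η) ∧
    Integrable (steinWeissKernel n β q η) ∧
    0 < ∫ x, steinWeissKernel n β q η x ∧
    -- Pitt's inequality, with both sides finite
    ∀ f : 𝓢(EuclideanSpace ℝ (Fin n), ℂ),
      Integrable (fun x => (‖x‖ ^ β * ‖f x‖) ^ p) ∧
      Integrable (fun x => (‖x‖ ^ (-β) * ‖𝓕 (f : EuclideanSpace ℝ (Fin n) → ℂ) x‖) ^ q) ∧
      (∫ x, (‖x‖ ^ (-β) * ‖𝓕 (f : EuclideanSpace ℝ (Fin n) → ℂ) x‖) ^ q) ^ (1 / q) ≤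
        pittConstant n β p q η * (∫ x, (‖x‖ ^ β * ‖f x‖) ^ p) ^ (1 / p) := by
  -- A unit vector exists only for n ≥ 1, so the dimension hypothesis is contained in `hη`.
  have := Pitt.nontrivial_of_norm_eq_one hη
  have hp0 : 0 < p := by linarith
  have hconj : p.HolderConjugate q := by
    rw [Real.holderConjugate_iff]; exact ⟨hp1, by simpa using hpq⟩
  have hq1 : 1 < q := hconj.symm.lt
  have hq0 : 0 < q := by linarith
  have iD := Pitt.integrable_diffKernel hβ0 hβ1 hq0 η
  have iE := Pitt.integrable_steinWeissKernel hβ0 hβ1 hq0 hqβ hη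
  have hE := Pitt.integral_steinWeissKernel_pos hβ0 hβ1 hq0 hqβ hη
  refine ⟨iD, iE, hE, fun f => ?_⟩
  have iP := Pitt.integrable_norm_rpow_mul_rpow f hβ0 hβ1 hp1.le
  have iS : Integrable fun x => (‖x‖ ^ (-β) * ‖𝓕 (f : EuclideanSpace ℝ (Fin n) → ℂ) x‖) ^ q :=
    Pitt.integrable_norm_rpow_neg_mul_rpow (𝓕 f) hβ0 hq1.le hqβ
  refine ⟨iP, iS, ?_⟩
  have hF : Continuous (𝓕 (f : EuclideanSpace ℝ (Fin n) → ℂ)) :=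
    (𝓕 f : 𝓢(EuclideanSpace ℝ (Fin n), ℂ)).continuous
  have eS : (∫⁻ x, ENNReal.ofReal (‖x‖ ^ (-(q * β))) *
      ‖𝓕 (f : EuclideanSpace ℝ (Fin n) → ℂ) x‖ₑ ^ q) =
      ENNReal.ofReal (∫ x, (‖x‖ ^ (-β) * ‖𝓕 (f : EuclideanSpace ℝ (Fin n) → ℂ) x‖) ^ q) := by
    rw [ofReal_integral_eq_lintegral_ofReal iS (.of_forall fun x => by positivity)]
    refine lintegral_congr fun x => ?_
    rw [Real.mul_rpow (by positivity) (norm_nonneg _), ← Real.rpow_mul (norm_nonneg _),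
      ENNReal.ofReal_mul (by positivity), ← ENNReal.ofReal_rpow_of_nonneg (norm_nonneg _) hq0.le,
      ofReal_norm, neg_mul, mul_comm β]
  -- Hardy from below and the Fourier estimate from above, joined at the double integral. The
  -- finiteness demanded by the Hardy inequality holds because 𝓕 f is Schwartz and qβ < n.
  have h := (Pitt.lintegral_steinWeissKernel_mul_le hη hβ0 hβ1 hq1.le hqβ hF
    (by rw [eS]; exact ENNReal.ofReal_ne_top)).trans
    (Pitt.lintegral_lintegral_fourier_sub_le hβ0 hβ1 hp1 hp2 hpq f hη)
  have hD : 0 ≤ ∫ w, diffKernel n β q η w :=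
    integral_nonneg fun w => Pitt.diffKernel_nonneg w η
  have hP : 0 ≤ ∫ x, (‖x‖ ^ β * ‖f x‖) ^ p := integral_nonneg fun x => by positivity
  have hS : 0 ≤ ∫ x, (‖x‖ ^ (-β) * ‖𝓕 (f : EuclideanSpace ℝ (Fin n) → ℂ) x‖) ^ q :=
    integral_nonneg fun x => by positivity
  have hB : 0 ≤ Pitt.babenkoConst n p q := by unfold Pitt.babenkoConst; positivity
  rw [eS, ← ofReal_integral_eq_lintegral_ofReal iE
      (.of_forall (Pitt.steinWeissKernel_nonneg η)),
    ← ofReal_integral_eq_lintegral_ofReal iD (.of_forall fun w => Pitt.diffKernel_nonneg w η),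
    ← ofReal_integral_eq_lintegral_ofReal iP (.of_forall fun x => by positivity)] at h
  rw [pittConstant, ← Pitt.babenkoConst]
  exact Pitt.rpow_one_div_le_of_mul_le hp0 hq0 hE hS hB hD hP h
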